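/- Let $D,d\ge 0$ be integers and consider bosonic modes $a_{\bm j,\ell}$, $\bm j\in\mathbb Z^D$, $\ell=1,\dots,d$, with $[a_{\bm j,\ell},a_{\bm j',\ell'}]=0$ and $[a_{\bm j,\ell},a^\dagger_{\bm j',\ell'}]=\delta_{\bm j\bm j'}\delta_{\ell\ell'}$. A translationally invariant quadratic bosonic Hamiltonian (QBH) is a formal sum $$H=\sum_{\bm j,\bm r,\ell,\ell'} a_{\bm j,\ell}^\dagger (K_{\bm r})_{\ell\ell'}a_{\bm j+\bm r,\ell'}+\tfrac12\big[a_{\bm j,\ell}^\dagger(\Delta_{\bm r})_{\ell\ell'}a^\dagger_{\bm j+\bm r,\ell'}+\mathrm{H.c.}\big],$$ with complex $d\times d$ matrices $K_{\bm r}=K_{-\bm r}^\dagger$, $\Delta_{\bm r}=\Delta_{-\bm r}^T$ that vanish for all but finitely many $\bm r\in\mathbb Z^D$. With $K(\bm k)=\sum_{\bm r}e^{i\bm k\cdot\bm r}K_{\bm r}$ and $\Delta(\bm k)=\sum_{\bm r}e^{i\bm k\cdot\bm r}\Delta_{\bm r}$, its Bloch dynamical matrix is $$g(\bm k)=\begin{pmatrix}K(\bm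 k)&\Delta(\bm k)\\-\Delta^*(-\bm k)&-K^*(-\bm k)\end{pmatrix},\qquad \bm k\in\mathrm{BZ}=[-\pi,\pi]^D .$$ $H$ is dynamically stable if $g(\bm k)$ is diagonalizable with real spectrum for every $\bm k\in\mathrm{BZ}$. The quasiparticle energies $\omega_1(\bm k),\dots,\omega_d(\bm k)$ are then the eigenvalues of $g(\bm k)$ with eigenvectors $v$ of positive Krein signature, $v^\dagger\tau_3v>0$, $\tau_3=\mathrm{diag}(1_d,-1_d)$. The direct and indirect Krein gaps are (for $d\ge1$) $$\Delta_{\rm Krein}=\min_{\bm k,m,n}|\omega_n(\bm k)+\omega_m(-\bm k)|,\qquad \Delta'_{\rm Krein}=\min_{\bm k,\bm k',m,n}|\omega_n(\bm k)+\omega_m(\bm k')| .$$ A state is a normalized positive linear functional $\langle\cdot\rangle$ on the $*$-algebra of polynomials in the $a_{\bm j,\ell},a^\dagger_{\bm j,\ell}$; it is translationally invariant if it is invariant under all lattice translations $a_{\bm j,\ell}\mapsto a_{\bm j+\bm r,\ell}$. A quasiparticle vacuum (QPV) of $H$ is a state that (a) is obtained from the Fock vacuum by a homogeneous Bogoliubov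 transformation, i.e. is annihilated by all annihilation operators of a complete set of bosonic modes that are linear combinations, with square-summable coefficients, of the $a_{\bm j,\ell}$ and $a_{\bm j,\ell}^\dagger$ (a bounded invertible linear transformation of $\ell^2$ coefficient vectors that preserves commutators and adjoints), and (b) is an eigenstate of $H$, i.e. $\langle[H,X]\rangle=0$ for all $X$ in the algebra. **Theorem.** Let $H$ be a dynamically stable, translationally invariant QBH. Then: (i) if $\Delta'_{\rm Krein}>0$, there exists a unique QPV of $H$, and it is translationally invariant; (ii) if $\Delta_{\rm Krein}>0$, there exists a unique translationally invariant QPV of $H$. -/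

import Mathlib

open scoped Matrix

noncomputable section

/-! ### The CCR algebra -/

/-- The value of the commutator of two generators: the left summand labels the annihilation
operators `a i`, the right summand the creation operators `a† i`. -/
def ccrForm {ι : Type} [DecidableEq ι] : ι ⊕ ι → ι ⊕ ι → ℂ
  | .inl i, .inr j => if i = j then 1 else 0
  | .inr i, .inl j => if i = j then -1 else 0
  | .inl _, .inl _ => 0
  | .inr _, .inr _ => 0

/-- The canonical commutation relations `x y = y x + [x, y]` between generators. -/
inductive CCRRel (ι : Type) [DecidableEq ι] :
    FreeAlgebra ℂ (ι ⊕ ι) → FreeAlgebra ℂ (ι ⊕ ι) → Prop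
  | ccr (s t : ι ⊕ ι) : CCRRel ι
      (FreeAlgebra.ι ℂ s * FreeAlgebra.ι ℂ t)
      (FreeAlgebra.ι ℂ t * FreeAlgebra.ι ℂ s + algebraMap ℂ _ (ccrForm s t))

/-- The unital algebra generated by `a i` and `a† i`, subject to the canonical commutation
relations: the polynomials in finitely many creation and annihilation operators. -/
def CCRAlgebra (ι : Type) [DecidableEq ι] : Type := RingQuot (CCRRel ι)

namespace CCRAlgebra

variable {ι : Type} [DecidableEq ι]

instance : Ring (CCRAlgebra ι) := inferInstanceAs (Ring (RingQuot (CCRRel ι)))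

instance : Algebra ℂ (CCRAlgebra ι) := inferInstanceAs (Algebra ℂ (RingQuot (CCRRel ι)))

/-- The Nambu array: `nambu (inl i) = a i` and `nambu (inr i) = a† i`. -/
def nambu (s : ι ⊕ ι) : CCRAlgebra ι := RingQuot.mkAlgHom ℂ (CCRRel ι) (FreeAlgebra.ι ℂ s)

/-- The annihilation operator of mode `i`. -/
def ann (i : ι) : CCRAlgebra ι := nambu (.inl i)

/-- The creation operator of mode `i`. -/
def cre (i : ι) : CCRAlgebra ι := nambu (.inr i)

theorem nambu_mul (s t : ι ⊕ ι) :
    (nambu s : CCRAlgebra ι) * nambu t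
      = nambu t * nambu s + algebraMap ℂ (CCRAlgebra ι) (ccrForm s t) := by
  have h := RingQuot.mkAlgHom_rel ℂ (CCRRel.ccr (ι := ι) s t)
  rw [map_mul, map_add, map_mul, AlgHom.commutes] at h
  exact h

/-- The universal property of the CCR algebra. -/
def lift {A : Type} [Ring A] [Algebra ℂ A] (f : ι ⊕ ι → A)
    (hf : ∀ s t, f s * f t = f t * f s + algebraMap ℂ A (ccrForm s t)) :
    CCRAlgebra ι →ₐ[ℂ] A :=
  RingQuot.liftAlgHom ℂ ⟨FreeAlgebra.lift ℂ f, by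
    rintro _ _ ⟨s, t⟩
    simpa using hf s t⟩

theorem lift_nambu {A : Type} [Ring A] [Algebra ℂ A] (f : ι ⊕ ι → A)
    (hf : ∀ s t, f s * f t = f t * f s + algebraMap ℂ A (ccrForm s t)) (s : ι ⊕ ι) :
    lift f hf (nambu s) = f s := by
  have h := RingQuot.liftAlgHom_mkAlgHom_apply ℂ (FreeAlgebra.lift ℂ f)
    (s := CCRRel ι) (by
      rintro _ _ ⟨s, t⟩
      simpa using hf s t) (FreeAlgebra.ι ℂ s)
  rw [FreeAlgebra.lift_ι_apply] at h
  exact h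

theorem algHom_ext {A : Type} [Ring A] [Algebra ℂ A] {f g : CCRAlgebra ι →ₐ[ℂ] A}
    (h : ∀ s, f (nambu s) = g (nambu s)) : f = g := by
  refine RingQuot.ringQuot_ext' ℂ f g (FreeAlgebra.hom_ext (funext fun s => ?_))
  exact h s

/-- The opposite of the CCR algebra with complex conjugated scalars, the target of the adjoint
seen as a linear multiplicative map. -/
def ConjOp (ι : Type) [DecidableEq ι] : Type := (CCRAlgebra ι)ᵐᵒᵖ

instance : Ring (ConjOp ι) := inferInstanceAs (Ring (CCRAlgebra ι)ᵐᵒᵖ)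

instance : Algebra ℂ (ConjOp ι) := Algebra.compHom (CCRAlgebra ι)ᵐᵒᵖ (starRingEnd ℂ)

/-- The adjoint, as an algebra homomorphism to the conjugate opposite algebra; it exchanges
`a i` and `a† i`. -/
def adj : CCRAlgebra ι →ₐ[ℂ] ConjOp ι :=
  lift (fun s => (MulOpposite.op (nambu s.swap) : (CCRAlgebra ι)ᵐᵒᵖ)) (by
    intro s t
    have h := nambu_mul (ι := ι) t.swap s.swap
    have h2 : ccrForm t.swap s.swap = starRingEnd ℂ (ccrForm s t) := by
      rcases s with i | i <;> rcases t with j | j <;> simp [ccrForm, eq_comm, apply_ite]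
    rw [h2] at h
    exact congrArg MulOpposite.op h)

theorem adj_nambu (s : ι ⊕ ι) :
    adj (nambu s) = (MulOpposite.op (nambu s.swap) : (CCRAlgebra ι)ᵐᵒᵖ) :=
  lift_nambu _ _ s

theorem adj_algebraMap (c : ℂ) : adj (algebraMap ℂ (CCRAlgebra ι) c)
    = (MulOpposite.op (algebraMap ℂ (CCRAlgebra ι) (starRingEnd ℂ c)) : (CCRAlgebra ι)ᵐᵒᵖ) :=
  adj.commutes c

instance : Star (CCRAlgebra ι) := ⟨fun X => MulOpposite.unop (adj X : (CCRAlgebra ι)ᵐᵒᵖ)⟩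

theorem star_def (X : CCRAlgebra ι) :
    star X = MulOpposite.unop (adj X : (CCRAlgebra ι)ᵐᵒᵖ) := rfl

theorem star_nambu (s : ι ⊕ ι) : star (nambu s : CCRAlgebra ι) = nambu s.swap := by
  rw [star_def, adj_nambu]; rfl

theorem star_algebraMap (c : ℂ) : star (algebraMap ℂ (CCRAlgebra ι) c)
    = algebraMap ℂ (CCRAlgebra ι) (starRingEnd ℂ c) := by
  rw [star_def, adj_algebraMap]; rfl

theorem star_mul_rev (X Y : CCRAlgebra ι) : star (X * Y) = star Y * star X := by
  simp only [star_def]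
  rw [map_mul]
  rfl

theorem star_add_eq (X Y : CCRAlgebra ι) : star (X + Y) = star X + star Y := by
  simp only [star_def]
  rw [map_add]
  rfl

theorem star_invol (X : CCRAlgebra ι) : star (star X) = X := by
  let f : CCRAlgebra ι →ₐ[ℂ] CCRAlgebra ι :=
    { toFun := fun X => star (star X)
      map_one' := by
        have h := star_algebraMap (ι := ι) 1
        simp only [map_one] at h
        rw [h, h]
      map_mul' := fun X Y => by rw [star_mul_rev, star_mul_rev]
      map_zero' := by
        have h := star_algebraMap (ι := ι) 0
        simp only [map_zero] at h
        rw [h, h]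
      map_add' := fun X Y => by rw [star_add_eq, star_add_eq]
      commutes' := fun c => by rw [star_algebraMap, star_algebraMap]; simp }
  have h : f = AlgHom.id ℂ _ := algHom_ext fun s => by
    change star (star (nambu s)) = nambu s
    rw [star_nambu, star_nambu, Sum.swap_swap]
  exact DFunLike.congr_fun h X

/-- The adjoint makes the CCR algebra a complex *-algebra. -/
instance : StarRing (CCRAlgebra ι) where
  star_involutive := star_invol
  star_mul := star_mul_rev
  star_add := star_add_eq

instance : StarModule ℂ (CCRAlgebra ι) where
  star_smul c X := by
    rw [Algebra.smul_def, star_mul_rev, star_algebraMap, Algebra.smul_def, Algebra.commutes]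
    rfl

/-- A bijection of the modes acts on the CCR algebra. -/
def relabel (e : ι ≃ ι) : CCRAlgebra ι →ₐ[ℂ] CCRAlgebra ι :=
  lift (fun s => nambu (Sum.map e e s)) (by
    intro s t
    rw [nambu_mul]
    congr 2
    rcases s with i | i <;> rcases t with j | j <;> simp [ccrForm])

end CCRAlgebra

/-! ### States, Bogoliubov transformations and quasiparticle vacua -/

/-- A state: a normalized positive linear functional on the CCR algebra. -/
structure CCRState (ι : Type) [DecidableEq ι] where
  /-- the expectation value -/
  expect : CCRAlgebra ι →ₗ[ℂ] ℂ
  normalized : expect 1 = 1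
  re_nonneg : ∀ X, 0 ≤ (expect (star X * X)).re
  im_eq_zero : ∀ X, (expect (star X * X)).im = 0

/-- The square-summable coefficient vectors `F` of the linear expressions
`φ(F) = ∑ i, (F (inl i) a i + F (inr i) a† i)` in the creation and annihilation operators. -/
abbrev NambuSpace (ι : Type) : Type := lp (fun _ : ι ⊕ ι => ℂ) 2

namespace NambuSpace

variable {ι : Type}

/-- The coefficients of the adjoint: `φ(F)† = φ(conj F)`. -/
def conj (F : NambuSpace ι) : NambuSpace ι :=
  ⟨fun s => starRingEnd ℂ (F s.swap), by
    have h := (memℓp_gen_iff (p := 2) (by norm_num)).1 (lp.memℓp F)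
    refine memℓp_gen ?_
    simpa [Function.comp_def] using (Equiv.sumComm ι ι).summable_iff.2 h⟩

/-- The commutator: `[φ(F), φ(G)] = commutator F G`. -/
def commutator (F G : NambuSpace ι) : ℂ :=
  ∑' i : ι, (F (.inl i) * G (.inr i) - F (.inr i) * G (.inl i))

/-- The coefficient vectors of linear combinations of annihilation operators only. -/
def IsAnnihilation (F : NambuSpace ι) : Prop := ∀ i : ι, F (.inr i) = 0

end NambuSpace

/-- A (homogeneous) Bogoliubov transformation. The new modes are `β(f) = φ(B f)` for `f` with
`IsAnnihilation f`, in particular `β i = φ(B (single (inl i) 1))`; they obey the canonical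
commutation relations and are complete (`B` is onto). If the new Nambu array is
`ψ = L⁻¹ φ`, then `B` is the transpose of `L⁻¹`, and the two laws say
`L* = τ₁ L τ₁` and `L† τ₃ L = τ₃`. -/
structure Bogoliubov (ι : Type) where
  /-- the transformation of coefficient vectors -/
  B : NambuSpace ι ≃L[ℂ] NambuSpace ι
  map_commutator : ∀ F G, (B F).commutator (B G) = F.commutator G
  map_conj : ∀ F, B F.conj = (B F).conj

namespace CCRState

variable {ι : Type} [DecidableEq ι]

/-- `φ(F)` annihilates the state: `⟨X φ(F)⟩ = 0` for all `X`. -/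
def AnnihilatedBy (ω : CCRState ι) (F : NambuSpace ι) : Prop :=
  ∀ X : CCRAlgebra ι, HasSum (fun s => F s * ω.expect (X * CCRAlgebra.nambu s)) 0

/-- A quasiparticle vacuum, irrespective of a Hamiltonian: the image of the Fock vacuum under a
Bogoliubov transformation, i.e. the state annihilated by all the transformed annihilation
operators. -/
def IsQuasiparticleVacuum (ω : CCRState ι) : Prop :=
  ∃ T : Bogoliubov ι, ∀ f : NambuSpace ι, f.IsAnnihilation → ω.AnnihilatedBy (T.B f)

end CCRState

/-! ### Translationally invariant quadratic bosonic Hamiltonians -/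

/-- The modes: `d` bosons at each site of the lattice `ℤ^D`. -/
abbrev LatticeMode (D d : ℕ) : Type := (Fin D → ℤ) × Fin d

/-- The lattice translation by `r`, `a (j, ℓ) ↦ a (j + r, ℓ)`, as an automorphism. -/
def latticeTranslate {D d : ℕ} (r : Fin D → ℤ) :
    CCRAlgebra (LatticeMode D d) →ₐ[ℂ] CCRAlgebra (LatticeMode D d) :=
  CCRAlgebra.relabel ((Equiv.addRight r).prodCongr (Equiv.refl (Fin d)))

/-- Translationally invariant states. -/
def CCRState.TranslationInvariant {D d : ℕ} (ω : CCRState (LatticeMode D d)) : Prop :=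
  ∀ (r : Fin D → ℤ) (X : CCRAlgebra (LatticeMode D d)), ω.expect (latticeTranslate r X) = ω.expect X

/-- A translationally invariant quadratic bosonic Hamiltonian of finite range on `ℤ^D`, with `d`
bosons per site: hopping matrices `K r` and pairing matrices `Δ r`, zero for all but finitely
many `r`. -/
structure QBH (D d : ℕ) where
  /-- hopping matrices -/
  K : (Fin D → ℤ) →₀ Matrix (Fin d) (Fin d) ℂ
  /-- pairing matrices -/
  Δ : (Fin D → ℤ) →₀ Matrix (Fin d) (Fin d) ℂ
  K_adj : ∀ r, (K r)ᴴ = K (-r)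
  Δ_transpose : ∀ r, (Δ r)ᵀ = Δ (-r)

namespace QBH

variable {D d : ℕ} (H : QBH D d)

open CCRAlgebra in
/-- The terms of the Hamiltonian that start at the site `j`. -/
def siteTerm (j : Fin D → ℤ) : CCRAlgebra (LatticeMode D d) :=
  (H.K.sum fun r M => ∑ ℓ, ∑ ℓ', M ℓ ℓ' • (cre (j, ℓ) * ann (j + r, ℓ')))
  + (1 / 2 : ℂ) • (H.Δ.sum fun r M => ∑ ℓ, ∑ ℓ',
      (M ℓ ℓ' • (cre (j, ℓ) * cre (j + r, ℓ'))
        + star (M ℓ ℓ' • (cre (j, ℓ) * cre (j + r, ℓ')))))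

/-- The partial sum over the sites in `S` of the formal infinite sum `H`. -/
def partialSum (S : Finset (Fin D → ℤ)) : CCRAlgebra (LatticeMode D d) := ∑ j ∈ S, H.siteTerm j

/-- Eigenstates of `H` in infinite volume: `⟨[H, X]⟩ = 0` for every `X`, where `[H, X]` is the
eventually constant value of the commutators with the partial sums of `H`. -/
def IsEigenstate (ω : CCRState (LatticeMode D d)) : Prop :=
  ∀ X : CCRAlgebra (LatticeMode D d), ∀ᶠ S in (Filter.atTop : Filter (Finset (Fin D → ℤ))),
    ω.expect (H.partialSum S * X - X * H.partialSum S) = 0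

/-- A quasiparticle vacuum (QPV) of `H`. -/
def IsQPV (ω : CCRState (LatticeMode D d)) : Prop :=
  ω.IsQuasiparticleVacuum ∧ H.IsEigenstate ω

/-- The Fourier transform `∑ r, e^{i k·r} M r`. -/
def fourier (M : (Fin D → ℤ) →₀ Matrix (Fin d) (Fin d) ℂ) (k : Fin D → ℝ) :
    Matrix (Fin d) (Fin d) ℂ :=
  M.sum fun r A => Complex.exp (Complex.I * ((∑ i, k i * (r i : ℝ) : ℝ) : ℂ)) • A

/-- The Bloch dynamical matrix. -/
def bloch (k : Fin D → ℝ) : Matrix (Fin d ⊕ Fin d) (Fin d ⊕ Fin d) ℂ :=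
  Matrix.fromBlocks (fourier H.K k) (fourier H.Δ k)
    (-(fourier H.Δ (-k)).map (starRingEnd ℂ)) (-(fourier H.K (-k)).map (starRingEnd ℂ))

/-- The first Brillouin zone `[-π, π]^D`. -/
def brillouinZone (D : ℕ) : Set (Fin D → ℝ) := {k | ∀ i, k i ∈ Set.Icc (-Real.pi) Real.pi}

/-- Dynamical stability: all Bloch dynamical matrices are diagonalizable with real spectrum. -/
def DynamicallyStable : Prop :=
  ∀ k ∈ brillouinZone D, ∃ (P : Matrix (Fin d ⊕ Fin d) (Fin d ⊕ Fin d) ℂ)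
    (ev : Fin d ⊕ Fin d → ℝ),
    IsUnit P ∧ H.bloch k * P = P * Matrix.diagonal fun s => (ev s : ℂ)

/-- The Krein form `v† τ₃ v`, a real number. -/
def kreinForm (v : Fin d ⊕ Fin d → ℂ) : ℝ :=
  ∑ n, ‖v (.inl n)‖ ^ 2 - ∑ n, ‖v (.inr n)‖ ^ 2

/-- The set `{ω₁(k), …, ω_d(k)}` of quasiparticle energies at momentum `k`: the eigenvalues of
the Bloch dynamical matrix that have an eigenvector of Krein signature `+1`. -/
def quasiparticleEnergies (k : Fin D → ℝ) : Set ℝ :=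
  {w | ∃ v : Fin d ⊕ Fin d → ℂ, H.bloch k *ᵥ v = (w : ℂ) • v ∧ 0 < kreinForm v}

/-- The direct Krein gap, the minimum of `|ω_n(k) + ω_m(-k)|`. -/
def kreinGap : ℝ :=
  sInf {x | ∃ k ∈ brillouinZone D, ∃ w ∈ H.quasiparticleEnergies k,
    ∃ w' ∈ H.quasiparticleEnergies (-k), x = |w + w'|}

/-- The indirect Krein gap, the minimum of `|ω_n(k) + ω_m(k')|`. -/
def indirectKreinGap : ℝ :=
  sInf {x | ∃ k ∈ brillouinZone D, ∃ k' ∈ brillouinZone D, ∃ w ∈ H.quasiparticleEnergies k,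
    ∃ w' ∈ H.quasiparticleEnergies k', x = |w + w'|}

end QBH

end

/-!
A quasiparticle vacuum is determined by the fundamental symmetry `S` (`S² = 1` and `τ₃ S > 0`) of
the Krein space of coefficient vectors that is `1` on the annihilation operators and `-1` on the
creation operators of its modes. Conversely, each fundamental symmetry that anticommutes with
taking adjoints belongs to exactly one vacuum: existence is Wick's theorem, positivity being
inherited from Fock spaces, and for uniqueness the annihilation operators can be commuted to the
right. The vacuum is invariant under `[H, ·]`, or under translations, iff `S` commutes with the
operator by which these act on the coefficient vectors.

Two commuting fundamental symmetries coincide, so it suffices to find one with which every such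
`S` commutes. Under either gap condition no eigenvalue of a Bloch matrix has eigenvectors of both
signs, hence the sign of the Bloch matrix with respect to the Krein form is a fundamental symmetry,
and by rigidity it is continuous in the momentum. Its Fourier transform `S₀` is a fundamental
symmetry that commutes with `[H, ·]` and with translations, and gives the translationally invariant
vacuum. By a partition of unity on the torus, `S₀` lies in the closed algebra generated by `[H, ·]`
and translations, so every translationally invariant `S` commutes with it. Under the indirect gap,
the sign is one and the same continuous function of all Bloch matrices; by Weierstrass, `S₀` then
lies in the closed algebra generated by `[H, ·]` alone, and every `S` commutes with it.
-/

noncomputable section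

section CStarAlgebra

open scoped Ring

variable {A : Type*} [CStarAlgebra A] [PartialOrder A]

/-- The fundamental symmetries `S` of the Krein space whose indefinite inner product is given by
the self-adjoint involution `J`: `S` is an involution, and `⟨x, J S x⟩` is positive. The eigenspaces
of `S` for `1` and `-1` are the positive and the negative part of a fundamental decomposition. We
phrase this in a C⋆-algebra, so that it applies to operators, matrices and matrix functions. -/
structure IsFundamentalSymmetry (J S : A) : Prop where
  mul_self : S * S = 1
  nonneg : 0 ≤ J * S

namespace IsFundamentalSymmetry

variable {J S S' : A}

/-- The unit `J S`. -/
def unit (hS : IsFundamentalSymmetry J S) (hJ : J * J = 1) : Aˣ where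
  val := J * S
  inv := S * J
  val_inv := by rw [mul_assoc, ← mul_assoc S, hS.mul_self, one_mul, hJ]
  inv_val := by rw [mul_assoc, ← mul_assoc J, hJ, one_mul, hS.mul_self]

variable [StarOrderedRing A]

theorem isUnit_sqrt (hS : IsFundamentalSymmetry J S) (hJ : J * J = 1) :
    IsUnit (CFC.sqrt (J * S)) :=
  (CFC.isUnit_sqrt_iff _ hS.nonneg).2 (hS.unit hJ).isUnit

/-- Both sides are positive, with square `S J`. -/
theorem conj_sqrt (hS : IsFundamentalSymmetry J S) (hJ : J * J = 1) (hJ_star : IsSelfAdjoint J) :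
    J * CFC.sqrt (J * S) * J = (CFC.sqrt (J * S))⁻¹ʳ := by
  set R := CFC.sqrt (J * S)
  have hconj : 0 ≤ J * R * J := by
    simpa only [hJ_star.star_eq] using star_left_conjugate_nonneg (CFC.sqrt_nonneg (J * S)) J
  have hsq : J * R * J * (J * R * J) = S * J := by
    calc J * R * J * (J * R * J) = J * R * (J * J) * R * J := by noncomm_ring
      _ = J * (R * R) * J := by rw [hJ]; noncomm_ring
      _ = (J * J) * S * J := by rw [CFC.sqrt_mul_sqrt_self _ hS.nonneg]; noncomm_ring
      _ = S * J := by rw [hJ, one_mul]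
  rw [← CFC.sqrt_unique hsq hconj, ← CFC.sqrt_ringInverse]
  exact congrArg CFC.sqrt (Ring.inverse_unit (hS.unit hJ)).symm

/-- The element `J S` is a positive unit, and the involution `(J S)⁻¹ (J S') = S S'` is similar to a
positive element. -/
theorem eq_of_commute (hS : IsFundamentalSymmetry J S) (hS' : IsFundamentalSymmetry J S')
    (hJ : J * J = 1) (h : Commute S S') : S = S' := by
  set R := CFC.sqrt (J * S)
  have hRR : R * R = J * S := CFC.sqrt_mul_sqrt_self _ hS.nonneg
  have hR : IsUnit R := hS.isUnit_sqrt hJ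
  set Q := R * (S * S') * R⁻¹ʳ with hQ_def
  have hQ_eq : Q = R⁻¹ʳ * (J * S') * R⁻¹ʳ := by
    calc Q = R⁻¹ʳ * R * R * (S * S') * R⁻¹ʳ := by rw [Ring.inverse_mul_cancel _ hR, one_mul]
      _ = R⁻¹ʳ * (R * R) * S * S' * R⁻¹ʳ := by noncomm_ring
      _ = R⁻¹ʳ * J * (S * S) * S' * R⁻¹ʳ := by rw [hRR]; noncomm_ring
      _ = R⁻¹ʳ * (J * S') * R⁻¹ʳ := by rw [hS.mul_self]; noncomm_ring
  have hQ_nonneg : 0 ≤ Q := by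
    have hR_star : star R = R := (IsSelfAdjoint.of_nonneg (CFC.sqrt_nonneg _)).star_eq
    have := star_left_conjugate_nonneg hS'.nonneg R⁻¹ʳ
    rwa [← Ring.inverse_star, hR_star, ← hQ_eq] at this
  have hQQ : Q * Q = 1 := by
    calc Q * Q
      _ = R * S * S' * (R⁻¹ʳ * R) * S * S' * R⁻¹ʳ := by simp only [hQ_def, mul_assoc]
      _ = R * S * (S' * S) * S' * R⁻¹ʳ := by
        rw [Ring.inverse_mul_cancel _ hR, mul_one, mul_assoc (R * S)]
      _ = R * (S * S) * (S' * S') * R⁻¹ʳ := by rw [← h.eq]; noncomm_ring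
      _ = 1 := by rw [hS.mul_self, hS'.mul_self, mul_one, mul_one, Ring.mul_inverse_cancel _ hR]
  have hQ_one : Q = 1 := by rw [← CFC.sqrt_mul_self Q, hQQ, CFC.sqrt_one]
  have hSS' : S * S' = 1 := by
    calc S * S' = R⁻¹ʳ * R * (S * S') * (R⁻¹ʳ * R) := by simp [Ring.inverse_mul_cancel _ hR]
      _ = R⁻¹ʳ * Q * R := by simp only [hQ_def, mul_assoc]
      _ = 1 := by rw [hQ_one, mul_one, Ring.inverse_mul_cancel _ hR]
  exact left_inv_eq_right_inv hS.mul_self hSS'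

theorem exists_sqrt (hS : IsFundamentalSymmetry J S) (hJ : J * J = 1) (hJ_star : IsSelfAdjoint J) :
    ∃ R : A, 0 ≤ R ∧ R * R = J * S ∧ J * R * J * R = 1 ∧ R * (J * R * J) = 1 := by
  refine ⟨CFC.sqrt (J * S), CFC.sqrt_nonneg _, CFC.sqrt_mul_sqrt_self _ hS.nonneg, ?_, ?_⟩
  · rw [hS.conj_sqrt hJ hJ_star, Ring.inverse_mul_cancel _ (hS.isUnit_sqrt hJ)]
  · rw [hS.conj_sqrt hJ hJ_star, Ring.mul_inverse_cancel _ (hS.isUnit_sqrt hJ)]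

end IsFundamentalSymmetry

theorem eq_of_nonneg_of_mul_self_eq [StarOrderedRing A] {a b : A} (ha : 0 ≤ a) (hb : 0 ≤ b)
    (h : a * a = b * b) : a = b := by
  rw [← CFC.sqrt_mul_self a, h, CFC.sqrt_mul_self b]

end CStarAlgebra

section Involution

variable {E : Type*} [NormedAddCommGroup E] [NormedSpace ℂ E] {S : E →L[ℂ] E}

/-- The projection to the eigenspace for `-1` of an involution `S`; the complementary projection,
to the eigenspace for `1`, is `F ↦ F - negProj S F`. -/
def negProj (S : E →L[ℂ] E) : E →L[ℂ] E := (1 / 2 : ℂ) • (1 - S)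

theorem negProj_apply (F : E) : negProj S F = (1 / 2 : ℂ) • (F - S F) := rfl

theorem negProj_eq_zero_iff {F : E} : negProj S F = 0 ↔ S F = F := by
  rw [negProj_apply, smul_eq_zero_iff_right (by norm_num), sub_eq_zero, eq_comm]

theorem map_negProj (hS : S * S = 1) (F : E) : S (negProj S F) = -negProj S F := by
  have hSF : S (S F) = F := DFunLike.congr_fun hS F
  rw [negProj_apply, map_smul, map_sub, hSF, ← smul_neg, neg_sub]

theorem map_sub_negProj (hS : S * S = 1) (F : E) : S (F - negProj S F) = F - negProj S F := by
  rw [map_sub, map_negProj hS, negProj_apply]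
  module

end Involution

namespace NambuSpace

open scoped InnerProductSpace

variable {ι : Type}

section Basis

variable [DecidableEq ι]

/-- The coefficient vector of a single generator. -/
def basisVec (s : ι ⊕ ι) : NambuSpace ι := lp.single 2 s (1 : ℂ)

theorem basisVec_apply (s t : ι ⊕ ι) : (basisVec s : NambuSpace ι) t = if t = s then 1 else 0 := by
  simp [basisVec, lp.single_apply, Pi.single_apply]

theorem hasSum_basisVec (F : NambuSpace ι) : HasSum (fun s => F s • basisVec s) F := by
  simpa only [basisVec, ← lp.single_smul, smul_eq_mul, mul_one] using
    lp.hasSum_single ENNReal.ofNat_ne_top F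

theorem hasSum_map_basisVec {E : Type*} [NormedAddCommGroup E] [NormedSpace ℂ E]
    (A : NambuSpace ι →L[ℂ] E) (F : NambuSpace ι) :
    HasSum (fun s => F s • A (basisVec s)) (A F) := by
  simpa only [map_smul] using (hasSum_basisVec F).mapL A

theorem clm_ext {E : Type*} [NormedAddCommGroup E] [NormedSpace ℂ E]
    {A A' : NambuSpace ι →L[ℂ] E} (h : ∀ s, A (basisVec s) = A' (basisVec s)) : A = A' := by
  ext1 F
  refine (hasSum_map_basisVec A F).unique ?_
  simpa only [h] using hasSum_map_basisVec A' F

theorem inner_basisVec (s : ι ⊕ ι) (F : NambuSpace ι) : ⟪basisVec s, F⟫_ℂ = F s := by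
  simp [basisVec, lp.inner_single_left]

end Basis

theorem conj_apply (F : NambuSpace ι) (s : ι ⊕ ι) : F.conj s = starRingEnd ℂ (F s.swap) := rfl

theorem conj_conj (F : NambuSpace ι) : F.conj.conj = F := by
  ext s; simp [conj_apply]

theorem conj_add (F G : NambuSpace ι) : (F + G).conj = F.conj + G.conj := by
  ext s; simp [conj_apply]

theorem conj_smul (c : ℂ) (F : NambuSpace ι) : (c • F).conj = starRingEnd ℂ c • F.conj := by
  ext s; simp [conj_apply]

theorem conj_neg (F : NambuSpace ι) : (-F).conj = -F.conj := by
  ext s; simp [conj_apply]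

theorem conj_sum {κ : Type*} (S : Finset κ) (F : κ → NambuSpace ι) :
    (∑ i ∈ S, F i).conj = ∑ i ∈ S, (F i).conj :=
  map_sum (AddMonoidHom.mk' conj conj_add) F S

theorem inner_conj_conj (F G : NambuSpace ι) : ⟪F.conj, G.conj⟫_ℂ = ⟪G, F⟫_ℂ := by
  rw [lp.inner_eq_tsum, lp.inner_eq_tsum, ← (Equiv.sumComm ι ι).tsum_eq]
  exact tsum_congr fun s => by simp [conj_apply, mul_comm]

theorem norm_conj (F : NambuSpace ι) : ‖F.conj‖ = ‖F‖ := by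
  simp only [norm_eq_sqrt_re_inner (𝕜 := ℂ), inner_conj_conj]

theorem conj_basisVec [DecidableEq ι] (s : ι ⊕ ι) :
    (basisVec s : NambuSpace ι).conj = basisVec s.swap := by
  ext t
  have : t.swap = s ↔ t = s.swap :=
    ⟨fun h => by rw [← h, Sum.swap_swap], fun h => by rw [h, Sum.swap_swap]⟩
  simp [conj_apply, basisVec_apply, this, apply_ite]

/-- The conjugate of an operator by the antiunitary `conj`, which stands for taking adjoints of
linear expressions in the generators. -/
def conjOp (A : NambuSpace ι →L[ℂ] NambuSpace ι) : NambuSpace ι →L[ℂ] NambuSpace ι :=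
  LinearMap.mkContinuous
    { toFun := fun F => (A F.conj).conj
      map_add' := fun F G => by rw [conj_add, map_add, conj_add]
      map_smul' := fun c F => by rw [conj_smul, map_smul, conj_smul]; simp } ‖A‖ fun F => by
    simpa [norm_conj] using A.le_opNorm F.conj

theorem conjOp_apply (A : NambuSpace ι →L[ℂ] NambuSpace ι) (F : NambuSpace ι) :
    conjOp A F = (A F.conj).conj := rfl

theorem conjOp_mul (A A' : NambuSpace ι →L[ℂ] NambuSpace ι) :
    conjOp (A * A') = conjOp A * conjOp A' := by
  ext1 F; simp [conjOp_apply, conj_conj]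

theorem conjOp_one : conjOp (1 : NambuSpace ι →L[ℂ] NambuSpace ι) = 1 := by
  ext1 F; simp [conjOp_apply, conj_conj]

theorem map_conj_of_conjOp_eq {A : NambuSpace ι →L[ℂ] NambuSpace ι} {ε : ℂ}
    (hA : conjOp A = ε • A) (F : NambuSpace ι) : A F.conj = starRingEnd ℂ ε • (A F).conj := by
  rw [← conj_smul, ← smul_apply, ← hA, conjOp_apply, conj_conj]

theorem map_conj_of_conjOp_eq_neg {S : NambuSpace ι →L[ℂ] NambuSpace ι} (hS : conjOp S = -S)
    (F : NambuSpace ι) : S F.conj = -(S F).conj := by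
  simpa using map_conj_of_conjOp_eq (ε := -1) (by rw [hS, neg_one_smul]) F

theorem map_conj_eq_self {S : NambuSpace ι →L[ℂ] NambuSpace ι} (hS : conjOp S = -S)
    {F : NambuSpace ι} (hF : S F = -F) : S F.conj = F.conj := by
  rw [map_conj_of_conjOp_eq_neg hS, hF, conj_neg, neg_neg]

/-- An operator that preserves the positive part of `S` also preserves the negative part, which is
its conjugate. -/
theorem commute_of_map_eq_self {S A : NambuSpace ι →L[ℂ] NambuSpace ι} {ε : ℂ} (hS : S * S = 1)
    (hSc : conjOp S = -S) (hA : conjOp A = ε • A) (h : ∀ F, S F = F → S (A F) = A F) :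
    Commute S A := by
  have h_neg : ∀ F, S F = -F → S (A F) = -A F := by
    intro F hF
    rw [← conj_conj F, map_conj_of_conjOp_eq hA, map_smul, map_conj_of_conjOp_eq_neg hSc,
      h _ (map_conj_eq_self hSc hF), smul_neg]
  ext1 F
  have hp := h (F - negProj S F) (map_sub_negProj hS F)
  have hn := h_neg (negProj S F) (map_negProj hS F)
  simp only [negProj_apply, map_smul, map_sub] at hp hn
  change S (A F) = A (S F)
  linear_combination (norm := module) hp + hn

theorem conjOp_nonneg {A : NambuSpace ι →L[ℂ] NambuSpace ι} (hA : 0 ≤ A) : 0 ≤ conjOp A := by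
  rw [ContinuousLinearMap.nonneg_iff_isPositive, ContinuousLinearMap.isPositive_iff_complex] at *
  intro F
  have hinner : ⟪conjOp A F, F⟫_ℂ = starRingEnd ℂ ⟪A F.conj, F.conj⟫_ℂ := by
    rw [conjOp_apply, inner_conj_symm, ← inner_conj_conj, conj_conj]
  obtain ⟨hreal, hnonneg⟩ := hA F.conj
  rw [hinner, ← hreal]
  simpa using hnonneg

/-- The diagonal of `τ₃`: `1` on annihilation operators, `-1` on creation operators. -/
def kreinSign : ι ⊕ ι → ℂ
  | .inl _ => 1
  | .inr _ => -1

theorem kreinSign_mul_self (s : ι ⊕ ι) : kreinSign s * kreinSign s = 1 := by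
  rcases s with _ | _ <;> simp [kreinSign]

theorem kreinSign_swap (s : ι ⊕ ι) : kreinSign s.swap = -kreinSign s := by
  rcases s with _ | _ <;> simp [kreinSign]

theorem conj_kreinSign (s : ι ⊕ ι) : starRingEnd ℂ (kreinSign s) = kreinSign s := by
  rcases s with _ | _ <;> simp [kreinSign]

theorem norm_kreinSign (s : ι ⊕ ι) : ‖kreinSign s‖ = 1 := by
  rcases s with _ | _ <;> simp [kreinSign]

/-- The operator `τ₃` on coefficient vectors; it turns the inner product into the Krein form. -/
def kreinOp : NambuSpace ι →L[ℂ] NambuSpace ι :=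
  LinearIsometry.toContinuousLinearMap
    { toFun := fun F => ⟨fun s => kreinSign s * F s, by
        have h := (memℓp_gen_iff (p := 2) (by norm_num)).1 (lp.memℓp F)
        refine memℓp_gen ?_
        simpa [norm_kreinSign] using h⟩
      map_add' := fun F G => by ext s; exact mul_add _ _ _
      map_smul' := fun c F => by ext s; exact mul_left_comm _ _ _
      norm_map' := fun F => by
        rw [lp.norm_eq_tsum_rpow (by norm_num), lp.norm_eq_tsum_rpow (by norm_num)]
        simp [norm_kreinSign] }

theorem kreinOp_apply (F : NambuSpace ι) (s : ι ⊕ ι) : kreinOp F s = kreinSign s * F s := rfl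

theorem kreinOp_basisVec [DecidableEq ι] (s : ι ⊕ ι) :
    kreinOp (basisVec s : NambuSpace ι) = kreinSign s • basisVec s := by
  ext t
  rw [kreinOp_apply, lp.coeFn_smul, Pi.smul_apply, smul_eq_mul, basisVec_apply]
  split_ifs with h
  · rw [h]
  · rw [mul_zero, mul_zero]

theorem kreinOp_mul_self : (kreinOp : NambuSpace ι →L[ℂ] NambuSpace ι) * kreinOp = 1 := by
  ext F s
  simp [kreinOp_apply, ← mul_assoc, kreinSign_mul_self]

theorem kreinOp_kreinOp (F : NambuSpace ι) : kreinOp (kreinOp F) = F :=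
  DFunLike.congr_fun kreinOp_mul_self F

theorem kreinOp_conj (F : NambuSpace ι) : kreinOp F.conj = -(kreinOp F).conj := by
  ext s
  simp [kreinOp_apply, conj_apply, conj_kreinSign, kreinSign_swap]

theorem conjOp_kreinOp : conjOp (kreinOp : NambuSpace ι →L[ℂ] NambuSpace ι) = -kreinOp := by
  ext1 F
  simp [conjOp_apply, kreinOp_conj, conj_neg, conj_conj]

theorem inner_kreinOp_left (F G : NambuSpace ι) : ⟪kreinOp F, G⟫_ℂ = ⟪F, kreinOp G⟫_ℂ := by
  rw [lp.inner_eq_tsum, lp.inner_eq_tsum]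
  refine tsum_congr fun s => ?_
  simp only [RCLike.inner_apply, kreinOp_apply, map_mul, conj_kreinSign]
  ring

theorem isSelfAdjoint_kreinOp : IsSelfAdjoint (kreinOp : NambuSpace ι →L[ℂ] NambuSpace ι) := by
  rw [ContinuousLinearMap.isSelfAdjoint_iff', eq_comm, ContinuousLinearMap.eq_adjoint_iff]
  exact inner_kreinOp_left

theorem commutator_eq_inner (F G : NambuSpace ι) : F.commutator G = ⟪G.conj, kreinOp F⟫_ℂ := by
  have h := lp.hasSum_inner (𝕜 := ℂ) G.conj (kreinOp F)
  have hl := h.summable.comp_injective (Sum.inl_injective (α := ι) (β := ι))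
  have hr := h.summable.comp_injective (Sum.inr_injective (α := ι) (β := ι))
  rw [commutator, ← h.tsum_eq, Summable.tsum_sum hl hr,
    ← Summable.tsum_add (by exact hl) (by exact hr)]
  refine tsum_congr fun i => ?_
  simp [kreinOp_apply, conj_apply, kreinSign]
  ring

theorem isAnnihilation_iff (F : NambuSpace ι) : F.IsAnnihilation ↔ kreinOp F = F := by
  refine ⟨fun h => ?_, fun h i => ?_⟩
  · ext (i | i)
    · simp [kreinOp_apply, kreinSign]
    · simp [kreinOp_apply, h i]
  · have h_inr : kreinSign (.inr i : ι ⊕ ι) * F (.inr i) = F (.inr i) := by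
      rw [← kreinOp_apply, h]
    rw [kreinSign] at h_inr
    linear_combination (-1 / 2 : ℂ) * h_inr

end NambuSpace

namespace Bogoliubov

open NambuSpace
open scoped InnerProductSpace

variable {ι : Type} (T : Bogoliubov ι)

/-- The fundamental symmetry of a Bogoliubov transformation: it is `1` on the new annihilation
operators and `-1` on the new creation operators, so that it determines the transformed vacuum. -/
def symmetry : NambuSpace ι →L[ℂ] NambuSpace ι :=
  (T.B : NambuSpace ι →L[ℂ] NambuSpace ι) * kreinOp * (T.B.symm : NambuSpace ι →L[ℂ] NambuSpace ι)

theorem symmetry_apply (F : NambuSpace ι) : T.symmetry F = T.B (kreinOp (T.B.symm F)) := rfl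

theorem symmetry_mul_self : T.symmetry * T.symmetry = 1 := by
  ext1 F
  simp [symmetry_apply, kreinOp_kreinOp]

theorem inner_kreinOp_map (F G : NambuSpace ι) :
    ⟪T.B F, kreinOp (T.B G)⟫_ℂ = ⟪F, kreinOp G⟫_ℂ := by
  simpa only [commutator_eq_inner, T.map_conj, conj_conj] using T.map_commutator G F.conj

theorem inner_kreinOp_symmetry (F G : NambuSpace ι) :
    ⟪F, kreinOp (T.symmetry G)⟫_ℂ = ⟪T.B.symm F, T.B.symm G⟫_ℂ := by
  rw [symmetry_apply, ← T.B.apply_symm_apply F, inner_kreinOp_map, kreinOp_kreinOp,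
    T.B.apply_symm_apply]

theorem isFundamentalSymmetry_symmetry : IsFundamentalSymmetry kreinOp T.symmetry where
  mul_self := T.symmetry_mul_self
  nonneg := by
    have h : kreinOp * T.symmetry = star (T.B.symm : NambuSpace ι →L[ℂ] NambuSpace ι)
        * (T.B.symm : NambuSpace ι →L[ℂ] NambuSpace ι) := by
      ext1 F
      refine ext_inner_left ℂ fun G => (T.inner_kreinOp_symmetry G F).trans ?_
      exact (ContinuousLinearMap.adjoint_inner_right
        (T.B.symm : NambuSpace ι →L[ℂ] NambuSpace ι) G _).symm
    rw [h]
    exact star_mul_self_nonneg _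

theorem symmetry_eq_self_iff (F : NambuSpace ι) :
    T.symmetry F = F ↔ ∃ f : NambuSpace ι, f.IsAnnihilation ∧ T.B f = F := by
  constructor
  · intro h
    refine ⟨T.B.symm F, (isAnnihilation_iff _).2 (T.B.injective ?_), T.B.apply_symm_apply F⟩
    rw [← symmetry_apply, h, T.B.apply_symm_apply]
  · rintro ⟨f, hf, rfl⟩
    rw [symmetry_apply, T.B.symm_apply_apply, (isAnnihilation_iff f).1 hf]

theorem symm_conj (F : NambuSpace ι) : T.B.symm F.conj = (T.B.symm F).conj := by
  rw [T.B.symm_apply_eq, T.map_conj, T.B.apply_symm_apply]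

theorem conjOp_symmetry : conjOp T.symmetry = -T.symmetry := by
  ext1 F
  rw [conjOp_apply, symmetry_apply, symm_conj, kreinOp_conj, map_neg, T.map_conj, conj_neg,
    conj_conj]
  rfl

theorem exists_symmetry_eq {S : NambuSpace ι →L[ℂ] NambuSpace ι}
    (hS : IsFundamentalSymmetry kreinOp S) (hc : conjOp S = -S) :
    ∃ T : Bogoliubov ι, T.symmetry = S := by
  set J : NambuSpace ι →L[ℂ] NambuSpace ι := kreinOp
  have hJ : J * J = 1 := kreinOp_mul_self
  obtain ⟨R, hR, hRR, hleft, hright⟩ := hS.exists_sqrt hJ isSelfAdjoint_kreinOp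
  have hR_conj : conjOp R = R := by
    refine eq_of_nonneg_of_mul_self_eq (conjOp_nonneg hR) hR ?_
    rw [← conjOp_mul, hRR, conjOp_mul, hc, conjOp_kreinOp, neg_mul_neg]
  have hB_conj : conjOp (J * R * J) = (1 : ℂ) • (J * R * J) := by
    rw [conjOp_mul, conjOp_mul, hR_conj, conjOp_kreinOp, neg_mul, neg_mul_neg, one_smul]
  have hB_self : IsSelfAdjoint (J * R * J) :=
    (IsSelfAdjoint.of_nonneg hR).conjugate_self isSelfAdjoint_kreinOp
  have hB_krein : J * R * J * J * (J * R * J) = J := by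
    calc J * R * J * J * (J * R * J) = J * R * (J * J) * (J * R * J) := by noncomm_ring
      _ = J * (R * (J * R * J)) := by rw [hJ, mul_one, mul_assoc]
      _ = J := by rw [hright, mul_one]
  have hB_map_conj (F : NambuSpace ι) : (J * R * J) F.conj = ((J * R * J) F).conj := by
    simpa using map_conj_of_conjOp_eq hB_conj F
  refine ⟨⟨.equivOfInverse (J * R * J) R (DFunLike.congr_fun hright) (DFunLike.congr_fun hleft),
    fun F G => ?_, hB_map_conj⟩, ?_⟩
  · rw [commutator_eq_inner, commutator_eq_inner]
    change ⟪((J * R * J) G).conj, J ((J * R * J) F)⟫_ℂ = ⟪G.conj, J F⟫_ℂ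
    rw [← hB_map_conj, ← ContinuousLinearMap.adjoint_inner_right,
      ← ContinuousLinearMap.star_eq_adjoint, hB_self.star_eq]
    exact congrArg _ (DFunLike.congr_fun hB_krein F)
  · change J * R * J * J * R = S
    calc J * R * J * J * R = J * R * (J * J) * R := by noncomm_ring
      _ = J * (R * R) := by rw [hJ, mul_one, mul_assoc]
      _ = S := by rw [hRR, ← mul_assoc, hJ, one_mul]

end Bogoliubov

namespace CCRAlgebra

open NambuSpace

variable {ι : Type} [DecidableEq ι]

theorem ccrForm_eq (s t : ι ⊕ ι) : ccrForm s t = if t = s.swap then kreinSign s else 0 := by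
  rcases s with i | i <;> rcases t with j | j <;> simp [ccrForm, kreinSign, eq_comm]

/-- The product of a list of generators. -/
def word (l : List (ι ⊕ ι)) : CCRAlgebra ι := (l.map nambu).prod

theorem word_nil : word ([] : List (ι ⊕ ι)) = 1 := rfl

theorem word_cons (s : ι ⊕ ι) (l : List (ι ⊕ ι)) : word (s :: l) = nambu s * word l := by
  simp [word]

theorem word_concat (l : List (ι ⊕ ι)) (s : ι ⊕ ι) : word (l ++ [s]) = word l * nambu s := by
  simp [word]

theorem adjoin_range_nambu : Algebra.adjoin ℂ (Set.range (nambu : ι ⊕ ι → CCRAlgebra ι)) = ⊤ := by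
  let q : FreeAlgebra ℂ (ι ⊕ ι) →ₐ[ℂ] CCRAlgebra ι := RingQuot.mkAlgHom ℂ (CCRRel ι)
  have hq : q.range = ⊤ := (AlgHom.range_eq_top q).2 (RingQuot.mkAlgHom_surjective ℂ (CCRRel ι))
  rw [← hq, ← Algebra.map_top, ← FreeAlgebra.adjoin_range_ι, AlgHom.map_adjoin, ← Set.range_comp]
  rfl

theorem induction_word {p : CCRAlgebra ι → Prop} (word : ∀ l, p (word l))
    (add : ∀ X Y, p X → p Y → p (X + Y)) (smul : ∀ (c : ℂ) X, p X → p (c • X))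
    (X : CCRAlgebra ι) : p X := by
  have hX : X ∈ Submodule.span ℂ
      (Submonoid.closure (Set.range (nambu : ι ⊕ ι → CCRAlgebra ι)) : Set (CCRAlgebra ι)) := by
    rw [← Algebra.adjoin_eq_span, adjoin_range_nambu]
    exact Submodule.mem_top
  induction hX using Submodule.span_induction with
  | mem x hx =>
    obtain ⟨l, hl, rfl⟩ := Submonoid.exists_list_of_mem_closure hx
    obtain ⟨l, rfl⟩ := (Set.range_list_map (nambu : ι ⊕ ι → CCRAlgebra ι)).ge hl
    exact word l
  | zero => simpa using smul 0 1 (word [])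
  | add x y _ _ hx hy => exact add x y hx hy
  | smul c x _ hx => exact smul c x hx

theorem word_mul_nambu (l : List (ι ⊕ ι)) (s : ι ⊕ ι) :
    word l * nambu s = nambu s * word l
      + ∑ k : Fin l.length, ccrForm l[k] s • word (l.eraseIdx k) := by
  induction l with
  | nil => simp [word]
  | cons t l ih =>
    rw [word_cons, mul_assoc, ih, mul_add, ← mul_assoc, nambu_mul, add_mul, mul_assoc,
      Algebra.algebraMap_eq_smul_one, smul_mul_assoc, one_mul, add_assoc]
    congr 1
    change _ = ∑ k : Fin (l.length + 1), _
    rw [Fin.sum_univ_succ, Finset.mul_sum]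
    congr 1
    refine Finset.sum_congr rfl fun k _ => ?_
    rw [mul_smul_comm]
    simp [word_cons]

/-- The functionals `η` that satisfy `η (X φ(F)) = 0` for `F` in the positive part of `S`, and
`η (φ(F) X) = 0` for `F` in the negative part. For states the second law follows from the first. -/
structure IsVacuumFunctional (S : NambuSpace ι →L[ℂ] NambuSpace ι) (η : CCRAlgebra ι →ₗ[ℂ] ℂ) :
    Prop where
  hasSum_mul_nambu : ∀ F, S F = F → ∀ X, HasSum (fun s => F s * η (X * nambu s)) 0
  hasSum_nambu_mul : ∀ F, S F = -F → ∀ X, HasSum (fun s => F s * η (nambu s * X)) 0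

variable {S : NambuSpace ι →L[ℂ] NambuSpace ι} {η : CCRAlgebra ι →ₗ[ℂ] ℂ}

theorem isVacuumFunctional_of_star (hSc : conjOp S = -S) {ε : ℂ}
    (hη : ∀ X, η (star X) = ε * starRingEnd ℂ (η X))
    (h : ∀ F, S F = F → ∀ X, HasSum (fun s => F s * η (X * nambu s)) 0) :
    IsVacuumFunctional S η := by
  refine ⟨h, fun F hF X => ?_⟩
  have hstar (s : ι ⊕ ι) : η (nambu s * X) = ε * starRingEnd ℂ (η (star X * nambu s.swap)) := by
    rw [← hη, star_mul, star_nambu, Sum.swap_swap, star_star]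
  have hsum := ((Equiv.sumComm ι ι).hasSum_iff.2 <| Complex.hasSum_conj'.2 <|
    h F.conj (map_conj_eq_self hSc hF) (star X)).mul_left ε
  simpa [Function.comp_def, conj_apply, hstar, mul_left_comm] using hsum

namespace IsVacuumFunctional

theorem sub {η' : CCRAlgebra ι →ₗ[ℂ] ℂ} (h : IsVacuumFunctional S η)
    (h' : IsVacuumFunctional S η') : IsVacuumFunctional S (η - η') where
  hasSum_mul_nambu F hF X := by
    simpa [mul_sub] using (h.hasSum_mul_nambu F hF X).sub (h'.hasSum_mul_nambu F hF X)
  hasSum_nambu_mul F hF X := by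
    simpa [mul_sub] using (h.hasSum_nambu_mul F hF X).sub (h'.hasSum_nambu_mul F hF X)

theorem hasSum_commutator (h : IsVacuumFunctional S η) (hS : S * S = 1) {F : NambuSpace ι}
    {X : CCRAlgebra ι} {x : ℂ} (hF : HasSum (fun s => F s * η (X * nambu s)) x) :
    HasSum (fun s => negProj S F s * η (X * nambu s - nambu s * X)) x := by
  have hpos := h.hasSum_mul_nambu _ (map_sub_negProj hS F) X
  have hneg := h.hasSum_nambu_mul _ (map_negProj hS F) X
  have hsum := (hF.sub hpos).sub hneg
  rw [sub_zero, sub_zero] at hsum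
  refine hsum.congr_fun fun s => ?_
  rw [map_sub, lp.coeFn_sub, Pi.sub_apply]
  ring

/-- Wick's theorem in recursive form. -/
theorem apply_word_mul_nambu (h : IsVacuumFunctional S η) (hS : S * S = 1) (l : List (ι ⊕ ι))
    (s : ι ⊕ ι) : η (word l * nambu s) = ∑ k : Fin l.length,
      kreinSign l[k] * η (word (l.eraseIdx k)) * negProj S (basisVec s) l[k].swap := by
  have hs : HasSum (fun t => (basisVec s : NambuSpace ι) t * η (word l * nambu t))
      (η (word l * nambu s)) := by
    simpa [basisVec_apply] using
      hasSum_single (f := fun t => (basisVec s : NambuSpace ι) t * η (word l * nambu t)) s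
        fun t ht => by simp [basisVec_apply, ht]
  refine (h.hasSum_commutator hS hs).unique ?_
  simp only [word_mul_nambu, add_sub_cancel_left, map_sum, map_smul, Finset.mul_sum]
  refine hasSum_sum fun k _ => ?_
  convert hasSum_ite_eq l[k].swap
    (kreinSign l[k] * η (word (l.eraseIdx k)) * negProj S (basisVec s) l[k].swap) using 2 with t
  rw [ccrForm_eq]
  split_ifs with ht
  · subst ht
    rw [smul_eq_mul]
    ring
  · simp

theorem eq_zero (h : IsVacuumFunctional S η) (hS : S * S = 1) (h_one : η 1 = 0) : η = 0 := by
  have hword (n : ℕ) : ∀ l : List (ι ⊕ ι), l.length = n → η (word l) = 0 := by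
    induction n using Nat.strong_induction_on with
    | _ n ih =>
      rintro l rfl
      rcases List.eq_nil_or_concat' l with rfl | ⟨l, s, rfl⟩
      · exact h_one
      · rw [word_concat, h.apply_word_mul_nambu hS]
        refine Finset.sum_eq_zero fun k _ => ?_
        have hlt : (l.eraseIdx k).length < (l ++ [s]).length := by grind
        rw [ih _ hlt _ rfl, mul_zero, zero_mul]
  ext X
  induction X using induction_word with
  | word l => exact hword _ l rfl
  | add X Y hX hY => rw [map_add, hX, hY, map_add]
  | smul c X hX => rw [map_smul, hX, map_smul]

theorem exists_functional (h : IsVacuumFunctional S η) (hS : S * S = 1) (X : CCRAlgebra ι) :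
    ∃ Λ : NambuSpace ι →L[ℂ] ℂ, ∀ s, Λ (basisVec s) = η (X * nambu s) := by
  induction X using induction_word with
  | word l =>
    refine ⟨∑ k : Fin l.length, (kreinSign l[k] * η (word (l.eraseIdx k))) •
      (innerSL ℂ (basisVec l[k].swap)).comp (negProj S), fun s => ?_⟩
    simp [h.apply_word_mul_nambu hS, inner_basisVec]
  | add X Y hX hY =>
    obtain ⟨Λ, hΛ⟩ := hX
    obtain ⟨Λ', hΛ'⟩ := hY
    exact ⟨Λ + Λ', fun s => by rw [add_apply, hΛ, hΛ', add_mul, map_add]⟩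
  | smul c X hX =>
    obtain ⟨Λ, hΛ⟩ := hX
    exact ⟨c • Λ, fun s => by rw [smul_apply, hΛ, smul_mul_assoc, map_smul]⟩

/-- Only the positive part of `S` annihilates a vacuum. -/
theorem map_eq_self (h : IsVacuumFunctional S η) (hS : S * S = 1) (h_one : η 1 = 1)
    {F : NambuSpace ι} (hF : ∀ t, HasSum (fun s => F s * η (nambu t * nambu s)) 0) : S F = F := by
  rw [← negProj_eq_zero_iff]
  ext t
  have hcomm (s : ι ⊕ ι) : η (nambu t.swap * nambu s - nambu s * nambu t.swap)
      = if s = t then kreinSign t.swap else 0 := by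
    rw [nambu_mul, add_sub_cancel_left, Algebra.algebraMap_eq_smul_one, map_smul, h_one,
      smul_eq_mul, mul_one, ccrForm_eq, Sum.swap_swap]
  have hsum := h.hasSum_commutator hS (hF t.swap)
  simp only [hcomm, mul_ite, mul_zero] at hsum
  have hzero := hsum.unique (hasSum_single t fun s hs => if_neg hs)
  rw [if_pos rfl, eq_comm, mul_eq_zero] at hzero
  refine hzero.resolve_right fun hsign => ?_
  simpa [hsign] using norm_kreinSign t.swap

end IsVacuumFunctional

end CCRAlgebra

namespace CCRState

open CCRAlgebra NambuSpace

variable {ι : Type} [DecidableEq ι]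

/-- Polarization of the positivity of `⟨(X + 1)† (X + 1)⟩` and `⟨(i X + 1)† (i X + 1)⟩`. -/
theorem expect_star (ω : CCRState ι) (X : CCRAlgebra ι) :
    ω.expect (star X) = starRingEnd ℂ (ω.expect X) := by
  have hX := ω.im_eq_zero X
  have him := ω.im_eq_zero (X + 1)
  have hre := ω.im_eq_zero (Complex.I • X + 1)
  simp only [star_add, star_one, star_smul, add_mul, mul_add, one_mul, mul_one, smul_mul_smul_comm,
    map_add, map_smul, ω.normalized, Complex.add_im, smul_eq_mul, Complex.mul_im] at him hre
  apply Complex.ext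
  · simp only [RCLike.star_def, Complex.conj_I, neg_mul, Complex.I_mul_I, neg_neg, Complex.one_re,
      hX, mul_zero, Complex.neg_re, Complex.I_re, neg_zero, Complex.I_im, mul_one, zero_mul,
      Complex.neg_im, add_zero, one_mul, zero_add, Complex.one_im] at hre
    simp only [Complex.conj_re]
    linarith
  · simp only [hX, zero_add, Complex.one_im, add_zero] at him
    simp only [Complex.conj_im]
    linarith

theorem ext_expect {ω ω' : CCRState ι} (h : ω.expect = ω'.expect) : ω = ω' := by
  cases ω; cases ω'; congr

/-- The state is annihilated by `φ(F)` for all `F` in the positive part of `S`. -/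
def IsVacuumOf (ω : CCRState ι) (S : NambuSpace ι →L[ℂ] NambuSpace ι) : Prop :=
  ∀ F, S F = F → ω.AnnihilatedBy F

theorem isQuasiparticleVacuum_iff (ω : CCRState ι) :
    ω.IsQuasiparticleVacuum ↔ ∃ T : Bogoliubov ι, ω.IsVacuumOf T.symmetry := by
  refine exists_congr fun T => ⟨fun h F hF => ?_, fun h f hf => ?_⟩
  · obtain ⟨f, hf, rfl⟩ := (T.symmetry_eq_self_iff F).1 hF
    exact h f hf
  · exact h _ ((T.symmetry_eq_self_iff _).2 ⟨f, hf, rfl⟩)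

variable {ω ω' : CCRState ι} {S : NambuSpace ι →L[ℂ] NambuSpace ι}

theorem IsVacuumOf.isVacuumFunctional (h : ω.IsVacuumOf S) (hSc : conjOp S = -S) :
    IsVacuumFunctional S ω.expect :=
  isVacuumFunctional_of_star hSc (ε := 1) (fun X => by rw [ω.expect_star, one_mul]) h

theorem IsVacuumOf.unique (hS : S * S = 1) (hSc : conjOp S = -S) (h : ω.IsVacuumOf S)
    (h' : ω'.IsVacuumOf S) : ω = ω' := by
  refine ext_expect (sub_eq_zero.1 ?_)
  refine ((h.isVacuumFunctional hSc).sub (h'.isVacuumFunctional hSc)).eq_zero hS ?_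
  simp [ω.normalized, ω'.normalized]

end CCRState

namespace FockForm

open MvPolynomial
open scoped ComplexOrder

variable {σ τ : Type*}

/-- The derivation of polynomials with `X s ↦ a s`. -/
def contraction (a : σ → ℂ) : Derivation ℂ (MvPolynomial σ ℂ) (MvPolynomial σ ℂ) :=
  mkDerivation ℂ fun s => C (a s)

theorem contraction_X (a : σ → ℂ) (s : σ) : contraction a (X s) = C (a s) := mkDerivation_X _ _ _

theorem contraction_contraction_comm (a b : σ → ℂ) (p : MvPolynomial σ ℂ) :
    contraction a (contraction b p) = contraction b (contraction a p) := by
  have h : ⁅contraction a, contraction b⁆ = 0 := by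
    refine derivation_ext fun i => ?_
    simp [Derivation.commutator_apply, contraction_X, derivation_C]
  simpa [Derivation.commutator_apply, sub_eq_zero] using DFunLike.congr_fun h p

section Form

variable [Fintype σ]

theorem contraction_eq_sum (a : σ → ℂ) : contraction a = ∑ i, a i • pderiv i := by
  classical
  refine derivation_ext fun s => ?_
  rw [← Derivation.coeFnAddMonoidHom_apply (∑ i, a i • pderiv i), map_sum, Finset.sum_apply,
    contraction_X]
  simp [pderiv_X, Pi.single_apply, smul_eq_C_mul]

/-- The linear polynomial with the coefficients `c`. -/
def linear (c : σ → ℂ) : MvPolynomial σ ℂ := ∑ i, c i • X i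

theorem constantCoeff_linear (c : σ → ℂ) : constantCoeff (linear c) = 0 := by
  simp [linear, constantCoeff_smul]

theorem contraction_linear (a c : σ → ℂ) : contraction a (linear c) = C (∑ i, c i * a i) := by
  simp [linear, contraction_X, smul_eq_C_mul]

/-- The squared norm of a monomial in the Fock space of polynomials. -/
def weight (m : σ →₀ ℕ) : ℕ := ∏ i, (m i).factorial

theorem weight_add_single (m : σ →₀ ℕ) (i : σ) :
    weight (m + Finsupp.single i 1) = weight m * (m i + 1) := by
  classical
  have hprod : ∏ j ∈ Finset.univ.erase i, ((m + Finsupp.single i 1 : σ →₀ ℕ) j).factorial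
      = ∏ j ∈ Finset.univ.erase i, (m j).factorial := by
    refine Finset.prod_congr rfl fun j hj => ?_
    rw [Finsupp.add_apply, Finsupp.single_apply, if_neg (Finset.ne_of_mem_erase hj).symm, add_zero]
  rw [weight, weight, ← Finset.mul_prod_erase _ _ (Finset.mem_univ i), hprod,
    ← Finset.mul_prod_erase _ (fun i => (m i).factorial) (Finset.mem_univ i), Finsupp.add_apply,
    Finsupp.single_eq_same, Nat.factorial_succ]
  ring

theorem sum_support_weight {p : MvPolynomial σ ℂ} {s : Finset (σ →₀ ℕ)} (hs : p.support ⊆ s)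
    (q : MvPolynomial σ ℂ) :
    ∑ m ∈ p.support, weight m * (starRingEnd ℂ (coeff m p) * coeff m q) =
      ∑ m ∈ s, weight m * (starRingEnd ℂ (coeff m p) * coeff m q) := by
  refine Finset.sum_subset hs fun m _ hm => ?_
  rw [notMem_support_iff.1 hm, map_zero, zero_mul, mul_zero]

/-- The Fock inner product of polynomials, in which different monomials are orthogonal. -/
def form : MvPolynomial σ ℂ →ₗ⋆[ℂ] MvPolynomial σ ℂ →ₗ[ℂ] ℂ :=
  LinearMap.mk₂'ₛₗ (starRingEnd ℂ) (RingHom.id ℂ)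
    (fun p q => ∑ m ∈ p.support, weight m * (starRingEnd ℂ (coeff m p) * coeff m q))
    (fun p p' q => by
      classical
      rw [sum_support_weight support_add, sum_support_weight Finset.subset_union_left,
        sum_support_weight Finset.subset_union_right, ← Finset.sum_add_distrib]
      simp [add_mul, mul_add])
    (fun c p q => by
      rw [sum_support_weight support_smul, Finset.smul_sum]
      simp [mul_assoc, mul_left_comm])
    (fun p q q' => by simp [mul_add, Finset.sum_add_distrib])
    (fun c p q => by simp [Finset.mul_sum, mul_left_comm])

theorem form_apply (p q : MvPolynomial σ ℂ) :
    form p q = ∑ m ∈ p.support, weight m * (starRingEnd ℂ (coeff m p) * coeff m q) := rfl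

theorem form_symm (p q : MvPolynomial σ ℂ) : starRingEnd ℂ (form p q) = form q p := by
  classical
  rw [form_apply, form_apply, sum_support_weight (s := p.support ∪ q.support)
    Finset.subset_union_left, sum_support_weight (s := p.support ∪ q.support)
    Finset.subset_union_right, map_sum]
  simp [mul_comm]

theorem form_monomial (m : σ →₀ ℕ) (a : ℂ) (q : MvPolynomial σ ℂ) :
    form (monomial m a) q = weight m * (starRingEnd ℂ a * coeff m q) := by
  classical
  rw [form_apply, sum_support_weight support_monomial_subset, Finset.sum_singleton,
    coeff_monomial, if_pos rfl]

theorem form_one (q : MvPolynomial σ ℂ) : form 1 q = constantCoeff q := by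
  simpa [weight, constantCoeff_eq] using form_monomial (0 : σ →₀ ℕ) 1 q

theorem form_self_nonneg (p : MvPolynomial σ ℂ) : 0 ≤ form p p :=
  Finset.sum_nonneg fun m _ =>
    mul_nonneg (Nat.cast_nonneg _) (star_mul_self_nonneg (coeff m p))

theorem form_X_mul (i : σ) (p q : MvPolynomial σ ℂ) : form (X i * p) q = form p (pderiv i q) := by
  induction p using MvPolynomial.induction_on' with
  | monomial m a =>
    rw [mul_comm, ← pow_one (X i), X_pow_eq_monomial, monomial_mul, form_monomial, form_monomial,
      coeff_pderiv, weight_add_single, mul_one]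
    push_cast
    ring
  | add p p' hp hp' => simp only [mul_add, map_add, LinearMap.add_apply, hp, hp']

theorem form_linear_mul (c : σ → ℂ) (p q : MvPolynomial σ ℂ) :
    form (linear c * p) q = form p (contraction (star c) q) := by
  rw [contraction_eq_sum, ← Derivation.coeFnAddMonoidHom_apply, map_sum, Finset.sum_apply, map_sum,
    linear, Finset.sum_mul, map_sum, LinearMap.sum_apply]
  simp [form_X_mul]

theorem form_contraction (c : σ → ℂ) (p q : MvPolynomial σ ℂ) :
    form (contraction (star c) p) q = form p (linear c * q) := by
  rw [← form_symm, ← form_linear_mul, form_symm]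

/-- The substitution of linear polynomials for the variables. -/
def linearSubst (c : τ → σ → ℂ) : MvPolynomial τ ℂ →ₐ[ℂ] MvPolynomial σ ℂ :=
  aeval fun t => linear (c t)

theorem linearSubst_X (c : τ → σ → ℂ) (t : τ) : linearSubst c (X t) = linear (c t) := aeval_X _ _

theorem constantCoeff_linearSubst (c : τ → σ → ℂ) (p : MvPolynomial τ ℂ) :
    constantCoeff (linearSubst c p) = constantCoeff p := by
  have h : (constantCoeff.comp (linearSubst c : MvPolynomial τ ℂ →+* MvPolynomial σ ℂ)) =
      constantCoeff :=
    MvPolynomial.ringHom_ext (by simp) (by simp [linearSubst_X, constantCoeff_linear])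
  exact DFunLike.congr_fun h p

theorem linearSubst_contraction {c : τ → σ → ℂ} {a : τ → ℂ} {b : σ → ℂ}
    (h : ∀ t, a t = ∑ i, c t i * b i) (p : MvPolynomial τ ℂ) :
    linearSubst c (contraction a p) = contraction b (linearSubst c p) := by
  induction p using MvPolynomial.induction_on with
  | C a => simp [derivation_C]
  | add p q hp hq => simp only [map_add, hp, hq]
  | mul_X p t hp =>
    have ht : linearSubst c (C (a t)) = contraction b (linear (c t)) := by
      rw [contraction_linear, ← h]
      exact (linearSubst c).commutes (a t)
    simp only [Derivation.leibniz, map_mul, map_add, smul_eq_mul, contraction_X, linearSubst_X, hp,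
      ht]

end Form

end FockForm

namespace CCRAlgebra

open MvPolynomial FockForm
open scoped ComplexOrder InnerProductSpace

variable {ι : Type} [DecidableEq ι]

section Wick

variable {w : ι ⊕ ι → ι ⊕ ι → ℂ} (hw : ∀ s t, w s t - w t s = ccrForm s t)

/-- The representation of the CCR algebra on polynomials in the generators in which
`φ_s = X_s + ∑ t, w s t ∂_t`. Its expectation in the vector `1` is Wick's theorem for the
two-point function `w`. -/
def wickRep : CCRAlgebra ι →ₐ[ℂ] Module.End ℂ (MvPolynomial (ι ⊕ ι) ℂ) :=
  lift (fun s => LinearMap.mulLeft ℂ (X s) + (contraction (w s) : _ →ₗ[ℂ] _)) (by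
    intro s t
    refine LinearMap.ext fun p => ?_
    simp only [Module.End.mul_apply, LinearMap.add_apply, LinearMap.mulLeft_apply,
      Derivation.coeFn_coe, map_add, Derivation.leibniz, contraction_X,
      contraction_contraction_comm (w s), Module.algebraMap_end_apply, smul_eq_mul, smul_eq_C_mul]
    rw [← hw s t, map_sub]
    ring)

theorem wickRep_nambu (s : ι ⊕ ι) (p : MvPolynomial (ι ⊕ ι) ℂ) :
    wickRep hw (nambu s) p = X s * p + contraction (w s) p := by
  rw [wickRep, lift_nambu]
  rfl

/-- The functional with the two-point function `w` that satisfies Wick's theorem. -/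
def wickFunctional : CCRAlgebra ι →ₗ[ℂ] ℂ where
  toFun Y := constantCoeff (wickRep hw Y 1)
  map_add' Y Z := by simp
  map_smul' c Y := by simp [constantCoeff_smul]

theorem wickFunctional_apply (Y : CCRAlgebra ι) :
    wickFunctional hw Y = constantCoeff (wickRep hw Y 1) := rfl

theorem wickFunctional_one : wickFunctional hw 1 = 1 := by simp [wickFunctional_apply]

theorem hasSum_constantCoeff_wickRep {F : ι ⊕ ι → ℂ} (hF : ∀ t, HasSum (fun s => F s * w t s) 0)
    (Y : CCRAlgebra ι) : ∀ q : MvPolynomial (ι ⊕ ι) ℂ,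
      HasSum (fun s => F s * constantCoeff (wickRep hw Y (X s * q))) 0 := by
  induction Y using induction_word with
  | word l =>
    induction l using List.reverseRecOn with
    | nil => intro q; simp [word_nil]
    | append_singleton l t ih =>
      intro q
      have hsum := ((ih (X t * q)).add (ih (contraction (w t) q))).add
        ((hF t).mul_right (constantCoeff (wickRep hw (word l) q)))
      rw [zero_mul, add_zero, add_zero] at hsum
      refine hsum.congr_fun fun s => ?_
      have hcommute : X t * (X s * q) + contraction (w t) (X s * q)
          = X s * (X t * q) + X s * contraction (w t) q + w t s • q := by
        simp only [Derivation.leibniz, contraction_X, smul_eq_mul, smul_eq_C_mul]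
        ring
      rw [word_concat, map_mul (wickRep hw), Module.End.mul_apply, wickRep_nambu, hcommute]
      simp only [map_add, map_smul, constantCoeff_smul, smul_eq_mul]
      ring
  | add Y Z hY hZ => intro q; simpa [mul_add] using (hY q).add (hZ q)
  | smul c Y hY =>
    intro q
    simpa [constantCoeff_smul, mul_left_comm] using (hY q).mul_left c

theorem hasSum_wickFunctional {F : ι ⊕ ι → ℂ} (hF : ∀ t, HasSum (fun s => F s * w t s) 0)
    (Y : CCRAlgebra ι) : HasSum (fun s => F s * wickFunctional hw (Y * nambu s)) 0 := by
  simpa [wickFunctional_apply, wickRep_nambu] using hasSum_constantCoeff_wickRep hw hF Y 1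

theorem exists_finset_mem_adjoin (Y : CCRAlgebra ι) :
    ∃ s : Finset (ι ⊕ ι), Y ∈ Algebra.adjoin ℂ (nambu '' (s : Set (ι ⊕ ι))) := by
  induction Y using induction_word with
  | word l =>
    refine ⟨l.toFinset, Subalgebra.list_prod_mem _ fun x hx => ?_⟩
    obtain ⟨s, hs, rfl⟩ := List.mem_map.1 hx
    exact Algebra.subset_adjoin ⟨s, by simpa using hs, rfl⟩
  | add Y Z hY hZ =>
    obtain ⟨s, hs⟩ := hY
    obtain ⟨t, ht⟩ := hZ
    exact ⟨s ∪ t, add_mem (Algebra.adjoin_mono (Set.image_mono (by simp)) hs)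
      (Algebra.adjoin_mono (Set.image_mono (by simp)) ht)⟩
  | smul c Y hY =>
    obtain ⟨s, hs⟩ := hY
    exact ⟨s, Subalgebra.smul_mem _ hs c⟩

/-- Through the substitution `X t ↦ ∑ i, c t i • X i`, the elements `Y` and `star Y` act on the
Fock space of `σ` by mutually adjoint operators. -/
def ActsAdjointly {σ : Type*} [Fintype σ] (c : ι ⊕ ι → σ → ℂ) (Y : CCRAlgebra ι) : Prop :=
  ∃ P P' : Module.End ℂ (MvPolynomial σ ℂ), (∀ p q, form (P p) q = form p (P' q)) ∧
    (∀ p, linearSubst c (wickRep hw Y p) = P (linearSubst c p)) ∧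
    ∀ p, linearSubst c (wickRep hw (star Y) p) = P' (linearSubst c p)

variable {σ : Type*} [Fintype σ] {c : ι ⊕ ι → σ → ℂ}

theorem actsAdjointly_nambu {s : ι ⊕ ι} (hs : ∀ t, w s t = ∑ i, star (c s.swap i) * c t i)
    (hs' : ∀ t, w s.swap t = ∑ i, star (c s i) * c t i) : ActsAdjointly hw c (nambu s) := by
  have hc (p) : linearSubst c (contraction (w s) p)
      = contraction (star (c s.swap)) (linearSubst c p) :=
    linearSubst_contraction (fun t => by simp [hs t, mul_comm]) p
  have hc' (p) : linearSubst c (contraction (w s.swap) p)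
      = contraction (star (c s)) (linearSubst c p) :=
    linearSubst_contraction (fun t => by simp [hs' t, mul_comm]) p
  refine ⟨LinearMap.mulLeft ℂ (linear (c s)) + (contraction (star (c s.swap)) : _ →ₗ[ℂ] _),
    LinearMap.mulLeft ℂ (linear (c s.swap)) + (contraction (star (c s)) : _ →ₗ[ℂ] _), ?_, ?_, ?_⟩
  · simp [form_linear_mul, form_contraction, add_comm]
  · simp [wickRep_nambu, linearSubst_X, hc]
  · simp [wickRep_nambu, linearSubst_X, star_nambu, hc']

theorem actsAdjointly_algebraMap (a : ℂ) : ActsAdjointly hw c (algebraMap ℂ (CCRAlgebra ι) a) :=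
  ⟨algebraMap ℂ _ a, algebraMap ℂ _ (star a), by simp, by simp, by
    simp [← algebraMap_star_comm]⟩

variable {hw} {Y Z : CCRAlgebra ι}

theorem ActsAdjointly.add (hY : ActsAdjointly hw c Y) (hZ : ActsAdjointly hw c Z) :
    ActsAdjointly hw c (Y + Z) := by
  obtain ⟨P, P', hadj, hP, hP'⟩ := hY
  obtain ⟨Q, Q', hadj', hQ, hQ'⟩ := hZ
  exact ⟨P + Q, P' + Q', by simp [hadj, hadj'], by simp [hP, hQ], by simp [hP', hQ']⟩

theorem ActsAdjointly.mul (hY : ActsAdjointly hw c Y) (hZ : ActsAdjointly hw c Z) :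
    ActsAdjointly hw c (Y * Z) := by
  obtain ⟨P, P', hadj, hP, hP'⟩ := hY
  obtain ⟨Q, Q', hadj', hQ, hQ'⟩ := hZ
  exact ⟨P * Q, Q' * P', by simp [hadj, hadj'], by simp [hP, hQ], by simp [hP', hQ']⟩

theorem ActsAdjointly.wickFunctional_star_mul_self_nonneg (hY : ActsAdjointly hw c Y) :
    0 ≤ wickFunctional hw (star Y * Y) := by
  obtain ⟨P, P', hadj, hP, hP'⟩ := hY
  have h : wickFunctional hw (star Y * Y) = form (P 1) (P 1) := by
    rw [wickFunctional_apply, map_mul, Module.End.mul_apply, ← constantCoeff_linearSubst c, hP',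
      hP, map_one, hadj, form_one]
  rw [h]
  exact form_self_nonneg _

end Wick

theorem exists_finite_coordinates {τ E : Type*} [NormedAddCommGroup E] [InnerProductSpace ℂ E]
    (u : τ → E) (s : Finset τ) :
    ∃ (n : ℕ) (c : τ → Fin n → ℂ), ∀ r ∈ s, ∀ t, ⟪u r, u t⟫_ℂ = ∑ i, star (c r i) * c t i := by
  classical
  let U : Submodule ℂ E := Submodule.span ℂ (s.image u)
  let b := stdOrthonormalBasis ℂ U
  refine ⟨_, fun t i => ⟪(b i : E), u t⟫_ℂ, fun r hr t => ?_⟩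
  have hU : u r ∈ U := Submodule.subset_span (Finset.mem_coe.2 (Finset.mem_image_of_mem u hr))
  have hexpand : ∑ i, ⟪(b i : E), u r⟫_ℂ • (b i : E) = u r := by
    simpa using congrArg Subtype.val (b.sum_repr' ⟨u r, hU⟩)
  conv_lhs => rw [← hexpand]
  simp [mul_comm]

theorem wickFunctional_star_mul_self_nonneg {E : Type*} [NormedAddCommGroup E]
    [InnerProductSpace ℂ E] (u : ι ⊕ ι → E)
    (hw : ∀ s t, ⟪u s.swap, u t⟫_ℂ - ⟪u t.swap, u s⟫_ℂ = ccrForm s t) (Y : CCRAlgebra ι) :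
    0 ≤ wickFunctional (w := fun s t => ⟪u s.swap, u t⟫_ℂ) hw (star Y * Y) := by
  obtain ⟨s, hs⟩ := exists_finset_mem_adjoin Y
  obtain ⟨n, c, hc⟩ := exists_finite_coordinates u (s ∪ s.image Sum.swap)
  suffices ActsAdjointly hw c Y from this.wickFunctional_star_mul_self_nonneg
  induction hs using Algebra.adjoin_induction with
  | mem x hx =>
    obtain ⟨r, hr, rfl⟩ := hx
    refine actsAdjointly_nambu hw (hc r.swap ?_) (fun t => ?_)
    · exact Finset.mem_union_right _ (Finset.mem_image_of_mem _ hr)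
    · rw [Sum.swap_swap]
      exact hc r (Finset.mem_union_left _ hr) t
  | algebraMap a => exact actsAdjointly_algebraMap hw a
  | add Y Z _ _ hY hZ => exact hY.add hZ
  | mul Y Z _ _ hY hZ => exact hY.mul hZ

end CCRAlgebra

namespace CCRState

open CCRAlgebra NambuSpace
open scoped InnerProductSpace ComplexOrder

variable {ι : Type} [DecidableEq ι]

/-- The quasi-free state with the two-point function `⟨φ_s φ_t⟩ = ⟪u s.swap, u t⟫`. -/
def quasiFree {E : Type*} [NormedAddCommGroup E] [InnerProductSpace ℂ E] (u : ι ⊕ ι → E)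
    (hu : ∀ s t, ⟪u s.swap, u t⟫_ℂ - ⟪u t.swap, u s⟫_ℂ = ccrForm s t) : CCRState ι where
  expect := wickFunctional hu
  normalized := wickFunctional_one hu
  re_nonneg Y := (Complex.nonneg_iff.1 (wickFunctional_star_mul_self_nonneg u hu Y)).1
  im_eq_zero Y := (Complex.nonneg_iff.1 (wickFunctional_star_mul_self_nonneg u hu Y)).2.symm

theorem quasiFree_annihilatedBy {E : Type*} [NormedAddCommGroup E] [InnerProductSpace ℂ E]
    {N : NambuSpace ι →L[ℂ] E} (hN : ∀ s t, ⟪N (basisVec s.swap), N (basisVec t)⟫_ℂ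
      - ⟪N (basisVec t.swap), N (basisVec s)⟫_ℂ = ccrForm s t)
    {F : NambuSpace ι} (hF : N F = 0) :
    (quasiFree (fun s => N (basisVec s)) hN).AnnihilatedBy F := by
  refine hasSum_wickFunctional hN fun t => ?_
  have hsum := hasSum_map_basisVec ((innerSL ℂ (N (basisVec t.swap))).comp N) F
  rw [ContinuousLinearMap.comp_apply, hF, map_zero] at hsum
  exact hsum

end CCRState

namespace Bogoliubov

open CCRAlgebra NambuSpace
open scoped InnerProductSpace

variable {ι : Type} (T : Bogoliubov ι)

/-- The creation part of a coefficient vector in the transformed modes. -/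
def creationPart : NambuSpace ι →L[ℂ] NambuSpace ι :=
  negProj kreinOp ∘L (T.B.symm : NambuSpace ι →L[ℂ] NambuSpace ι)

theorem creationPart_apply (F : NambuSpace ι) :
    T.creationPart F = (1 / 2 : ℂ) • (T.B.symm F - kreinOp (T.B.symm F)) := negProj_apply _

theorem creationPart_eq_zero {F : NambuSpace ι} (hF : T.symmetry F = F) :
    T.creationPart F = 0 := by
  obtain ⟨f, hf, rfl⟩ := (T.symmetry_eq_self_iff F).1 hF
  rw [creationPart_apply, T.B.symm_apply_apply, (isAnnihilation_iff f).1 hf, sub_self, smul_zero]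

theorem inner_creationPart (F G : NambuSpace ι) : ⟪T.creationPart F, T.creationPart G⟫_ℂ
    = (1 / 2 : ℂ) * (⟪T.B.symm F, T.B.symm G⟫_ℂ - ⟪F, kreinOp G⟫_ℂ) := by
  have hT := T.inner_kreinOp_map (T.B.symm F) (T.B.symm G)
  rw [T.B.apply_symm_apply, T.B.apply_symm_apply] at hT
  simp only [creationPart_apply, inner_smul_left, inner_smul_right, inner_sub_left,
    inner_sub_right, inner_kreinOp_left, kreinOp_kreinOp, hT, map_div₀, map_one, Complex.conj_ofNat]
  ring

theorem inner_creationPart_commutator [DecidableEq ι] (s t : ι ⊕ ι) :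
    ⟪T.creationPart (basisVec s.swap), T.creationPart (basisVec t)⟫_ℂ
      - ⟪T.creationPart (basisVec t.swap), T.creationPart (basisVec s)⟫_ℂ = ccrForm s t := by
  have hsymm : ⟪T.B.symm (basisVec t.swap), T.B.symm (basisVec s)⟫_ℂ
      = ⟪T.B.symm (basisVec s.swap), T.B.symm (basisVec t)⟫_ℂ := by
    rw [← conj_basisVec t, ← conj_basisVec s, T.symm_conj, T.symm_conj, ← inner_conj_conj,
      conj_conj]
  rw [inner_creationPart, inner_creationPart, hsymm, inner_basisVec, inner_basisVec, kreinOp_apply,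
    kreinOp_apply, basisVec_apply, basisVec_apply, ccrForm_eq, kreinSign_swap, kreinSign_swap]
  by_cases h : t = s.swap
  · subst h
    simp [kreinSign_swap]
    ring
  · have h' : t.swap ≠ s := fun hs => h (by rw [← hs, Sum.swap_swap])
    simp [h, h', eq_comm]

theorem exists_isVacuumOf [DecidableEq ι] : ∃ ω : CCRState ι, ω.IsVacuumOf T.symmetry :=
  ⟨_, fun _ hF => CCRState.quasiFree_annihilatedBy T.inner_creationPart_commutator
    (T.creationPart_eq_zero hF)⟩

end Bogoliubov

namespace CCRAlgebra

open NambuSpace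

variable {ι : Type} [DecidableEq ι]

/-- The map `φ_s ↦ δ s` is `φ(F) ↦ φ(A F)`. -/
def Implements (A : NambuSpace ι →L[ℂ] NambuSpace ι) (δ : ι ⊕ ι → CCRAlgebra ι) : Prop :=
  ∀ s, ∃ c : ι ⊕ ι →₀ ℂ, A (basisVec s) = c.sum (fun t a => a • basisVec t) ∧
    δ s = c.sum fun t a => a • nambu t

theorem IsVacuumFunctional.hasSum_implements_iff {S A : NambuSpace ι →L[ℂ] NambuSpace ι}
    {η : CCRAlgebra ι →ₗ[ℂ] ℂ} (h : IsVacuumFunctional S η) (hS : S * S = 1)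
    {δ : ι ⊕ ι → CCRAlgebra ι} (hA : Implements A δ) (X : CCRAlgebra ι) (F : NambuSpace ι)
    (x : ℂ) : HasSum (fun s => F s * η (X * δ s)) x ↔
      HasSum (fun s => A F s * η (X * nambu s)) x := by
  obtain ⟨Λ, hΛ⟩ := h.exists_functional hS X
  have hδ (s : ι ⊕ ι) : Λ (A (basisVec s)) = η (X * δ s) := by
    obtain ⟨c, hc, hc'⟩ := hA s
    simp [hc, hc', Finsupp.sum, Finset.mul_sum, hΛ]
  have hsum : HasSum (fun s => F s * η (X * δ s)) (Λ (A F)) := by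
    simpa [hδ] using hasSum_map_basisVec (Λ ∘L A) F
  have hsum' : HasSum (fun s => A F s * η (X * nambu s)) (Λ (A F)) := by
    simpa [hΛ] using hasSum_map_basisVec Λ (A F)
  exact ⟨fun hx => hx.unique hsum ▸ hsum', fun hx => hx.unique hsum' ▸ hsum⟩

theorem relabel_nambu (e : ι ≃ ι) (s : ι ⊕ ι) :
    relabel e (nambu s) = nambu (Sum.map e e s) := lift_nambu _ _ s

theorem relabel_star (e : ι ≃ ι) (X : CCRAlgebra ι) : relabel e (star X) = star (relabel e X) := by
  induction X using induction_word with
  | word l =>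
    induction l with
    | nil => simp [word_nil]
    | cons s l ih =>
      simp only [word_cons, star_mul, map_mul, ih, star_nambu, relabel_nambu]
      rcases s with i | i <;> rfl
  | add X Y hX hY => simp only [star_add, map_add, hX, hY]
  | smul c X hX => simp only [star_smul, map_smul, hX]

theorem conjOp_eq_self_of_map_basisVec (e : ι ≃ ι) {U : NambuSpace ι →L[ℂ] NambuSpace ι}
    (hU : ∀ s, U (basisVec s) = basisVec (Sum.map e e s)) : conjOp U = U := by
  refine clm_ext fun s => ?_
  rw [conjOp_apply, conj_basisVec, hU, hU, conj_basisVec]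
  rcases s with i | i <;> rfl

theorem implements_relabel (e : ι ≃ ι) {U : NambuSpace ι →L[ℂ] NambuSpace ι}
    (hU : ∀ s, U (basisVec s) = basisVec (Sum.map e e s)) :
    Implements U fun s => relabel e (nambu s) := fun s =>
  ⟨Finsupp.single (Sum.map e e s) 1, by simp [hU], by simp [relabel_nambu]⟩

end CCRAlgebra

namespace CCRState.IsVacuumOf

open CCRAlgebra NambuSpace

variable {ι : Type} [DecidableEq ι] {ω : CCRState ι} {S : NambuSpace ι →L[ℂ] NambuSpace ι}

section Derivation

variable {G : NambuSpace ι →L[ℂ] NambuSpace ι} {δ : CCRAlgebra ι →ₗ[ℂ] CCRAlgebra ι}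

theorem commute_of_derivation_invariant (h : ω.IsVacuumOf S) (hS : S * S = 1)
    (hSc : conjOp S = -S) (hGc : conjOp G = -G) (hδ : ∀ X Y, δ (X * Y) = δ X * Y + X * δ Y)
    (hG : Implements G fun s => δ (nambu s)) (hω : ∀ X, ω.expect (δ X) = 0) : Commute S G := by
  have hη := h.isVacuumFunctional hSc
  refine commute_of_map_eq_self hS hSc (ε := -1) (by rw [hGc, neg_one_smul]) fun F hF =>
    hη.map_eq_self hS ω.normalized fun t => (hη.hasSum_implements_iff hS hG _ F 0).1 ?_
  have hneg (s : ι ⊕ ι) : ω.expect (nambu t * δ (nambu s)) =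
      -ω.expect (δ (nambu t) * nambu s) := by
    rw [eq_neg_iff_add_eq_zero, add_comm, ← map_add, ← hδ, hω]
  simpa [hneg] using (h F hF (δ (nambu t))).neg

theorem derivation_invariant_of_commute (h : ω.IsVacuumOf S) (hS : S * S = 1)
    (hSc : conjOp S = -S) (hδ : ∀ X Y, δ (X * Y) = δ X * Y + X * δ Y)
    (hδ_star : ∀ X, δ (star X) = -star (δ X)) (hG : Implements G fun s => δ (nambu s))
    (hcomm : Commute S G) (X : CCRAlgebra ι) : ω.expect (δ X) = 0 := by
  have hη := h.isVacuumFunctional hSc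
  have hvac : IsVacuumFunctional S (ω.expect ∘ₗ δ) := by
    refine isVacuumFunctional_of_star hSc (ε := -1)
      (fun X => by simp [hδ_star, ω.expect_star]) fun F hF X => ?_
    have hGF : S (G F) = G F := by
      rw [← mul_apply_eq_comp, hcomm.eq, mul_apply_eq_comp, hF]
    have hsum := (hη.hasSum_implements_iff hS hG X F 0).2 (h _ hGF X)
    simpa [hδ, mul_add] using (h F hF (δ X)).add hsum
  have hone : δ 1 = 0 := by simpa using hδ 1 1
  exact DFunLike.congr_fun (hvac.eq_zero hS (by simp [hone])) X

/-- The derivation stands for the commutator with a quadratic Hamiltonian. -/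
theorem derivation_invariant_iff (h : ω.IsVacuumOf S) (hS : S * S = 1)
    (hSc : conjOp S = -S) (hGc : conjOp G = -G) (hδ : ∀ X Y, δ (X * Y) = δ X * Y + X * δ Y)
    (hδ_star : ∀ X, δ (star X) = -star (δ X)) (hG : Implements G fun s => δ (nambu s)) :
    (∀ X, ω.expect (δ X) = 0) ↔ Commute S G :=
  ⟨h.commute_of_derivation_invariant hS hSc hGc hδ hG,
    h.derivation_invariant_of_commute hS hSc hδ hδ_star hG⟩

end Derivation

section Relabel

variable {U : NambuSpace ι →L[ℂ] NambuSpace ι} (e : ι ≃ ι)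

theorem commute_of_relabel_invariant (h : ω.IsVacuumOf S) (hS : S * S = 1) (hSc : conjOp S = -S)
    (hU : ∀ s, U (basisVec s) = basisVec (Sum.map e e s))
    (hω : ∀ X, ω.expect (relabel e X) = ω.expect X) : Commute S U := by
  have hη := h.isVacuumFunctional hSc
  refine commute_of_map_eq_self hS hSc (ε := 1)
    (by rw [conjOp_eq_self_of_map_basisVec e hU, one_smul]) fun F hF =>
    hη.map_eq_self hS ω.normalized fun t =>
      (hη.hasSum_implements_iff hS (implements_relabel e hU) _ F 0).1 ?_
  have ht : nambu t = relabel e (nambu (Sum.map e.symm e.symm t)) := by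
    rw [relabel_nambu]
    rcases t with i | i <;> simp
  simpa only [ht, ← map_mul, hω] using h F hF (nambu (Sum.map e.symm e.symm t))

theorem relabel_invariant_of_commute (h : ω.IsVacuumOf S) (hS : S * S = 1) (hSc : conjOp S = -S)
    (hU : ∀ s, U (basisVec s) = basisVec (Sum.map e e s)) (hcomm : Commute S U)
    (X : CCRAlgebra ι) : ω.expect (relabel e X) = ω.expect X := by
  have hη := h.isVacuumFunctional hSc
  have hvac : IsVacuumFunctional S (ω.expect ∘ₗ (relabel e).toLinearMap) := by
    refine isVacuumFunctional_of_star hSc (ε := 1)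
      (fun X => by simp [relabel_star, ω.expect_star]) fun F hF X => ?_
    have hUF : S (U F) = U F := by
      rw [← mul_apply_eq_comp, hcomm.eq, mul_apply_eq_comp, hF]
    simpa using (hη.hasSum_implements_iff hS (implements_relabel e hU) (relabel e X) F 0).2
      (h _ hUF _)
  have hzero := (hvac.sub hη).eq_zero hS (by simp)
  exact sub_eq_zero.1 (DFunLike.congr_fun hzero X)

theorem relabel_invariant_iff (h : ω.IsVacuumOf S) (hS : S * S = 1) (hSc : conjOp S = -S)
    (hU : ∀ s, U (basisVec s) = basisVec (Sum.map e e s)) :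
    (∀ X, ω.expect (relabel e X) = ω.expect X) ↔ Commute S U :=
  ⟨h.commute_of_relabel_invariant e hS hSc hU, h.relabel_invariant_of_commute e hS hSc hU⟩

end Relabel

end CCRState.IsVacuumOf

namespace CCRAlgebra

variable {ι : Type} [DecidableEq ι]

theorem mul_nambu_commutator (a b c : ι ⊕ ι) :
    (nambu a * nambu b : CCRAlgebra ι) * nambu c - nambu c * (nambu a * nambu b)
      = ccrForm b c • nambu a + ccrForm a c • nambu b := by
  have h1 : (nambu a * nambu b : CCRAlgebra ι) * nambu c
      = nambu a * (nambu c * nambu b + algebraMap ℂ _ (ccrForm b c)) := by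
    rw [mul_assoc, nambu_mul]
  have h2 : (nambu c * (nambu a * nambu b) : CCRAlgebra ι)
      = (nambu a * nambu c - algebraMap ℂ _ (ccrForm a c)) * nambu b := by
    rw [nambu_mul a c, add_sub_cancel_right, mul_assoc]
  rw [h1, h2, Algebra.algebraMap_eq_smul_one, Algebra.algebraMap_eq_smul_one, mul_add, sub_mul,
    mul_smul_comm, smul_mul_assoc, mul_one, one_mul, ← mul_assoc]
  abel

end CCRAlgebra

/-- The matrices that act on the components at one site. -/
abbrev SiteMatrix (d : ℕ) : Type := Matrix (Fin d ⊕ Fin d) (Fin d ⊕ Fin d) ℂ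

namespace QBH

open CCRAlgebra NambuSpace

variable {D d : ℕ} (H : QBH D d)

/-- The label of the `s`-th of the `2d` generators at the site `j`. -/
def siteIndex (j : Fin D → ℤ) (s : Fin d ⊕ Fin d) : LatticeMode D d ⊕ LatticeMode D d :=
  Sum.map (Prod.mk j) (Prod.mk j) s

/-- A finite set of lattice vectors that supports the hopping and the pairing matrices, enlarged
to be closed under negation and to contain `0`. -/
def rangeSet : Finset (Fin D → ℤ) :=
  insert 0 ((H.K.support ∪ H.Δ.support) ∪ (H.K.support ∪ H.Δ.support).image Neg.neg)

theorem support_K_subset_rangeSet : H.K.support ⊆ H.rangeSet := fun r hr => by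
  simp only [rangeSet, Finset.mem_insert, Finset.mem_union]; tauto

theorem support_Δ_subset_rangeSet : H.Δ.support ⊆ H.rangeSet := fun r hr => by
  simp only [rangeSet, Finset.mem_insert, Finset.mem_union]; tauto

theorem zero_mem_rangeSet : 0 ∈ H.rangeSet := Finset.mem_insert_self _ _

theorem neg_mem_rangeSet {r : Fin D → ℤ} (h : r ∈ H.rangeSet) : -r ∈ H.rangeSet := by
  simp only [rangeSet, Finset.mem_insert, Finset.mem_union, Finset.mem_image] at h ⊢
  rcases h with rfl | h | ⟨r', h, rfl⟩
  · exact .inl neg_zero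
  · exact .inr (.inr ⟨r, h, rfl⟩)
  · exact .inr (.inl (by simpa using h))

/-- The dynamical matrices in real space: `bloch` is their Fourier transform. -/
def dynamicalMatrix (r : Fin D → ℤ) : SiteMatrix d :=
  Matrix.fromBlocks (H.K r) (H.Δ r) (-(H.Δ r).map (starRingEnd ℂ)) (-(H.K r).map (starRingEnd ℂ))

theorem siteTerm_eq (j : Fin D → ℤ) : H.siteTerm j =
    (∑ r ∈ H.rangeSet, ∑ ℓ, ∑ ℓ', H.K r ℓ ℓ' • (cre (j, ℓ) * ann (j + r, ℓ')))
    + (1 / 2 : ℂ) • ∑ r ∈ H.rangeSet, ∑ ℓ, ∑ ℓ',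
      (H.Δ r ℓ ℓ' • (cre (j, ℓ) * cre (j + r, ℓ'))
        + starRingEnd ℂ (H.Δ r ℓ ℓ') • (ann (j + r, ℓ') * ann (j, ℓ))) := by
  have hs : ∀ (c : ℂ) (a b : LatticeMode D d), star (c • (cre a * cre b : CCRAlgebra _))
      = starRingEnd ℂ c • (ann b * ann a) := by
    intro c a b
    rw [star_smul, star_mul, cre, cre, star_nambu, star_nambu]
    rfl
  rw [siteTerm, Finsupp.sum_of_support_subset _ H.support_K_subset_rangeSet,
    Finsupp.sum_of_support_subset _ H.support_Δ_subset_rangeSet]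
  · simp only [hs]
  · intro r _; simp
  · intro r _; simp

section Sums

variable {E : Type*} [AddCommMonoid E] [Module ℂ E] {R S : Finset (Fin D → ℤ)} {i : Fin D → ℤ}
  (M : (Fin D → ℤ) → Matrix (Fin d) (Fin d) ℂ) (f : LatticeMode D d → E) (p : Fin d)

theorem sum_site_left (hi : i ∈ S) : ∑ j ∈ S, ∑ r ∈ R, ∑ ℓ, ∑ ℓ',
      M r ℓ ℓ' • ((if (j, ℓ) = (i, p) then (1 : ℂ) else 0) • f (j + r, ℓ'))
    = ∑ r ∈ R, ∑ ℓ', M r p ℓ' • f (i + r, ℓ') := by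
  rw [Finset.sum_eq_single i]
  · refine Finset.sum_congr rfl fun r _ => ?_
    rw [Finset.sum_eq_single p]
    · simp
    · intro ℓ _ hℓ; simp [hℓ]
    · simp
  · intro j _ hj; simp [hj]
  · intro h; exact absurd hi h

theorem sum_site_right (hR : ∀ r ∈ R, -r ∈ R) (hi : ∀ r ∈ R, i + r ∈ S) :
    ∑ j ∈ S, ∑ r ∈ R, ∑ ℓ, ∑ ℓ',
      M r ℓ ℓ' • ((if (j + r, ℓ') = (i, p) then (1 : ℂ) else 0) • f (j, ℓ))
    = ∑ r ∈ R, ∑ ℓ, M (-r) ℓ p • f (i + r, ℓ) := by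
  rw [Finset.sum_comm]
  refine Finset.sum_bij' (fun r _ => -r) (fun r _ => -r) (fun r hr => hR r hr)
    (fun r hr => hR r hr) (fun r _ => neg_neg r) (fun r _ => neg_neg r) fun r hr => ?_
  rw [Finset.sum_eq_single (i + -r)]
  · refine Finset.sum_congr rfl fun ℓ _ => ?_
    rw [Finset.sum_eq_single p]
    · simp
    · intro ℓ' _ hℓ'; simp [hℓ']
    · simp
  · intro j _ hj
    have : j + r ≠ i := fun h => hj (by rw [← h]; abel)
    simp [this]
  · intro h; exact absurd (hi _ (hR r hr)) h

end Sums

theorem K_neg_apply (r : Fin D → ℤ) (ℓ p : Fin d) : H.K (-r) ℓ p = starRingEnd ℂ (H.K r p ℓ) := by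
  rw [← H.K_adj]
  rfl

theorem Δ_neg_apply (r : Fin D → ℤ) (ℓ p : Fin d) : H.Δ (-r) ℓ p = H.Δ r p ℓ := by
  rw [← H.Δ_transpose]
  rfl

theorem siteTerm_commutator (j : Fin D → ℤ) (c : LatticeMode D d ⊕ LatticeMode D d) :
    H.siteTerm j * nambu c - nambu c * H.siteTerm j
      = ∑ r ∈ H.rangeSet, ∑ ℓ, ∑ ℓ', H.K r ℓ ℓ' •
          (ccrForm (.inl (j + r, ℓ')) c • cre (j, ℓ) + ccrForm (.inr (j, ℓ)) c • ann (j + r, ℓ'))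
        + (1 / 2 : ℂ) • ∑ r ∈ H.rangeSet, ∑ ℓ, ∑ ℓ', (H.Δ r ℓ ℓ' •
          (ccrForm (.inr (j + r, ℓ')) c • cre (j, ℓ) + ccrForm (.inr (j, ℓ)) c • cre (j + r, ℓ'))
          + starRingEnd ℂ (H.Δ r ℓ ℓ') • (ccrForm (.inl (j, ℓ)) c • ann (j + r, ℓ')
            + ccrForm (.inl (j + r, ℓ')) c • ann (j, ℓ))) := by
  rw [siteTerm_eq, add_mul, mul_add, add_sub_add_comm, smul_mul_assoc, mul_smul_comm, ← smul_sub]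
  congr 1
  · simp only [Finset.sum_mul, Finset.mul_sum, ← Finset.sum_sub_distrib, smul_mul_assoc,
      mul_smul_comm, ← smul_sub]
    simp only [cre, ann, mul_nambu_commutator]
  · congr 1
    simp only [Finset.sum_mul, Finset.mul_sum, ← Finset.sum_sub_distrib, smul_mul_assoc,
      mul_smul_comm, add_mul, mul_add, add_sub_add_comm, ← smul_sub]
    simp only [cre, ann, mul_nambu_commutator]

section PartialSum

variable {S : Finset (Fin D → ℤ)} {i : Fin D → ℤ} (hS : ∀ r ∈ H.rangeSet, i + r ∈ S)
include hS

theorem partialSum_commutator_ann (p : Fin d) :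
    H.partialSum S * ann (i, p) - ann (i, p) * H.partialSum S
      = -∑ r ∈ H.rangeSet, (∑ q, H.K r p q • ann (i + r, q) + ∑ q, H.Δ r p q • cre (i + r, q)) := by
  have hi : i ∈ S := by simpa using hS 0 H.zero_mem_rangeSet
  have hR : ∀ r ∈ H.rangeSet, -r ∈ H.rangeSet := fun r => H.neg_mem_rangeSet
  have hann : ∀ a : LatticeMode D d, ccrForm (.inl a) (.inl (i, p)) = 0 := fun a => rfl
  have hcre : ∀ (a : LatticeMode D d) (Y : CCRAlgebra (LatticeMode D d)),
      ccrForm (.inr a) (.inl (i, p)) • Y = (if a = (i, p) then (1 : ℂ) else 0) • -Y := by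
    intro a Y
    change (if a = (i, p) then (-1 : ℂ) else 0) • Y = _
    split_ifs <;> simp
  have hK := sum_site_left (R := H.rangeSet) H.K
    (fun a => -(ann a : CCRAlgebra (LatticeMode D d))) p hi
  have hΔ_left := sum_site_left (R := H.rangeSet) H.Δ
    (fun a => -(cre a : CCRAlgebra (LatticeMode D d))) p hi
  have hΔ_right := sum_site_right H.Δ (fun a => -(cre a : CCRAlgebra (LatticeMode D d))) p hR hS
  rw [partialSum, ann, Finset.sum_mul, Finset.mul_sum, ← Finset.sum_sub_distrib]
  simp only [siteTerm_commutator, hann, hcre, zero_smul, zero_add, add_zero, smul_zero, smul_add,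
    Finset.sum_add_distrib, ← Finset.smul_sum]
  rw [hK, hΔ_left, hΔ_right]
  simp only [Δ_neg_apply, smul_neg, Finset.sum_neg_distrib]
  module

theorem partialSum_commutator_cre (p : Fin d) :
    H.partialSum S * cre (i, p) - cre (i, p) * H.partialSum S
      = ∑ r ∈ H.rangeSet, (∑ q, starRingEnd ℂ (H.Δ r p q) • ann (i + r, q)
          + ∑ q, starRingEnd ℂ (H.K r p q) • cre (i + r, q)) := by
  have hi : i ∈ S := by simpa using hS 0 H.zero_mem_rangeSet
  have hR : ∀ r ∈ H.rangeSet, -r ∈ H.rangeSet := fun r => H.neg_mem_rangeSet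
  have hcre : ∀ a : LatticeMode D d, ccrForm (.inr a) (.inr (i, p)) = 0 := fun a => rfl
  have hann : ∀ a : LatticeMode D d,
      ccrForm (.inl a) (.inr (i, p)) = if a = (i, p) then (1 : ℂ) else 0 := fun a => rfl
  have hK := sum_site_right H.K (fun a => (cre a : CCRAlgebra (LatticeMode D d))) p hR hS
  have hΔ_left := sum_site_left (R := H.rangeSet) (fun r => (H.Δ r).map (starRingEnd ℂ))
    (fun a => (ann a : CCRAlgebra (LatticeMode D d))) p hi
  have hΔ_right := sum_site_right (fun r => (H.Δ r).map (starRingEnd ℂ))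
    (fun a => (ann a : CCRAlgebra (LatticeMode D d))) p hR hS
  simp only [Matrix.map_apply] at hΔ_left hΔ_right
  rw [partialSum, cre, Finset.sum_mul, Finset.mul_sum, ← Finset.sum_sub_distrib]
  simp only [siteTerm_commutator, hann, hcre, zero_smul, zero_add, add_zero, smul_zero, smul_add,
    Finset.sum_add_distrib, ← Finset.smul_sum]
  rw [hK, hΔ_left, hΔ_right]
  simp only [Δ_neg_apply, K_neg_apply]
  module

theorem partialSum_commutator (s : Fin d ⊕ Fin d) :
    H.partialSum S * nambu (siteIndex i s) - nambu (siteIndex i s) * H.partialSum S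
      = -∑ r ∈ H.rangeSet, ∑ t, H.dynamicalMatrix r s t • nambu (siteIndex (i + r) t) := by
  simp only [Fintype.sum_sum_type]
  rcases s with p | p
  · exact H.partialSum_commutator_ann hS p
  · rw [← Finset.sum_neg_distrib]
    refine (H.partialSum_commutator_cre hS p).trans (Finset.sum_congr rfl fun r _ => ?_)
    simp only [dynamicalMatrix, Matrix.fromBlocks_apply₂₁, Matrix.fromBlocks_apply₂₂, siteIndex,
      Sum.map_inl, Sum.map_inr, cre, ann, Matrix.neg_apply, Matrix.map_apply, neg_smul,
      Finset.sum_neg_distrib, neg_add, neg_neg]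

end PartialSum

theorem exists_siteIndex (c : LatticeMode D d ⊕ LatticeMode D d) : ∃ i s, c = siteIndex i s := by
  rcases c with ⟨i, p⟩ | ⟨i, p⟩
  · exact ⟨i, .inl p, rfl⟩
  · exact ⟨i, .inr p, rfl⟩

theorem eventually_commutator_nambu (i : Fin D → ℤ) (s : Fin d ⊕ Fin d) :
    ∀ᶠ S in (Filter.atTop : Filter (Finset (Fin D → ℤ))),
      H.partialSum S * nambu (siteIndex i s) - nambu (siteIndex i s) * H.partialSum S
      = -∑ r ∈ H.rangeSet, ∑ t, H.dynamicalMatrix r s t • nambu (siteIndex (i + r) t) := by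
  filter_upwards [Filter.eventually_ge_atTop (H.rangeSet.image (i + ·))] with S hS
  exact H.partialSum_commutator (fun r hr => hS (Finset.mem_image_of_mem _ hr)) s

theorem exists_commutator (Y : CCRAlgebra (LatticeMode D d)) :
    ∃ Z, ∀ᶠ S in (Filter.atTop : Filter (Finset (Fin D → ℤ))),
      H.partialSum S * Y - Y * H.partialSum S = Z := by
  induction Y using induction_word with
  | word l =>
    induction l with
    | nil => exact ⟨0, Filter.Eventually.of_forall fun S => by simp [word_nil]⟩
    | cons c l ih =>
      obtain ⟨Z, hZ⟩ := ih
      obtain ⟨i, s, rfl⟩ := exists_siteIndex c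
      refine ⟨(-∑ r ∈ H.rangeSet, ∑ t, H.dynamicalMatrix r s t • nambu (siteIndex (i + r) t))
        * word l + nambu (siteIndex i s) * Z, ?_⟩
      filter_upwards [hZ, H.eventually_commutator_nambu i s] with S hword hnambu
      rw [← hword, ← hnambu, word_cons]
      noncomm_ring
  | add Y Y' hY hY' =>
    obtain ⟨⟨Z, hZ⟩, Z', hZ'⟩ := And.intro hY hY'
    refine ⟨Z + Z', ?_⟩
    filter_upwards [hZ, hZ'] with S h h'
    rw [← h, ← h']
    noncomm_ring
  | smul c Y hY =>
    obtain ⟨Z, hZ⟩ := hY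
    refine ⟨c • Z, ?_⟩
    filter_upwards [hZ] with S h
    rw [← h, mul_smul_comm, smul_mul_assoc, smul_sub]

/-- The derivation `[H, ·]` of the CCR algebra: the eventually constant value of the commutators
with the partial sums of `H`. -/
def commutatorMap : CCRAlgebra (LatticeMode D d) →ₗ[ℂ] CCRAlgebra (LatticeMode D d) where
  toFun Y := (H.exists_commutator Y).choose
  map_add' Y Z := by
    obtain ⟨S, ⟨hYZ, hY⟩, hZ⟩ := (((H.exists_commutator (Y + Z)).choose_spec.and
      (H.exists_commutator Y).choose_spec).and (H.exists_commutator Z).choose_spec).exists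
    rw [← hYZ, ← hY, ← hZ]
    noncomm_ring
  map_smul' c Y := by
    obtain ⟨S, hcY, hY⟩ := ((H.exists_commutator (c • Y)).choose_spec.and
      (H.exists_commutator Y).choose_spec).exists
    rw [← hcY, ← hY, mul_smul_comm, smul_mul_assoc, smul_sub, RingHom.id_apply]

theorem eventually_commutatorMap (Y : CCRAlgebra (LatticeMode D d)) :
    ∀ᶠ S in (Filter.atTop : Filter (Finset (Fin D → ℤ))),
      H.partialSum S * Y - Y * H.partialSum S = H.commutatorMap Y :=
  (H.exists_commutator Y).choose_spec

theorem commutatorMap_mul (Y Z : CCRAlgebra (LatticeMode D d)) :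
    H.commutatorMap (Y * Z) = H.commutatorMap Y * Z + Y * H.commutatorMap Z := by
  obtain ⟨S, ⟨hYZ, hY⟩, hZ⟩ := (((H.eventually_commutatorMap (Y * Z)).and
    (H.eventually_commutatorMap Y)).and (H.eventually_commutatorMap Z)).exists
  rw [← hYZ, ← hY, ← hZ]
  noncomm_ring

theorem commutatorMap_nambu (i : Fin D → ℤ) (s : Fin d ⊕ Fin d) :
    H.commutatorMap (nambu (siteIndex i s))
      = -∑ r ∈ H.rangeSet, ∑ t, H.dynamicalMatrix r s t • nambu (siteIndex (i + r) t) := by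
  obtain ⟨S, h, h'⟩ := ((H.eventually_commutatorMap (nambu (siteIndex i s))).and
    (H.eventually_commutator_nambu i s)).exists
  rw [← h, ← h']

theorem dynamicalMatrix_swap (r : Fin D → ℤ) (s t : Fin d ⊕ Fin d) :
    H.dynamicalMatrix r s.swap t.swap = -starRingEnd ℂ (H.dynamicalMatrix r s t) := by
  rcases s with p | p <;> rcases t with q | q <;> simp [dynamicalMatrix]

theorem siteIndex_swap (i : Fin D → ℤ) (s : Fin d ⊕ Fin d) :
    (siteIndex i s).swap = siteIndex i s.swap := by
  rcases s with p | p <;> rfl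

theorem commutatorMap_star_nambu (c : LatticeMode D d ⊕ LatticeMode D d) :
    H.commutatorMap (star (nambu c)) = -star (H.commutatorMap (nambu c)) := by
  obtain ⟨i, s, rfl⟩ := exists_siteIndex c
  rw [star_nambu, siteIndex_swap, commutatorMap_nambu, commutatorMap_nambu, star_neg, star_sum]
  congr 1
  rw [← Finset.sum_neg_distrib]
  refine Finset.sum_congr rfl fun r _ => ?_
  rw [star_sum, ← Finset.sum_neg_distrib]
  refine Fintype.sum_equiv (Equiv.sumComm _ _) _ _ fun t => ?_
  have hswap := H.dynamicalMatrix_swap r s t.swap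
  rw [Sum.swap_swap] at hswap
  rw [hswap, star_smul, star_nambu, siteIndex_swap, Equiv.sumComm_apply, Sum.swap_swap, neg_smul]
  rfl

theorem commutatorMap_star (Y : CCRAlgebra (LatticeMode D d)) :
    H.commutatorMap (star Y) = -star (H.commutatorMap Y) := by
  induction Y using induction_word with
  | word l =>
    induction l with
    | nil =>
      have h_one : H.commutatorMap 1 = 0 := by simpa using H.commutatorMap_mul 1 1
      simp [word_nil, h_one]
    | cons c l ih =>
      rw [word_cons, star_mul, commutatorMap_mul, commutatorMap_mul, ih, commutatorMap_star_nambu,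
        star_add, star_mul, star_mul]
      noncomm_ring
  | add Y Z hY hZ =>
    rw [star_add, map_add, map_add, star_add, hY, hZ, neg_add]
  | smul c Y hY =>
    rw [star_smul, map_smul, map_smul, star_smul, hY, smul_neg]

theorem isEigenstate_iff (ω : CCRState (LatticeMode D d)) :
    H.IsEigenstate ω ↔ ∀ Y, ω.expect (H.commutatorMap Y) = 0 := by
  refine forall_congr' fun Y => ?_
  rw [Filter.eventually_congr ((H.eventually_commutatorMap Y).mono fun S hS => by rw [hS]),
    Filter.eventually_const]

end QBH

section MultiplicationOperators

open MeasureTheory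
open scoped ENNReal

variable {X : Type*} [TopologicalSpace X] [CompactSpace X] [MeasurableSpace X] [BorelSpace X]
  (μ : Measure X) [IsFiniteMeasure μ]

/-- Multiplication by a continuous function on `L²`. -/
def mulOperator (f : C(X, ℂ)) : Lp ℂ 2 μ →L[ℂ] Lp ℂ 2 μ :=
  (ContinuousLinearMap.mul ℂ ℂ).holderL μ ∞ 2 2 (ContinuousMap.toLp ∞ μ ℂ f)

theorem coeFn_mulOperator (f : C(X, ℂ)) (g : Lp ℂ 2 μ) :
    mulOperator μ f g =ᵐ[μ] fun x => f x * g x := by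
  have h_holder :=
    (ContinuousLinearMap.mul ℂ ℂ).coeFn_holder (r := 2) (ContinuousMap.toLp ∞ μ ℂ f) g
  filter_upwards [h_holder, ContinuousMap.coeFn_toLp (p := ∞) (𝕜 := ℂ) μ f] with x hx hfx
  rw [← hfx]
  exact hx

/-- The representation of continuous functions by multiplication operators on `L²`. -/
def mulRep : C(X, ℂ) →⋆ₐ[ℂ] (Lp ℂ 2 μ →L[ℂ] Lp ℂ 2 μ) where
  toFun := mulOperator μ
  map_one' := by
    ext1 g
    refine Lp.ext ?_
    filter_upwards [coeFn_mulOperator μ 1 g] with x hx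
    simpa using hx
  map_mul' f f' := by
    ext1 g
    refine Lp.ext ?_
    filter_upwards [coeFn_mulOperator μ (f * f') g, coeFn_mulOperator μ f (mulOperator μ f' g),
      coeFn_mulOperator μ f' g] with x hff' hf hf'
    change _ = (mulOperator μ f (mulOperator μ f' g)) x
    rw [hff', hf, hf', ContinuousMap.mul_apply, mul_assoc]
  map_zero' := by simp [mulOperator]
  map_add' f f' := by simp [mulOperator]
  commutes' c := by
    ext1 g
    refine Lp.ext ?_
    filter_upwards [coeFn_mulOperator μ (algebraMap ℂ _ c) g, Lp.coeFn_smul c g] with x hc hsmul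
    rw [hc, Algebra.algebraMap_eq_smul_one]
    change _ = (c • g : Lp ℂ 2 μ) x
    rw [hsmul]
    simp
  map_star' f := by
    rw [ContinuousLinearMap.star_eq_adjoint, ContinuousLinearMap.eq_adjoint_iff]
    intro g h
    rw [L2.inner_def, L2.inner_def]
    refine integral_congr_ae ?_
    filter_upwards [coeFn_mulOperator μ (star f) g, coeFn_mulOperator μ f h] with x hg hh
    rw [hg, hh]
    simp only [ContinuousMap.star_apply, RCLike.star_def, RCLike.inner_apply', map_mul,
      RingHomCompTriple.comp_apply, RingHom.id_apply]
    ring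

theorem mulRep_toLp (f g : C(X, ℂ)) :
    mulRep μ f (ContinuousMap.toLp 2 μ ℂ g) = ContinuousMap.toLp 2 μ ℂ (f * g) := by
  refine Lp.ext ?_
  filter_upwards [coeFn_mulOperator μ f (ContinuousMap.toLp 2 μ ℂ g),
    ContinuousMap.coeFn_toLp (p := 2) (𝕜 := ℂ) μ g,
    ContinuousMap.coeFn_toLp (p := 2) (𝕜 := ℂ) μ (f * g)] with x hf hg hfg
  rw [hfg, ContinuousMap.mul_apply, ← hg]
  exact hf

theorem continuous_mulRep : Continuous (mulRep μ) :=
  (((ContinuousLinearMap.mul ℂ ℂ).holderL μ ∞ 2 2).comp (ContinuousMap.toLp ∞ μ ℂ)).continuous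

end MultiplicationOperators

section Convolution

open MeasureTheory

attribute [local instance] instMeasureSpaceUnitAddCircle

instance isProbabilityMeasure_volume_unitAddCircle :
    IsProbabilityMeasure (volume : Measure UnitAddCircle) :=
  inferInstanceAs (IsProbabilityMeasure AddCircle.haarAddCircle)

/-- The continuous functions on the torus act on `ℓ²(ℤ^D)` by multiplication in Fourier space,
that is, by convolution with their Fourier coefficients. -/
def convolutionRep (D : ℕ) : C(UnitAddTorus (Fin D), ℂ) →⋆ₐ[ℂ]
    (lp (fun _ : Fin D → ℤ => ℂ) 2 →L[ℂ] lp (fun _ : Fin D → ℤ => ℂ) 2) :=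
  UnitAddTorus.mFourierBasis.repr.conjStarAlgEquiv.toStarAlgHom.comp (mulRep volume)

theorem continuous_convolutionRep (D : ℕ) : Continuous (convolutionRep D) :=
  continuous_const.clm_comp ((continuous_mulRep volume).clm_comp continuous_const)

theorem convolutionRep_mFourier {D : ℕ} (r j : Fin D → ℤ) :
    convolutionRep D (UnitAddTorus.mFourier r) (lp.single 2 j 1) = lp.single 2 (j + r) (1 : ℂ) := by
  let b := UnitAddTorus.mFourierBasis (d := Fin D)
  have hb : ∀ j, b j = ContinuousMap.toLp 2 volume ℂ (UnitAddTorus.mFourier j) :=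
    fun j => congrFun UnitAddTorus.coe_mFourierBasis j
  change b.repr (mulRep volume (UnitAddTorus.mFourier r) (b.repr.symm (lp.single 2 j 1))) = _
  rw [b.repr_symm_single, hb, mulRep_toLp, ← b.repr_self, hb]
  congr 2
  ext x
  rw [ContinuousMap.mul_apply, UnitAddTorus.mFourier_add, mul_comm]

end Convolution

section Amplification

open ContinuousLinearMap

variable {n E F : Type*} [Fintype n] [DecidableEq n]
  [NormedAddCommGroup E] [InnerProductSpace ℂ E] [CompleteSpace E]
  [NormedAddCommGroup F] [InnerProductSpace ℂ F] [CompleteSpace F]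

/-- Isometries `J s : E → F` whose ranges are orthogonal and span `F`: they identify `F` with a
direct sum of copies of `E`. -/
structure IsIsometricDecomposition (J : n → E →L[ℂ] F) : Prop where
  adjoint_comp : ∀ s t, adjoint (J s) ∘L J t = if s = t then 1 else 0
  sum_comp_adjoint : ∑ s, J s ∘L adjoint (J s) = 1

namespace IsIsometricDecomposition

variable {J : n → E →L[ℂ] F} {A : Type*} [Ring A] [StarRing A] [Algebra ℂ A]
  (m : A →⋆ₐ[ℂ] (E →L[ℂ] E))

theorem sandwich_mul_sandwich (hJ : IsIsometricDecomposition J) (s u v t : n) (a b : A) :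
    J s ∘L m a ∘L adjoint (J u) * J v ∘L m b ∘L adjoint (J t)
      = if u = v then J s ∘L m (a * b) ∘L adjoint (J t) else 0 := by
  have hassoc : J s ∘L m a ∘L adjoint (J u) * J v ∘L m b ∘L adjoint (J t)
      = J s ∘L m a ∘L (adjoint (J u) ∘L J v) ∘L m b ∘L adjoint (J t) := rfl
  rw [hassoc, hJ.adjoint_comp]
  split_ifs with h
  · rw [map_mul]
    rfl
  · simp

theorem sum_sandwich_algebraMap (hJ : IsIsometricDecomposition J) (c : ℂ) :
    ∑ s, ∑ t, J s ∘L m (algebraMap ℂ (Matrix n n A) c s t) ∘L adjoint (J t)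
      = algebraMap ℂ (F →L[ℂ] F) c := by
  have hentry : ∀ s t, J s ∘L m (algebraMap ℂ (Matrix n n A) c s t) ∘L adjoint (J t)
      = if s = t then c • J s ∘L adjoint (J t) else 0 := by
    intro s t
    rw [Matrix.algebraMap_matrix_apply]
    split_ifs with h
    · rw [AlgHomClass.commutes, Algebra.algebraMap_eq_smul_one]
      ext1 F
      simp
    · simp
  simp only [hentry, Finset.sum_ite_eq, Finset.mem_univ, if_true]
  rw [← Finset.smul_sum, hJ.sum_comp_adjoint, Algebra.algebraMap_eq_smul_one]

theorem sum_sandwich_mul (hJ : IsIsometricDecomposition J) (M N : Matrix n n A) :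
    ∑ s, ∑ t, J s ∘L m ((M * N) s t) ∘L adjoint (J t)
      = (∑ s, ∑ t, J s ∘L m (M s t) ∘L adjoint (J t))
        * ∑ s, ∑ t, J s ∘L m (N s t) ∘L adjoint (J t) := by
  rw [Finset.sum_mul]
  refine Finset.sum_congr rfl fun s _ => ?_
  simp only [Matrix.mul_apply, map_sum, finsetSum_comp, comp_finsetSum]
  rw [Finset.sum_mul, Finset.sum_comm]
  refine Finset.sum_congr rfl fun u _ => ?_
  simp only [Finset.mul_sum, hJ.sandwich_mul_sandwich]
  rw [Finset.sum_comm]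
  simp only [Finset.sum_ite_eq, Finset.mem_univ, if_true]

/-- A representation on `E` induces a representation of matrices on the sum `F` of copies
of `E`. -/
def matrixRep (hJ : IsIsometricDecomposition J) : Matrix n n A →⋆ₐ[ℂ] (F →L[ℂ] F) where
  toFun M := ∑ s, ∑ t, J s ∘L m (M s t) ∘L adjoint (J t)
  map_one' := by simpa using hJ.sum_sandwich_algebraMap m 1
  map_mul' M N := hJ.sum_sandwich_mul m M N
  map_zero' := by simp
  map_add' M N := by
    simp only [Matrix.add_apply, map_add, add_comp, comp_add, Finset.sum_add_distrib]
  commutes' c := hJ.sum_sandwich_algebraMap m c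
  map_star' M := by
    simp only [star_sum]
    rw [Finset.sum_comm]
    refine Finset.sum_congr rfl fun s _ => Finset.sum_congr rfl fun t _ => ?_
    simp only [Matrix.star_apply, map_star, star_eq_adjoint,
      ContinuousLinearMap.adjoint_comp, adjoint_adjoint, comp_assoc]

end IsIsometricDecomposition

end Amplification

/-- The matrix of entries of a continuous matrix function. -/
def matrixEntries (X n : Type*) [TopologicalSpace X] [Fintype n] [DecidableEq n] :
    C(X, Matrix n n ℂ) →⋆ₐ[ℂ] Matrix n n C(X, ℂ) where
  toFun A := .of fun s t => ⟨fun x => A x s t, (continuous_apply_apply s t).comp A.continuous⟩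
  map_one' := by
    ext s t x
    simp only [Matrix.of_apply, Matrix.one_apply, ContinuousMap.one_apply, ContinuousMap.coe_mk]
    split_ifs <;> rfl
  map_mul' A B := by
    ext s t x
    simp [Matrix.mul_apply]
  map_zero' := rfl
  map_add' _ _ := rfl
  commutes' c := by
    ext s t x
    change algebraMap ℂ (Matrix n n ℂ) c s t = _
    simp only [Matrix.algebraMap_matrix_apply]
    split_ifs <;> rfl
  map_star' _ := rfl

theorem continuous_matrixEntries_apply {X n : Type*} [TopologicalSpace X] [Fintype n]
    [DecidableEq n] (s t : n) : Continuous fun A : C(X, Matrix n n ℂ) => matrixEntries X n A s t :=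
  ContinuousMap.continuous_postcomp
    (⟨fun M => M s t, continuous_apply_apply s t⟩ : C(Matrix n n ℂ, ℂ))

namespace QBH

open ContinuousLinearMap NambuSpace
open scoped InnerProductSpace

variable {D d : ℕ}

theorem siteIndex_inj {i j : Fin D → ℤ} {s t : Fin d ⊕ Fin d} :
    siteIndex i s = siteIndex j t ↔ i = j ∧ s = t := by
  rcases s with p | p <;> rcases t with q | q <;> simp [siteIndex]

theorem orthonormal_basisVec_siteIndex (s : Fin d ⊕ Fin d) : Orthonormal ℂ
    fun j : Fin D → ℤ => (basisVec (siteIndex j s) : NambuSpace (LatticeMode D d)) := by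
  rw [orthonormal_iff_ite]
  intro i j
  rw [inner_basisVec, basisVec_apply]
  simp only [siteIndex_inj, and_true]

/-- The isometry of `ℓ²(ℤ^D)` onto the coefficient vectors supported on the `s`-th generator of
each site. -/
def siteEmbedding (D : ℕ) (s : Fin d ⊕ Fin d) :
    lp (fun _ : Fin D → ℤ => ℂ) 2 →L[ℂ] NambuSpace (LatticeMode D d) :=
  (orthonormal_basisVec_siteIndex s).orthogonalFamily.linearIsometry.toContinuousLinearMap

theorem siteEmbedding_single (s : Fin d ⊕ Fin d) (j : Fin D → ℤ) :
    siteEmbedding D s (lp.single 2 j 1) = basisVec (siteIndex j s) := by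
  refine ((orthonormal_basisVec_siteIndex s).orthogonalFamily.linearIsometry_apply_single
    (1 : ℂ)).trans ?_
  simp

theorem adjoint_siteEmbedding_basisVec (s t : Fin d ⊕ Fin d) (j : Fin D → ℤ) :
    adjoint (siteEmbedding D s) (basisVec (siteIndex j t))
      = if s = t then lp.single 2 j (1 : ℂ) else 0 := by
  ext i
  have hcoord : ∀ F : lp (fun _ : Fin D → ℤ => ℂ) 2, F i = ⟪lp.single 2 i (1 : ℂ), F⟫_ℂ := by
    simp [lp.inner_single_left]
  rw [hcoord, adjoint_inner_right, siteEmbedding_single, inner_basisVec, basisVec_apply]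
  simp only [siteIndex_inj]
  rcases eq_or_ne s t with rfl | hst
  · simp only [and_true, if_true, lp.coeFn_single, Pi.single_apply]
  · simp only [hst, and_false, if_false]
    rfl

theorem isIsometricDecomposition_siteEmbedding (D d : ℕ) :
    IsIsometricDecomposition (siteEmbedding (d := d) D) where
  adjoint_comp s t := by
    refine lp.ext_continuousLinearMap ENNReal.ofNat_ne_top fun j => ?_
    ext1
    simp only [comp_apply, lp.singleContinuousLinearMap_apply, siteEmbedding_single,
      adjoint_siteEmbedding_basisVec]
    split_ifs <;> rfl
  sum_comp_adjoint := by
    refine clm_ext fun c => ?_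
    obtain ⟨j, t, rfl⟩ := exists_siteIndex c
    simp only [sum_apply, comp_apply, adjoint_siteEmbedding_basisVec, apply_ite, map_zero,
      siteEmbedding_single, Finset.sum_ite_eq', Finset.mem_univ, if_true, one_apply_eq_self]

/-- The action of the continuous matrix functions on the torus, as symbols of convolution operators,
on the coefficient vectors of the lattice. -/
def blochRep (D d : ℕ) :
    C(UnitAddTorus (Fin D), SiteMatrix d) →⋆ₐ[ℂ]
      (NambuSpace (LatticeMode D d) →L[ℂ] NambuSpace (LatticeMode D d)) :=
  ((isIsometricDecomposition_siteEmbedding D d).matrixRep (convolutionRep D)).comp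
    (matrixEntries _ _)

theorem blochRep_apply (A : C(UnitAddTorus (Fin D), SiteMatrix d)) :
    blochRep D d A = ∑ s, ∑ t, siteEmbedding D s ∘L convolutionRep D (matrixEntries _ _ A s t) ∘L
      adjoint (siteEmbedding D t) := rfl

theorem continuous_blochRep (D d : ℕ) : Continuous (blochRep D d) := by
  refine Continuous.congr ?_ fun A => (blochRep_apply A).symm
  exact continuous_finsetSum _ fun s _ => continuous_finsetSum _ fun t _ =>
    continuous_const.clm_comp (((continuous_convolutionRep D).comp
      (continuous_matrixEntries_apply s t)).clm_comp continuous_const)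

/-- The matrix function `x ↦ e^{2πi r·x} A`. -/
def monomialSymbol (r : Fin D → ℤ) (A : SiteMatrix d) :
    C(UnitAddTorus (Fin D), SiteMatrix d) where
  toFun x := UnitAddTorus.mFourier r x • A
  continuous_toFun := by fun_prop

theorem blochRep_monomialSymbol (r : Fin D → ℤ) (A : SiteMatrix d)
    (j : Fin D → ℤ) (s : Fin d ⊕ Fin d) :
    blochRep D d (monomialSymbol r A) (basisVec (siteIndex j s))
      = ∑ t, A t s • basisVec (siteIndex (j + r) t) := by
  have hentries : ∀ t u, matrixEntries _ _ (monomialSymbol r A) t u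
      = A t u • UnitAddTorus.mFourier r := fun t u => ContinuousMap.ext fun x => mul_comm _ _
  simp only [blochRep_apply, sum_apply, comp_apply, adjoint_siteEmbedding_basisVec, hentries,
    map_smul, smul_apply, apply_ite, map_zero, Finset.sum_ite_eq', Finset.mem_univ, if_true,
    convolutionRep_mFourier, siteEmbedding_single]

end QBH

theorem aeval_units_conj {R A : Type*} [CommRing R] [Ring A] [Algebra R A] (u : Aˣ) (a : A)
    (p : Polynomial R) :
    Polynomial.aeval (u * a * ↑u⁻¹ : A) p = u * Polynomial.aeval a p * ↑u⁻¹ := by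
  simpa only [MulSemiringAction.toAlgHom_apply, ConjAct.units_smul_def, ConjAct.ofConjAct_toConjAct]
    using Polynomial.aeval_algHom_apply
      (MulSemiringAction.toAlgHom R A (ConjAct.toConjAct u)) a p

namespace IsFundamentalSymmetry

open Filter Topology

variable {A : Type*} [CStarAlgebra A] [PartialOrder A] {J S N : A}

theorem one_le_norm [Nontrivial A] (hS : IsFundamentalSymmetry J S) : 1 ≤ ‖S‖ := by
  have h : 1 ≤ ‖S‖ * ‖S‖ := by
    simpa only [hS.mul_self, CStarRing.norm_one] using norm_mul_le S S
  nlinarith [norm_nonneg S]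

variable [StarOrderedRing A]

/-- With `R := √(J S)` we have `star (R N) * (R N) = star N * J S N = J N S N = J S N N`. -/
theorem eq_zero_of_commute (hS : IsFundamentalSymmetry J S) (hJ : J * J = 1)
    (hJ_star : IsSelfAdjoint J) (hN : 0 ≤ J * N) (hNN : N * N = 0) (h : Commute N S) : N = 0 := by
  set R := CFC.sqrt (J * S)
  have hR_star : star R = R := (IsSelfAdjoint.of_nonneg (CFC.sqrt_nonneg _)).star_eq
  have hN_star : star N * J = J * N := by
    simpa only [star_mul, hJ_star.star_eq] using (IsSelfAdjoint.of_nonneg hN).star_eq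
  have hRN : star (R * N) * (R * N) = 0 := by
    calc star (R * N) * (R * N) = star N * (R * R) * N := by
          rw [star_mul, hR_star]; simp only [mul_assoc]
      _ = star N * J * S * N := by
        rw [CFC.sqrt_mul_sqrt_self _ hS.nonneg]; simp only [mul_assoc]
      _ = J * (S * N * N) := by rw [hN_star, mul_assoc J, h.eq]; simp only [mul_assoc]
      _ = 0 := by rw [mul_assoc, hNN, mul_zero, mul_zero]
  exact (hS.isUnit_sqrt hJ).mul_right_eq_zero.1 ((CStarRing.star_mul_self_eq_zero_iff _).1 hRN)

theorem eq_smul_of_commute (hS : IsFundamentalSymmetry J S) (hJ : J * J = 1)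
    (hJ_star : IsSelfAdjoint J) {c : ℝ} (hc : 0 ≤ c) (hN : 0 ≤ J * N) (hNN : N * N = c ^ 2 • 1)
    (h : Commute N S) : N = c • S := by
  rcases hc.eq_or_lt with rfl | hc
  · rw [hS.eq_zero_of_commute hJ hJ_star hN (by rw [hNN]; simp) h, zero_smul]
  · have hN' : IsFundamentalSymmetry J (c⁻¹ • N) := by
      refine ⟨?_, ?_⟩
      · rw [smul_mul_smul_comm, hNN, smul_smul, ← pow_two, inv_pow,
          inv_mul_cancel₀ (pow_pos hc 2).ne', one_smul]
      · rw [mul_smul_comm]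
        exact smul_nonneg (inv_nonneg.2 hc.le) hN
    rw [← hN'.eq_of_commute hS hJ (h.smul_left c⁻¹), smul_inv_smul₀ hc.ne']

/-- Conjugation by `√(J S)` makes `a` self-adjoint, and the inverse of `√(J S)` is
`J √(J S) J`. -/
theorem norm_aeval_le (hS : IsFundamentalSymmetry J S) (hJ : J * J = 1) (hJ_star : IsSelfAdjoint J)
    {a : A} (ha : star a * J = J * a) (h : Commute a S) {p : Polynomial ℝ} {c : ℝ} (hc : 0 ≤ c)
    (hp : ∀ t ∈ spectrum ℝ a, |p.eval t| ≤ c) : ‖Polynomial.aeval a p‖ ≤ ‖S‖ * c := by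
  obtain ⟨R, hR, hRR, hR_left, hR_right⟩ := hS.exists_sqrt hJ hJ_star
  have hR_star : star R = R := (IsSelfAdjoint.of_nonneg hR).star_eq
  let u : Aˣ := ⟨R, J * R * J, hR_right, hR_left⟩
  have hu_star : star (↑u⁻¹ : A) = ↑u⁻¹ := by
    change star (J * R * J) = J * R * J
    rw [star_mul, star_mul, hJ_star.star_eq, hR_star, mul_assoc]
  have huu : (u * u : A) = J * S := hRR
  have hua : IsSelfAdjoint (u * a * ↑u⁻¹ : A) := by
    calc star (u * a * ↑u⁻¹ : A) = ↑u⁻¹ * star a * u := by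
          rw [star_mul, star_mul, hu_star, show star (u : A) = u from hR_star, mul_assoc]
      _ = ↑u⁻¹ * (star a * J * S) * ↑u⁻¹ := by
          rw [mul_assoc _ J, ← huu, ← mul_assoc, ← mul_assoc, Units.mul_inv_cancel_right]
      _ = ↑u⁻¹ * (u * u * a) * ↑u⁻¹ := by rw [ha, mul_assoc J, h.eq, huu, mul_assoc J]
      _ = u * a * ↑u⁻¹ := by rw [mul_assoc (u : A), Units.inv_mul_cancel_left]
  have hJ_unitary : J ∈ unitary A := by simp [Unitary.mem_iff, hJ_star.star_eq, hJ]
  have hu_norm : ‖(↑u⁻¹ : A)‖ = ‖(u : A)‖ := by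
    change ‖J * R * J‖ = ‖R‖
    rw [CStarRing.norm_mul_mem_unitary _ hJ_unitary, CStarRing.norm_mem_unitary_mul _ hJ_unitary]
  have hu_sq : ‖(u : A)‖ * ‖(u : A)‖ = ‖S‖ := by
    rw [← CStarRing.norm_mem_unitary_mul S hJ_unitary, ← hRR, ← CStarRing.norm_star_mul_self,
      hR_star]
  have haeval : Polynomial.aeval a p = ↑u⁻¹ * cfc p.eval (u * a * ↑u⁻¹ : A) * u := by
    rw [cfc_polynomial p _ hua, aeval_units_conj, mul_assoc, Units.inv_mul_cancel_right,
      Units.inv_mul_cancel_left]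
  have hcfc : ‖cfc p.eval (u * a * ↑u⁻¹ : A)‖ ≤ c :=
    norm_cfc_le hc fun t ht => hp t (by rwa [spectrum.units_conjugate] at ht)
  calc ‖Polynomial.aeval a p‖ ≤ ‖(↑u⁻¹ : A)‖ * c * ‖(u : A)‖ := by
        rw [haeval]
        exact (norm_mul_le _ _).trans (by gcongr; exact (norm_mul_le _ _).trans (by gcongr))
    _ = ‖S‖ * c := by rw [hu_norm, ← hu_sq]; ring

/-- The normalized symmetries `‖S x‖⁻¹ • S x` and the numbers `‖S x‖⁻¹` have limits `N` and `c`
along an ultrafilter; `N = c • S x₀` by uniqueness of the fundamental symmetry, and `c ≠ 0` because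
`‖N‖ = 1`. In particular `S` is locally bounded. -/
theorem continuous_of_commute {X : Type*} [TopologicalSpace X] [ProperSpace A] {m S : X → A}
    (hJ : J * J = 1) (hJ_star : IsSelfAdjoint J) (hm : Continuous m)
    (hS : ∀ x, IsFundamentalSymmetry J (S x))
    (hcomm : ∀ x Z, Commute Z (m x) → Commute Z (S x)) : Continuous S := by
  cases subsingleton_or_nontrivial A
  · exact continuous_of_const fun _ _ => Subsingleton.elim _ _
  have hS_norm : ∀ x, ‖S x‖ ≠ 0 := fun x => (zero_lt_one.trans_le (hS x).one_le_norm).ne'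
  refine continuous_iff_ultrafilter.2 fun x₀ U hU => ?_
  obtain ⟨c, hc, hc_lim⟩ := (isCompact_Icc (a := (0 : ℝ)) (b := 1)).ultrafilter_le_nhds'
    (U.map fun x => ‖S x‖⁻¹) (Ultrafilter.mem_map.2 <| univ_mem' fun x =>
      ⟨by positivity, inv_le_one_of_one_le₀ (hS x).one_le_norm⟩)
  obtain ⟨N, hN, hN_lim⟩ := (isCompact_sphere (0 : A) 1).ultrafilter_le_nhds'
    (U.map fun x => ‖S x‖⁻¹ • S x) (Ultrafilter.mem_map.2 <| univ_mem' fun x => by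
      simp [norm_smul, inv_mul_cancel₀ (hS_norm x)])
  replace hc_lim : Tendsto (fun x => ‖S x‖⁻¹) U (𝓝 c) := hc_lim
  replace hN_lim : Tendsto (fun x => ‖S x‖⁻¹ • S x) U (𝓝 N) := hN_lim
  have hNN : N * N = c ^ 2 • 1 := by
    refine tendsto_nhds_unique (hN_lim.mul hN_lim) (((hc_lim.pow 2).smul_const 1).congr fun x => ?_)
    rw [smul_mul_smul_comm, (hS x).mul_self, pow_two]
  have hJN : 0 ≤ J * N := by
    refine ge_of_tendsto' (hN_lim.const_mul J) fun x => ?_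
    rw [mul_smul_comm]
    exact smul_nonneg (by positivity) (hS x).nonneg
  have hNm : Commute N (m x₀) := by
    have hm_lim := (hm.tendsto x₀).mono_left hU
    refine tendsto_nhds_unique (hN_lim.mul hm_lim) ((hm_lim.mul hN_lim).congr fun x => ?_)
    exact ((hcomm x (m x) (Commute.refl _)).smul_right _).eq
  have hN_eq : N = c • S x₀ :=
    (hS x₀).eq_smul_of_commute hJ hJ_star hc.1 hJN hNN (hcomm x₀ N hNm)
  have hc_ne : c ≠ 0 := by
    rintro rfl
    simp [hN_eq] at hN
  have hlim := (hc_lim.inv₀ hc_ne).smul hN_lim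
  rw [hN_eq, inv_smul_smul₀ hc_ne] at hlim
  exact hlim.congr fun x => by rw [inv_inv, smul_inv_smul₀ (hS_norm x)]

end IsFundamentalSymmetry

namespace KreinMatrix

open scoped ComplexOrder Matrix.Norms.L2Operator MatrixOrder
open NambuSpace QBH Polynomial

variable {d : ℕ}

/-- The matrix `τ₃`, which defines the Krein form. -/
def tau (d : ℕ) : SiteMatrix d := Matrix.diagonal kreinSign

theorem tau_mul_tau : tau d * tau d = 1 := by
  rw [tau, Matrix.diagonal_mul_diagonal, ← Matrix.diagonal_one]
  exact congrArg _ (funext kreinSign_mul_self)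

theorem isSelfAdjoint_tau : IsSelfAdjoint (tau d) := by
  rw [isSelfAdjoint_iff, Matrix.star_eq_conjTranspose, tau, Matrix.diagonal_conjTranspose]
  exact congrArg _ (funext conj_kreinSign)

theorem dotProduct_tau_mulVec_self (x : Fin d ⊕ Fin d → ℂ) :
    star x ⬝ᵥ tau d *ᵥ x = (kreinForm x : ℂ) := by
  simp only [tau, Matrix.mulVec_diagonal, dotProduct, Fintype.sum_sum_type, kreinForm, kreinSign,
    Pi.star_apply]
  push_cast
  simp only [one_mul, neg_one_mul, mul_neg, Finset.sum_neg_distrib, ← sub_eq_add_neg]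
  congr 1 <;> exact Finset.sum_congr rfl fun s _ => Complex.conj_mul' _

/-- The matrices that are self-adjoint for the Krein form. -/
def IsKreinSelfAdjoint (g : SiteMatrix d) : Prop := gᴴ * tau d = tau d * g

theorem IsKreinSelfAdjoint.pow {g : SiteMatrix d} (hg : IsKreinSelfAdjoint g) (n : ℕ) :
    IsKreinSelfAdjoint (g ^ n) := by
  rw [IsKreinSelfAdjoint, Matrix.conjTranspose_pow]
  exact ((show SemiconjBy (tau d) g gᴴ from hg.symm).pow_right n).eq.symm

theorem IsKreinSelfAdjoint.aeval {g : SiteMatrix d} (hg : IsKreinSelfAdjoint g) (p : ℝ[X]) :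
    IsKreinSelfAdjoint (aeval g p) := by
  induction p using Polynomial.induction_on' with
  | add p q hp hq =>
    rw [IsKreinSelfAdjoint, map_add, Matrix.conjTranspose_add, add_mul, mul_add, hp, hq]
  | monomial n a =>
    rw [IsKreinSelfAdjoint, aeval_monomial, ← Algebra.smul_def, Matrix.conjTranspose_smul,
      smul_mul_assoc, mul_smul_comm, hg.pow n, star_trivial]

/-- Strong stability in the sense of Krein: `g` is diagonalizable with real spectrum and no
eigenvalue has eigenvectors of both Krein signatures. -/
structure IsStronglyStable (g : SiteMatrix d) : Prop where
  isKreinSelfAdjoint : IsKreinSelfAdjoint g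
  diagonalizable : ∃ (P : SiteMatrix d) (ev : Fin d ⊕ Fin d → ℝ),
    IsUnit P ∧ g * P = P * Matrix.diagonal fun i => (ev i : ℂ)
  not_kreinForm_neg : ∀ (a : ℝ) (x y : Fin d ⊕ Fin d → ℂ), g *ᵥ x = (a : ℂ) • x →
    g *ᵥ y = (a : ℂ) • y → 0 < kreinForm x → ¬ kreinForm y < 0

theorem mem_spectrum_real_iff {g : SiteMatrix d} {a : ℝ} :
    a ∈ spectrum ℝ g ↔ ∃ x, x ≠ 0 ∧ g *ᵥ x = (a : ℂ) • x := by
  have halg : algebraMap ℝ (SiteMatrix d) a = (a : ℂ) • 1 := by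
    rw [Algebra.algebraMap_eq_smul_one, Complex.coe_smul]
  rw [spectrum.mem_iff, Matrix.isUnit_iff_isUnit_det, isUnit_iff_ne_zero, not_not,
    ← Matrix.exists_mulVec_eq_zero_iff]
  simp only [halg, Matrix.sub_mulVec, Matrix.smul_mulVec, Matrix.one_mulVec, sub_eq_zero,
    eq_comm (a := g *ᵥ _)]

theorem aeval_mulVec {g : SiteMatrix d} {a : ℝ} {x : Fin d ⊕ Fin d → ℂ}
    (h : g *ᵥ x = (a : ℂ) • x) (p : ℝ[X]) : aeval g p *ᵥ x = ((p.eval a : ℝ) : ℂ) • x := by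
  have hpow (n : ℕ) : g ^ n *ᵥ x = ((a ^ n : ℝ) : ℂ) • x := by
    induction n with
    | zero => simp
    | succ n ih =>
      rw [pow_succ', ← Matrix.mulVec_mulVec, ih, Matrix.mulVec_smul, h, smul_smul, pow_succ,
        Complex.ofReal_mul]
  induction p using Polynomial.induction_on' with
  | add p q hp hq => rw [map_add, Matrix.add_mulVec, hp, hq, eval_add, Complex.ofReal_add, add_smul]
  | monomial n c =>
    rw [aeval_monomial, ← Algebra.smul_def, Matrix.smul_mulVec, hpow, eval_monomial,
      Complex.ofReal_mul, mul_smul, Complex.coe_smul c]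

theorem commute_aeval {g Z : SiteMatrix d} (h : Commute Z g) (p : ℝ[X]) : Commute Z (aeval g p) :=
  (Algebra.commute_of_mem_adjoin_singleton_of_commute (aeval_mem_adjoin_singleton ℝ g) h)

theorem IsStronglyStable.aeval_eq_of_eqOn_spectrum {g : SiteMatrix d} (hg : IsStronglyStable g)
    {p q : ℝ[X]} (h : ∀ a ∈ spectrum ℝ g, p.eval a = q.eval a) : aeval g p = aeval g q := by
  obtain ⟨P, ev, hP, hgP⟩ := hg.diagonalizable
  refine hP.mul_right_cancel (Matrix.ext_of_mulVec_single fun i => ?_)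
  set x := P *ᵥ Pi.single i 1 with hx_def
  have hx : g *ᵥ x = (ev i : ℂ) • x := by
    rw [hx_def, Matrix.mulVec_mulVec, hgP, ← Matrix.mulVec_mulVec, Matrix.diagonal_mulVec_single,
      mul_one, ← Matrix.mulVec_smul, ← Pi.single_smul, smul_eq_mul, mul_one]
  have hx_ne : x ≠ 0 := fun h0 => by
    have := Matrix.mulVec_injective_of_isUnit hP (h0.trans (Matrix.mulVec_zero P).symm)
    simpa using congrFun this i
  rw [← Matrix.mulVec_mulVec, ← Matrix.mulVec_mulVec, ← hx_def, aeval_mulVec hx, aeval_mulVec hx,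
    h _ (mem_spectrum_real_iff.2 ⟨x, hx_ne, hx⟩)]

open Classical in
/-- The Krein signature of the eigenvalue `a`; the value is `-1` if there is no eigenvector. -/
def signature (g : SiteMatrix d) (a : ℝ) : ℝ :=
  if ∃ x : Fin d ⊕ Fin d → ℂ, g *ᵥ x = (a : ℂ) • x ∧ 0 < kreinForm x then 1 else -1

theorem signature_mul_self (g : SiteMatrix d) (a : ℝ) : signature g a * signature g a = 1 := by
  rw [signature]; split_ifs <;> norm_num

theorem IsStronglyStable.signature_mul_kreinForm_nonneg {g : SiteMatrix d}
    (hg : IsStronglyStable g) {a : ℝ} {x : Fin d ⊕ Fin d → ℂ} (hx : g *ᵥ x = (a : ℂ) • x) :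
    0 ≤ signature g a * kreinForm x := by
  rw [signature]
  split_ifs with h
  · obtain ⟨y, hy, hy_pos⟩ := h
    simpa using hg.not_kreinForm_neg a y x hy hx hy_pos
  · simpa using fun hx_pos => h ⟨x, hx, hx_pos⟩

/-- The eigenvalues of `g`. -/
def nodes (g : SiteMatrix d) : Finset ℝ := (Matrix.finite_real_spectrum (A := g)).toFinset

theorem mem_nodes {g : SiteMatrix d} {a : ℝ} : a ∈ nodes g ↔ a ∈ spectrum ℝ g :=
  Set.Finite.mem_toFinset _

/-- The spectral projection of `g` for the eigenvalue `a`. -/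
def eigenprojection (g : SiteMatrix d) (a : ℝ) : SiteMatrix d :=
  aeval g (Lagrange.basis (nodes g) id a)

/-- The sign of `g`: the polynomial in `g` that is `1` on the eigenvectors of positive and `-1`
on the eigenvectors of negative Krein signature. -/
def sign (g : SiteMatrix d) : SiteMatrix d :=
  aeval g (Lagrange.interpolate (nodes g) id (signature g))

theorem eval_interpolate_signature {g : SiteMatrix d} {a : ℝ} (ha : a ∈ spectrum ℝ g) :
    (Lagrange.interpolate (nodes g) id (signature g)).eval a = signature g a :=
  Lagrange.eval_interpolate_at_node (v := id) _ Function.injective_id.injOn (mem_nodes.2 ha)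

theorem sign_mulVec {g : SiteMatrix d} {a : ℝ} {x : Fin d ⊕ Fin d → ℂ} (hx_ne : x ≠ 0)
    (hx : g *ᵥ x = (a : ℂ) • x) : sign g *ᵥ x = (signature g a : ℂ) • x := by
  rw [sign, aeval_mulVec hx, eval_interpolate_signature (mem_spectrum_real_iff.2 ⟨x, hx_ne, hx⟩)]

theorem commute_sign {g Z : SiteMatrix d} (h : Commute Z g) : Commute Z (sign g) :=
  commute_aeval h _

theorem eval_basis {g : SiteMatrix d} {a b : ℝ} (ha : a ∈ nodes g) (hb : b ∈ nodes g) :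
    (Lagrange.basis (nodes g) id a).eval b = if b = a then 1 else 0 := by
  split_ifs with h
  · subst h; exact Lagrange.eval_basis_self (v := id) Function.injective_id.injOn ha
  · exact Lagrange.eval_basis_of_ne (v := id) (Ne.symm h) hb

theorem sign_eq_sum (g : SiteMatrix d) :
    sign g = ∑ a ∈ nodes g, signature g a • eigenprojection g a := by
  simp only [sign, Lagrange.interpolate_apply, map_sum, map_mul, aeval_C, eigenprojection,
    Algebra.smul_def]

namespace IsStronglyStable

variable {g : SiteMatrix d}

theorem eigenprojection_mul_self (hg : IsStronglyStable g) {a : ℝ} (ha : a ∈ nodes g) :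
    eigenprojection g a * eigenprojection g a = eigenprojection g a := by
  rw [eigenprojection, ← map_mul]
  refine hg.aeval_eq_of_eqOn_spectrum fun b hb => ?_
  rw [eval_mul, eval_basis ha (mem_nodes.2 hb)]
  split_ifs <;> norm_num

theorem mul_eigenprojection (hg : IsStronglyStable g) {a : ℝ} (ha : a ∈ nodes g) :
    g * eigenprojection g a = (a : ℂ) • eigenprojection g a := by
  have : aeval g (X * Lagrange.basis (nodes g) id a) =
      aeval g (C a * Lagrange.basis (nodes g) id a) := by
    refine hg.aeval_eq_of_eqOn_spectrum fun b hb => ?_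
    rw [eval_mul, eval_mul, eval_basis ha (mem_nodes.2 hb), eval_X, eval_C]
    split_ifs with h <;> simp [h]
  rwa [map_mul, map_mul, aeval_X, aeval_C, ← Algebra.smul_def, ← Complex.coe_smul] at this

theorem sign_mul_self (hg : IsStronglyStable g) : sign g * sign g = 1 := by
  rw [sign, ← map_mul, ← map_one (aeval (R := ℝ) g)]
  refine hg.aeval_eq_of_eqOn_spectrum fun a ha => ?_
  rw [eval_mul, eval_one, eval_interpolate_signature ha, signature_mul_self]

theorem signature_smul_tau_mul_eigenprojection_nonneg (hg : IsStronglyStable g) {a : ℝ}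
    (ha : a ∈ nodes g) : 0 ≤ signature g a • (tau d * eigenprojection g a) := by
  set E := eigenprojection g a
  have hE_adj : Eᴴ * tau d = tau d * E := hg.isKreinSelfAdjoint.aeval _
  have hE_mul : Eᴴ * tau d * E = tau d * E := by
    rw [hE_adj, mul_assoc, hg.eigenprojection_mul_self ha]
  rw [Matrix.nonneg_iff_posSemidef]
  refine Matrix.PosSemidef.of_dotProduct_mulVec_nonneg ?_ fun x => ?_
  · rw [Matrix.IsHermitian, Matrix.conjTranspose_smul, Matrix.conjTranspose_mul,
      ← Matrix.star_eq_conjTranspose (tau d), isSelfAdjoint_tau.star_eq, hE_adj, star_trivial]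
  · have hEx : g *ᵥ E *ᵥ x = (a : ℂ) • E *ᵥ x := by
      rw [Matrix.mulVec_mulVec, hg.mul_eigenprojection ha, Matrix.smul_mulVec]
    have hform : star x ⬝ᵥ (signature g a • (tau d * E)) *ᵥ x =
        ((signature g a * kreinForm (E *ᵥ x) : ℝ) : ℂ) := by
      rw [Complex.ofReal_mul, ← dotProduct_tau_mulVec_self, Matrix.smul_mulVec,
        dotProduct_smul, Complex.real_smul, ← hE_mul, Matrix.star_mulVec, mul_assoc,
        ← Matrix.mulVec_mulVec, Matrix.dotProduct_mulVec, Matrix.mulVec_mulVec]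
    rw [hform]
    exact_mod_cast hg.signature_mul_kreinForm_nonneg hEx

theorem isFundamentalSymmetry_sign (hg : IsStronglyStable g) :
    IsFundamentalSymmetry (tau d) (sign g) where
  mul_self := hg.sign_mul_self
  nonneg := by
    rw [sign_eq_sum, Finset.mul_sum]
    refine Finset.sum_nonneg fun a ha => ?_
    rw [mul_smul_comm]
    exact hg.signature_smul_tau_mul_eigenprojection_nonneg ha

/-- The positive matrix `τ₃ (sign g)` is invertible, hence definite. -/
theorem signature_mul_kreinForm_pos (hg : IsStronglyStable g) {a : ℝ} {x : Fin d ⊕ Fin d → ℂ}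
    (hx_ne : x ≠ 0) (hx : g *ᵥ x = (a : ℂ) • x) : 0 < signature g a * kreinForm x := by
  have hS := hg.isFundamentalSymmetry_sign
  have hpos : (tau d * sign g).PosDef :=
    ((Matrix.nonneg_iff_posSemidef.1 hS.nonneg).posDef_iff_isUnit).2
      (hS.unit tau_mul_tau).isUnit
  have := hpos.dotProduct_mulVec_pos hx_ne
  rw [← Matrix.mulVec_mulVec, sign_mulVec hx_ne hx, Matrix.mulVec_smul, dotProduct_smul,
    dotProduct_tau_mulVec_self, smul_eq_mul] at this
  exact_mod_cast this

theorem eq_signature (hg : IsStronglyStable g) {f : ℝ → ℝ}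
    (hpos : ∀ (a : ℝ) x, g *ᵥ x = (a : ℂ) • x → 0 < kreinForm x → f a = 1)
    (hneg : ∀ (a : ℝ) x, g *ᵥ x = (a : ℂ) • x → kreinForm x < 0 → f a = -1) {a : ℝ}
    (ha : a ∈ spectrum ℝ g) : f a = signature g a := by
  obtain ⟨x, hx_ne, hx⟩ := mem_spectrum_real_iff.1 ha
  have h := hg.signature_mul_kreinForm_pos hx_ne hx
  rw [signature] at h ⊢
  split_ifs at h ⊢ with hex
  · obtain ⟨y, hy, hy_pos⟩ := hex
    exact hpos a y hy hy_pos
  · exact hneg a x hx (by linarith)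

end IsStronglyStable

/-- The pointwise sign of a continuous family of strongly stable matrices. -/
def signMap {X : Type*} [TopologicalSpace X] (M : C(X, SiteMatrix d))
    (hM : ∀ x, IsStronglyStable (M x)) : C(X, SiteMatrix d) where
  toFun x := sign (M x)
  continuous_toFun := IsFundamentalSymmetry.continuous_of_commute tau_mul_tau isSelfAdjoint_tau
    M.continuous (fun x => (hM x).isFundamentalSymmetry_sign) fun _ _ => commute_sign

end KreinMatrix

namespace KreinMatrix

open scoped ComplexOrder Matrix.Norms.L2Operator
open NambuSpace QBH

variable {d : ℕ} {g : SiteMatrix d}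

theorem J_conjTranspose : (Matrix.J (Fin d) ℂ)ᴴ = (Matrix.J (Fin d) ℂ)ᵀ := by
  simp [Matrix.J, Matrix.fromBlocks_conjTranspose, Matrix.fromBlocks_transpose]

theorem J_transpose_mul_J : (Matrix.J (Fin d) ℂ)ᵀ * Matrix.J (Fin d) ℂ = 1 := by
  rw [Matrix.J_transpose, neg_mul, Matrix.J_squared, neg_neg]

theorem J_mul_J_transpose : Matrix.J (Fin d) ℂ * (Matrix.J (Fin d) ℂ)ᵀ = 1 :=
  mul_eq_one_comm.1 J_transpose_mul_J

theorem isUnit_J : IsUnit (Matrix.J (Fin d) ℂ) :=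
  .of_mul_eq_one _ J_mul_J_transpose

theorem tau_eq_fromBlocks : tau d = Matrix.fromBlocks 1 0 0 (-1) := by
  rw [tau, ← Matrix.diagonal_one, Matrix.diagonal_neg, Matrix.fromBlocks_diagonal]
  exact congrArg _ (funext fun s => by rcases s with p | p <;> rfl)

theorem J_mul_tau : Matrix.J (Fin d) ℂ * tau d = -(tau d * Matrix.J (Fin d) ℂ) := by
  rw [tau_eq_fromBlocks, Matrix.J]
  simp [Matrix.fromBlocks_multiply, Matrix.fromBlocks_neg]

theorem kreinForm_J_transpose_mulVec (x : Fin d ⊕ Fin d → ℂ) :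
    kreinForm ((Matrix.J (Fin d) ℂ)ᵀ *ᵥ x) = -kreinForm x := by
  simp [kreinForm, Matrix.J, Matrix.fromBlocks_mulVec, Matrix.fromBlocks_transpose,
    Matrix.neg_mulVec]

theorem mulVec_J_transpose_mulVec {a : ℝ} {x : Fin d ⊕ Fin d → ℂ}
    (hx : (Matrix.J (Fin d) ℂ * g * (Matrix.J (Fin d) ℂ)ᵀ) *ᵥ x = (a : ℂ) • x) :
    g *ᵥ (Matrix.J (Fin d) ℂ)ᵀ *ᵥ x = (a : ℂ) • (Matrix.J (Fin d) ℂ)ᵀ *ᵥ x := by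
  rw [← Matrix.mulVec_smul, ← hx, Matrix.mulVec_mulVec, Matrix.mulVec_mulVec, ← mul_assoc,
    ← mul_assoc, J_transpose_mul_J, one_mul]

theorem IsKreinSelfAdjoint.J_conj (hg : IsKreinSelfAdjoint g) :
    IsKreinSelfAdjoint (Matrix.J (Fin d) ℂ * g * (Matrix.J (Fin d) ℂ)ᵀ) := by
  set J := Matrix.J (Fin d) ℂ
  have hJ_star : Jᴴ = Jᵀ := J_conjTranspose
  have hJ_tau : Jᵀ * tau d = -(tau d * Jᵀ) := by
    rw [Matrix.J_transpose, neg_mul, mul_neg, J_mul_tau]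
  calc (J * g * Jᵀ)ᴴ * tau d = J * gᴴ * (Jᵀ * tau d) := by
        rw [Matrix.conjTranspose_mul, Matrix.conjTranspose_mul, ← hJ_star,
          Matrix.conjTranspose_conjTranspose]
        simp only [mul_assoc]
    _ = -(J * (gᴴ * tau d) * Jᵀ) := by rw [hJ_tau]; noncomm_ring
    _ = -(J * tau d) * g * Jᵀ := by rw [hg]; noncomm_ring
    _ = tau d * (J * g * Jᵀ) := by rw [J_mul_tau]; noncomm_ring

/-- Conjugation by `J` preserves the spectrum and reverses the Krein signatures. -/
theorem IsStronglyStable.J_conj (hg : IsStronglyStable g) :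
    IsStronglyStable (Matrix.J (Fin d) ℂ * g * (Matrix.J (Fin d) ℂ)ᵀ) where
  isKreinSelfAdjoint := hg.isKreinSelfAdjoint.J_conj
  diagonalizable := by
    obtain ⟨P, ev, hP, hgP⟩ := hg.diagonalizable
    refine ⟨Matrix.J (Fin d) ℂ * P, ev, isUnit_J.mul hP, ?_⟩
    rw [mul_assoc _ P, ← hgP, mul_assoc, ← mul_assoc _ _ P, J_transpose_mul_J, one_mul, mul_assoc]
  not_kreinForm_neg a x y hx hy hx_pos hy_neg :=
    hg.not_kreinForm_neg a _ _ (mulVec_J_transpose_mulVec hy) (mulVec_J_transpose_mulVec hx)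
      (by rwa [kreinForm_J_transpose_mulVec, neg_pos])
      (by rwa [kreinForm_J_transpose_mulVec, neg_lt_zero])

end KreinMatrix

namespace QBH

open scoped ComplexOrder Matrix.Norms.L2Operator
open NambuSpace KreinMatrix

variable {D d : ℕ} (H : QBH D d)

/-- The phase `e^{i k·r}`. -/
def phase (k : Fin D → ℝ) (r : Fin D → ℤ) : ℂ :=
  Complex.exp (Complex.I * ((∑ i, k i * (r i : ℝ) : ℝ) : ℂ))

theorem conj_phase (k : Fin D → ℝ) (r : Fin D → ℤ) :
    starRingEnd ℂ (phase k r) = phase (-k) r := by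
  rw [phase, ← Complex.exp_conj, map_mul, Complex.conj_I, Complex.conj_ofReal, phase]
  simp

theorem phase_neg_right (k : Fin D → ℝ) (r : Fin D → ℤ) : phase k (-r) = phase (-k) r := by
  simp [phase]

theorem fourier_eq_sum {M : (Fin D → ℤ) →₀ Matrix (Fin d) (Fin d) ℂ} {R : Finset (Fin D → ℤ)}
    (hM : M.support ⊆ R) (k : Fin D → ℝ) : fourier M k = ∑ r ∈ R, phase k r • M r :=
  Finsupp.sum_of_support_subset _ hM _ fun _ _ => smul_zero _

theorem conj_fourier_neg {M : (Fin D → ℤ) →₀ Matrix (Fin d) (Fin d) ℂ} {R : Finset (Fin D → ℤ)}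
    (hM : M.support ⊆ R) (k : Fin D → ℝ) :
    (fourier M (-k)).map (starRingEnd ℂ) = ∑ r ∈ R, phase k r • (M r).map (starRingEnd ℂ) := by
  ext s t
  simp only [fourier_eq_sum hM, Matrix.map_apply, Matrix.sum_apply, Matrix.smul_apply, smul_eq_mul,
    map_sum, map_mul, conj_phase, neg_neg]

theorem bloch_eq_sum (k : Fin D → ℝ) :
    H.bloch k = ∑ r ∈ H.rangeSet, phase k r • H.dynamicalMatrix r := by
  rw [bloch, fourier_eq_sum H.support_K_subset_rangeSet, fourier_eq_sum H.support_Δ_subset_rangeSet,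
    conj_fourier_neg H.support_K_subset_rangeSet, conj_fourier_neg H.support_Δ_subset_rangeSet]
  ext (p | p) (q | q) <;> simp [dynamicalMatrix, Matrix.sum_apply]

theorem sum_rangeSet_neg {M : Type*} [AddCommMonoid M] (f : (Fin D → ℤ) → M) :
    ∑ r ∈ H.rangeSet, f (-r) = ∑ r ∈ H.rangeSet, f r :=
  Finset.sum_bij' (fun r _ => -r) (fun r _ => -r) (fun _ => H.neg_mem_rangeSet)
    (fun _ => H.neg_mem_rangeSet) (fun r _ => neg_neg r) (fun r _ => neg_neg r) fun _ _ => rfl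

theorem bloch_neg_swap (k : Fin D → ℝ) (s t : Fin d ⊕ Fin d) :
    H.bloch (-k) s.swap t.swap = -starRingEnd ℂ (H.bloch k s t) := by
  simp only [bloch_eq_sum, Matrix.sum_apply, Matrix.smul_apply, smul_eq_mul, dynamicalMatrix_swap,
    map_sum, map_mul, conj_phase, mul_neg, Finset.sum_neg_distrib]

theorem conjTranspose_dynamicalMatrix_mul_tau (r : Fin D → ℤ) :
    (H.dynamicalMatrix r)ᴴ * tau d = tau d * H.dynamicalMatrix (-r) := by
  ext (p | p) (q | q) <;>
    simp [tau, dynamicalMatrix, kreinSign, K_neg_apply, Δ_neg_apply]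

theorem isKreinSelfAdjoint_bloch (k : Fin D → ℝ) : IsKreinSelfAdjoint (H.bloch k) := by
  rw [IsKreinSelfAdjoint, bloch_eq_sum, Matrix.conjTranspose_sum, Finset.sum_mul, Finset.mul_sum,
    ← H.sum_rangeSet_neg]
  refine Finset.sum_congr rfl fun r _ => ?_
  rw [Matrix.conjTranspose_smul, smul_mul_assoc, conjTranspose_dynamicalMatrix_mul_tau, neg_neg,
    mul_smul_comm, phase_neg_right, Complex.star_def, conj_phase, neg_neg]

theorem neg_mem_quasiparticleEnergies {k : Fin D → ℝ} {a : ℝ} {v : Fin d ⊕ Fin d → ℂ}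
    (hv : H.bloch k *ᵥ v = (a : ℂ) • v) (hneg : kreinForm v < 0) :
    -a ∈ H.quasiparticleEnergies (-k) := by
  refine ⟨fun s => starRingEnd ℂ (v s.swap), ?_, ?_⟩
  · funext s
    have hs := congrArg (starRingEnd ℂ) (congrFun hv s.swap)
    simp only [Matrix.mulVec, dotProduct, map_sum, map_mul, Pi.smul_apply, smul_eq_mul,
      Complex.conj_ofReal] at hs ⊢
    rw [Complex.ofReal_neg, neg_mul, ← hs, ← Finset.sum_neg_distrib]
    refine Fintype.sum_equiv (Equiv.sumComm _ _) _ _ fun t => ?_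
    have hst := H.bloch_neg_swap k s.swap t.swap
    rw [Sum.swap_swap, Sum.swap_swap] at hst
    rw [hst, Equiv.sumComm_apply, neg_mul]
  · simp only [kreinForm, Sum.swap_inl, Sum.swap_inr, RCLike.norm_conj] at hneg ⊢
    linarith

theorem neg_mem_brillouinZone {k : Fin D → ℝ} (hk : k ∈ brillouinZone D) :
    -k ∈ brillouinZone D := fun i => by
  rw [Pi.neg_apply, Set.neg_mem_Icc_iff, neg_neg]
  exact hk i

theorem indirectKreinGap_le {k k' : Fin D → ℝ} (hk : k ∈ brillouinZone D)
    (hk' : k' ∈ brillouinZone D) {w w' : ℝ} (hw : w ∈ H.quasiparticleEnergies k)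
    (hw' : w' ∈ H.quasiparticleEnergies k') : H.indirectKreinGap ≤ |w + w'| := by
  refine csInf_le ⟨0, ?_⟩ ⟨k, hk, k', hk', w, hw, w', hw', rfl⟩
  rintro _ ⟨_, _, _, _, _, _, _, _, rfl⟩
  exact abs_nonneg _

theorem kreinGap_le {k : Fin D → ℝ} (hk : k ∈ brillouinZone D) {w w' : ℝ}
    (hw : w ∈ H.quasiparticleEnergies k) (hw' : w' ∈ H.quasiparticleEnergies (-k)) :
    H.kreinGap ≤ |w + w'| := by
  refine csInf_le ⟨0, ?_⟩ ⟨k, hk, w, hw, w', hw', rfl⟩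
  rintro _ ⟨_, _, _, _, _, _, rfl⟩
  exact abs_nonneg _

theorem isStronglyStable_bloch_of_kreinGap_pos (hH : H.DynamicallyStable) (h : 0 < H.kreinGap)
    {k : Fin D → ℝ} (hk : k ∈ brillouinZone D) : IsStronglyStable (H.bloch k) where
  isKreinSelfAdjoint := H.isKreinSelfAdjoint_bloch k
  diagonalizable := hH k hk
  not_kreinForm_neg a x y hx hy hx_pos hy_neg := by
    have := H.kreinGap_le hk ⟨x, hx, hx_pos⟩ (H.neg_mem_quasiparticleEnergies hy hy_neg)
    rw [add_neg_cancel, abs_zero] at this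
    exact this.not_gt h

theorem isStronglyStable_bloch_of_indirectKreinGap_pos (hH : H.DynamicallyStable)
    (h : 0 < H.indirectKreinGap) {k : Fin D → ℝ} (hk : k ∈ brillouinZone D) :
    IsStronglyStable (H.bloch k) where
  isKreinSelfAdjoint := H.isKreinSelfAdjoint_bloch k
  diagonalizable := hH k hk
  not_kreinForm_neg a x y hx hy hx_pos hy_neg := by
    have := H.indirectKreinGap_le hk (neg_mem_brillouinZone hk) ⟨x, hx, hx_pos⟩
      (H.neg_mem_quasiparticleEnergies hy hy_neg)
    rw [add_neg_cancel, abs_zero] at this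
    exact this.not_gt h

/-- The symbol of the convolution operator by which `[H, ·]` acts on the generators. The column
index of the dynamical matrix labels the output, hence the transposition. -/
def symbol : C(UnitAddTorus (Fin D), SiteMatrix d) :=
  -∑ r ∈ H.rangeSet, monomialSymbol r (H.dynamicalMatrix r)ᵀ

theorem exists_mFourier_eq_phase (x : UnitAddTorus (Fin D)) :
    ∃ k ∈ brillouinZone D, ∀ r, UnitAddTorus.mFourier (-r) x = phase k r := by
  have hrep : ∀ i, ∃ t : ℝ, t ∈ Set.Ico (-(1 / 2) : ℝ) (-(1 / 2) + 1) ∧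
      (t : UnitAddCircle) = x i := by
    intro i
    have : x i ∈ (QuotientAddGroup.mk '' Set.Ico (-(1 / 2) : ℝ) (-(1 / 2) + 1) :
        Set (AddCircle (1 : ℝ))) := by
      rw [AddCircle.coe_image_Ico_eq]
      trivial
    exact this
  choose t ht htx using hrep
  refine ⟨fun i => -(2 * Real.pi * t i), fun i => ?_, fun r => ?_⟩
  · obtain ⟨h₁, h₂⟩ := ht i
    have hpi := Real.pi_pos
    constructor <;> nlinarith
  · change ∏ i, _root_.fourier ((-r) i) (x i) = _
    rw [phase]
    push_cast
    rw [Finset.mul_sum, Complex.exp_sum]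
    refine Finset.prod_congr rfl fun i _ => ?_
    rw [← htx i, fourier_coe_apply, Pi.neg_apply]
    congr 1
    push_cast
    ring

theorem neg_transpose_dynamicalMatrix (r : Fin D → ℤ) : -(H.dynamicalMatrix r)ᵀ =
    Matrix.J (Fin d) ℂ * H.dynamicalMatrix (-r) * (Matrix.J (Fin d) ℂ)ᵀ := by
  rw [Matrix.J, dynamicalMatrix, dynamicalMatrix, Matrix.fromBlocks_transpose,
    Matrix.fromBlocks_transpose, Matrix.fromBlocks_multiply, Matrix.fromBlocks_multiply]
  ext (p | p) (q | q) <;> simp [K_neg_apply, Δ_neg_apply]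

theorem exists_symbol_eq (x : UnitAddTorus (Fin D)) : ∃ k ∈ brillouinZone D,
    H.symbol x = Matrix.J (Fin d) ℂ * H.bloch k * (Matrix.J (Fin d) ℂ)ᵀ := by
  obtain ⟨k, hk, hphase⟩ := exists_mFourier_eq_phase x
  refine ⟨k, hk, ?_⟩
  have hsum : H.symbol x =
      ∑ r ∈ H.rangeSet, UnitAddTorus.mFourier r x • -(H.dynamicalMatrix r)ᵀ := by
    simp only [symbol, ContinuousMap.neg_apply, ContinuousMap.sum_apply, smul_neg,
      Finset.sum_neg_distrib]
    rfl
  rw [hsum, ← H.sum_rangeSet_neg, bloch_eq_sum, Finset.mul_sum, Finset.sum_mul]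
  refine Finset.sum_congr rfl fun r _ => ?_
  rw [neg_transpose_dynamicalMatrix, hphase, neg_neg, mul_smul_comm, smul_mul_assoc]

theorem isStronglyStable_symbol
    (h : ∀ k ∈ brillouinZone D, IsStronglyStable (H.bloch k)) (x : UnitAddTorus (Fin D)) :
    IsStronglyStable (H.symbol x) := by
  obtain ⟨k, hk, hx⟩ := H.exists_symbol_eq x
  exact hx ▸ (h k hk).J_conj

/-- All the quasiparticle energies. -/
def energySet : Set ℝ := {w | ∃ k ∈ brillouinZone D, w ∈ H.quasiparticleEnergies k}

theorem neg_mem_energySet_of_symbol_mulVec {x : UnitAddTorus (Fin D)} {a : ℝ}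
    {v : Fin d ⊕ Fin d → ℂ} (hv : H.symbol x *ᵥ v = (a : ℂ) • v) (hpos : 0 < kreinForm v) :
    -a ∈ H.energySet := by
  obtain ⟨k, hk, hx⟩ := H.exists_symbol_eq x
  rw [hx] at hv
  exact ⟨-k, neg_mem_brillouinZone hk,
    H.neg_mem_quasiparticleEnergies (mulVec_J_transpose_mulVec hv)
      (by rwa [kreinForm_J_transpose_mulVec, neg_lt_zero])⟩

theorem mem_energySet_of_symbol_mulVec {x : UnitAddTorus (Fin D)} {a : ℝ}
    {v : Fin d ⊕ Fin d → ℂ} (hv : H.symbol x *ᵥ v = (a : ℂ) • v) (hneg : kreinForm v < 0) :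
    a ∈ H.energySet := by
  obtain ⟨k, hk, hx⟩ := H.exists_symbol_eq x
  rw [hx] at hv
  exact ⟨k, hk, _, mulVec_J_transpose_mulVec hv, by rwa [kreinForm_J_transpose_mulVec, neg_pos]⟩

/-- By the gap, `energySet` and its negative have positive distance. -/
theorem exists_continuous_eq_on_energySet (h : 0 < H.indirectKreinGap) :
    ∃ f : ℝ → ℝ, Continuous f ∧ (∀ a, -a ∈ H.energySet → f a = 1) ∧
      ∀ a ∈ H.energySet, f a = -1 := by
  set δ := H.indirectKreinGap
  refine ⟨fun a => max (-1) (1 - 2 / δ * Metric.infDist (-a) H.energySet), by fun_prop,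
    fun a ha => ?_, fun a ha => max_eq_left ?_⟩
  · simp only [Metric.infDist_zero_of_mem ha]
    norm_num
  · have hdist : δ ≤ Metric.infDist (-a) H.energySet := by
      rw [Metric.le_infDist ⟨a, ha⟩]
      rintro w ⟨k', hk', hw⟩
      obtain ⟨k, hk, hak⟩ := ha
      rw [Real.dist_eq, ← abs_neg, neg_sub, sub_neg_eq_add, add_comm w a]
      exact H.indirectKreinGap_le hk hk' hak hw
    have : 2 ≤ 2 / δ * Metric.infDist (-a) H.energySet := by
      rw [div_mul_eq_mul_div, le_div_iff₀ h]
      gcongr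
    linarith

end QBH

/-- A partition of unity reduces membership in a closed `C(X, ℝ)`-module to pointwise data. -/
theorem mem_of_forall_exists_apply_eq {X E : Type*} [TopologicalSpace X] [CompactSpace X]
    [T2Space X] [NormedAddCommGroup E] [NormedSpace ℝ E] {W : Submodule C(X, ℝ) C(X, E)}
    (hW : IsClosed (W : Set C(X, E))) {S : C(X, E)} (hS : ∀ x, ∃ N ∈ W, N x = S x) : S ∈ W := by
  choose N hN hNS using hS
  refine hW.closure_subset (Metric.mem_closure_iff.2 fun ε hε => ?_)
  have hU_open (x) : IsOpen {y | dist (S y) (N x y) < ε / 2} :=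
    isOpen_lt (S.continuous.dist (N x).continuous) continuous_const
  have hU_mem (x) : x ∈ {y | dist (S y) (N x y) < ε / 2} := by simpa [hNS] using half_pos hε
  obtain ⟨I, hI⟩ := isCompact_univ.elim_finite_subcover _ hU_open
    fun x _ => Set.mem_iUnion.2 ⟨x, hU_mem x⟩
  obtain ⟨f, hf⟩ := PartitionOfUnity.exists_isSubordinate isClosed_univ
    (fun i : I => {y | dist (S y) (N i y) < ε / 2}) (fun i => hU_open i)
    (fun x hx => by simpa using hI hx)
  refine ⟨∑ i, f i • N i, W.sum_mem fun i _ => W.smul_mem _ (hN i), ?_⟩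
  refine (dist_comm _ _).trans_lt (((ContinuousMap.dist_le (half_pos hε).le).2 fun y => ?_).trans_lt
    (half_lt_self hε))
  have hball : ∑ᶠ i, f i y • N i y ∈ Metric.closedBall (S y) (ε / 2) :=
    f.finsum_smul_mem_convex (Set.mem_univ y) (fun i hi => by
      rw [Metric.mem_closedBall, dist_comm]
      exact (hf i (subset_closure hi) : dist (S y) (N i y) < ε / 2).le) (convex_closedBall _ _)
  rw [finsum_eq_sum_of_fintype] at hball
  rwa [ContinuousMap.sum_apply]

/-- The square root of the values is continuous. -/
theorem exists_star_mul_self_eq {X A : Type*} [TopologicalSpace X] [CStarAlgebra A]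
    [PartialOrder A] [StarOrderedRing A] (F : C(X, A)) (hF : ∀ x, 0 ≤ F x) :
    ∃ R : C(X, A), star R * R = F := by
  refine ⟨⟨fun x => CFC.sqrt (F x), CFC.continuousOn_sqrt.comp_continuous F.continuous hF⟩, ?_⟩
  ext1 x
  change star (CFC.sqrt (F x)) * CFC.sqrt (F x) = F x
  rw [(IsSelfAdjoint.of_nonneg (CFC.sqrt_nonneg _)).star_eq, CFC.sqrt_mul_sqrt_self _ (hF x)]

theorem aeval_mem_of_mem {R A : Type*} [CommSemiring R] [Semiring A] [Algebra R A]
    {W : Subalgebra R A} {a : A} (ha : a ∈ W) (p : Polynomial R) : Polynomial.aeval a p ∈ W :=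
  Algebra.adjoin_le (Set.singleton_subset_iff.2 ha) (Polynomial.aeval_mem_adjoin_singleton R a)

theorem aeval_apply_eq {X R A : Type*} [TopologicalSpace X] [CommSemiring R]
    [Semiring A] [Algebra R A] [TopologicalSpace A] [IsTopologicalSemiring A] (M : C(X, A))
    (p : Polynomial R) (x : X) : Polynomial.aeval M p x = Polynomial.aeval (M x) p :=
  (Polynomial.aeval_algHom_apply
    ((Pi.evalAlgHom R (fun _ : X => A) x).comp (ContinuousMap.coeFnAlgHom R)) M p).symm

namespace KreinMatrix

open scoped ComplexOrder Matrix.Norms.L2Operator MatrixOrder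
open Polynomial

variable {D d : ℕ}

/-- By Weierstrass: the sign of `M x` differs from `p (M x)` by at most `‖sign (M x)‖` times the
distance of `p` from the signature on the spectrum. -/
theorem signMap_mem_of_eq_signature {X : Type*} [TopologicalSpace X] [CompactSpace X]
    {M : C(X, SiteMatrix d)} (hM : ∀ x, IsStronglyStable (M x))
    {W : Subalgebra ℂ C(X, SiteMatrix d)} (hW : IsClosed (W : Set C(X, SiteMatrix d)))
    (hMW : M ∈ W) {f : ℝ → ℝ} (hf : Continuous f)
    (hfM : ∀ x, ∀ a ∈ spectrum ℝ (M x), f a = signature (M x) a) : signMap M hM ∈ W := by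
  refine hW.closure_subset (Metric.mem_closure_iff.2 fun ε hε => ?_)
  set C := ‖M‖ * ‖(1 : SiteMatrix d)‖
  set δ := ε / (‖signMap M hM‖ + 1)
  have hδ : 0 < δ := by positivity
  obtain ⟨p, hp⟩ := exists_polynomial_near_of_continuousOn (-C) C f hf.continuousOn δ hδ
  refine ⟨aeval M p, aeval_mem_of_mem (W := W.restrictScalars ℝ) hMW p, ?_⟩
  have hδε : ‖signMap M hM‖ * δ < ε := by
    rw [← mul_div_assoc, div_lt_iff₀ (by positivity)]
    linarith
  refine lt_of_le_of_lt ((ContinuousMap.dist_le (by positivity)).2 fun x => ?_) hδε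
  have hx : ‖sign (M x) - aeval (M x) p‖ ≤ ‖sign (M x)‖ * δ := by
    rw [sign, ← map_sub, ← sign]
    refine (hM x).isFundamentalSymmetry_sign.norm_aeval_le tau_mul_tau isSelfAdjoint_tau
      (hM x).isKreinSelfAdjoint (commute_sign (Commute.refl _)) hδ.le fun a ha => ?_
    have haC : |a| ≤ C := (spectrum.norm_le_norm_mul_of_mem ha).trans
      (mul_le_mul_of_nonneg_right (M.norm_coe_le_norm x) (norm_nonneg _))
    rw [eval_sub, eval_interpolate_signature ha, ← hfM x a ha, abs_sub_comm]
    exact (hp a (abs_le.1 haC)).le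
  rw [aeval_apply_eq, dist_eq_norm]
  exact hx.trans (mul_le_mul_of_nonneg_right ((signMap M hM).norm_coe_le_norm x) hδ.le)

section Translations

variable {W : Subalgebra ℂ C(UnitAddTorus (Fin D), SiteMatrix d)}
  (hW : IsClosed (W : Set C(UnitAddTorus (Fin D), SiteMatrix d)))
  (hWr : ∀ r, QBH.monomialSymbol r 1 ∈ W)

include hW hWr

theorem smul_one_mem_of_monomialSymbol_mem (f : C(UnitAddTorus (Fin D), ℂ)) :
    f • (1 : C(UnitAddTorus (Fin D), SiteMatrix d)) ∈ W := by
  let L : C(UnitAddTorus (Fin D), ℂ) →L[ℂ] C(UnitAddTorus (Fin D), SiteMatrix d) :=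
    (ContinuousLinearMap.toSpanSingleton ℂ (1 : SiteMatrix d)).compLeftContinuous ℂ _
  have hspan : Submodule.span ℂ (Set.range UnitAddTorus.mFourier) ≤
      W.toSubmodule.comap L.toLinearMap := by
    rw [Submodule.span_le]
    rintro _ ⟨r, rfl⟩
    exact hWr r
  have := Submodule.topologicalClosure_minimal _ hspan (hW.preimage L.continuous)
  rw [UnitAddTorus.span_mFourier_closure_eq_top] at this
  exact this (Submodule.mem_top (x := f))

theorem signMap_mem_of_monomialSymbol_mem {M : C(UnitAddTorus (Fin D), SiteMatrix d)}
    (hM : ∀ x, IsStronglyStable (M x)) (hMW : M ∈ W) : signMap M hM ∈ W := by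
  let V : Submodule C(UnitAddTorus (Fin D), ℝ) C(UnitAddTorus (Fin D), SiteMatrix d) :=
    { W.toSubmodule with
      smul_mem' := fun f N hN => by
        let F : C(UnitAddTorus (Fin D), ℂ) := ⟨fun x => f x, by fun_prop⟩
        have hfN : f • N = F • 1 * N := by
          ext1 x
          change f x • N x = (F x • 1) * N x
          rw [smul_mul_assoc, one_mul]
          rfl
        rw [hfN]
        exact W.mul_mem (smul_one_mem_of_monomialSymbol_mem hW hWr F) hN }
  exact mem_of_forall_exists_apply_eq (W := V) hW fun x =>
    ⟨_, aeval_mem_of_mem (W := W.restrictScalars ℝ) hMW _, aeval_apply_eq M _ x⟩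

end Translations

end KreinMatrix

namespace QBH

open scoped ComplexOrder Matrix.Norms.L2Operator MatrixOrder
open NambuSpace CCRAlgebra KreinMatrix

variable {D d : ℕ} (H : QBH D d)

theorem blochRep_symbol_basisVec (j : Fin D → ℤ) (s : Fin d ⊕ Fin d) :
    blochRep D d H.symbol (basisVec (siteIndex j s))
      = -∑ r ∈ H.rangeSet, ∑ t, H.dynamicalMatrix r s t • basisVec (siteIndex (j + r) t) := by
  rw [symbol, map_neg, map_sum, neg_apply, sum_apply]
  simp only [blochRep_monomialSymbol, Matrix.transpose_apply]

theorem blochRep_diagonal_basisVec (r j : Fin D → ℤ) (c : Fin d ⊕ Fin d → ℂ) (s : Fin d ⊕ Fin d) :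
    blochRep D d (monomialSymbol r (Matrix.diagonal c)) (basisVec (siteIndex j s))
      = c s • basisVec (siteIndex (j + r) s) := by
  rw [blochRep_monomialSymbol, Finset.sum_eq_single s, Matrix.diagonal_apply_eq]
  · intro t _ ht
    rw [Matrix.diagonal_apply_ne c ht, zero_smul]
  · simp

theorem blochRep_translation_basisVec (r j : Fin D → ℤ) (s : Fin d ⊕ Fin d) :
    blochRep D d (monomialSymbol r 1) (basisVec (siteIndex j s))
      = basisVec (siteIndex (j + r) s) := by
  rw [← Matrix.diagonal_one, blochRep_diagonal_basisVec, one_smul]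

theorem blochRep_tau : blochRep D d (.const _ (tau d)) = kreinOp := by
  have htau : ContinuousMap.const (UnitAddTorus (Fin D)) (tau d) = monomialSymbol 0 (tau d) := by
    ext1 x
    change tau d = UnitAddTorus.mFourier 0 x • tau d
    rw [UnitAddTorus.mFourier_zero]
    exact (one_smul ℂ _).symm
  refine clm_ext fun c => ?_
  obtain ⟨j, s, rfl⟩ := exists_siteIndex c
  rw [htau, tau, blochRep_diagonal_basisVec, kreinOp_basisVec, add_zero]
  rcases s with p | p <;> rfl

theorem conjOp_blochRep_symbol :
    conjOp (blochRep D d H.symbol) = -blochRep D d H.symbol := by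
  refine clm_ext fun c => ?_
  obtain ⟨j, s, rfl⟩ := exists_siteIndex c
  rw [conjOp_apply, conj_basisVec, siteIndex_swap, blochRep_symbol_basisVec, neg_apply,
    blochRep_symbol_basisVec, conj_neg, neg_inj, conj_sum, ← Finset.sum_neg_distrib]
  refine Finset.sum_congr rfl fun r _ => ?_
  rw [conj_sum, ← Finset.sum_neg_distrib]
  refine Fintype.sum_equiv (Equiv.sumComm _ _) _ _ fun t => ?_
  have hswap := H.dynamicalMatrix_swap r s t.swap
  rw [Sum.swap_swap] at hswap
  rw [conj_smul, conj_basisVec, siteIndex_swap, hswap, Equiv.sumComm_apply, map_neg,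
    Complex.conj_conj, neg_smul]

theorem conjOp_blochRep_translation (r : Fin D → ℤ) :
    conjOp (blochRep D d (monomialSymbol r 1)) = blochRep D d (monomialSymbol r 1) := by
  refine clm_ext fun c => ?_
  obtain ⟨j, s, rfl⟩ := exists_siteIndex c
  rw [conjOp_apply, conj_basisVec, siteIndex_swap, blochRep_translation_basisVec,
    blochRep_translation_basisVec, conj_basisVec, siteIndex_swap, Sum.swap_swap]

theorem implements_blochRep_symbol :
    Implements (blochRep D d H.symbol) fun c => H.commutatorMap (nambu c) := by
  intro c
  obtain ⟨j, s, rfl⟩ := exists_siteIndex c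
  refine ⟨-∑ r ∈ H.rangeSet, ∑ t,
    Finsupp.single (siteIndex (j + r) t) (H.dynamicalMatrix r s t), ?_, ?_⟩
  · rw [← Finsupp.linearCombination_apply, blochRep_symbol_basisVec]
    simp only [map_neg, map_sum, Finsupp.linearCombination_single]
  · beta_reduce
    rw [← Finsupp.linearCombination_apply, commutatorMap_nambu]
    simp only [map_neg, map_sum, Finsupp.linearCombination_single]

section Vacuum

variable {ω : CCRState (LatticeMode D d)} {T : Bogoliubov (LatticeMode D d)}

theorem isEigenstate_iff_commute (h : ω.IsVacuumOf T.symmetry) :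
    H.IsEigenstate ω ↔ Commute T.symmetry (blochRep D d H.symbol) := by
  rw [isEigenstate_iff]
  exact h.derivation_invariant_iff T.symmetry_mul_self T.conjOp_symmetry H.conjOp_blochRep_symbol
    H.commutatorMap_mul H.commutatorMap_star H.implements_blochRep_symbol

theorem translationInvariant_iff_commute (h : ω.IsVacuumOf T.symmetry) :
    ω.TranslationInvariant ↔ ∀ r, Commute T.symmetry (blochRep D d (monomialSymbol r 1)) := by
  refine forall_congr' fun r => h.relabel_invariant_iff _ T.symmetry_mul_self T.conjOp_symmetry
    fun c => ?_
  obtain ⟨j, s, rfl⟩ := exists_siteIndex c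
  rw [blochRep_translation_basisVec]
  rcases s with p | p <;> rfl

end Vacuum

section Commutant

variable (Z : NambuSpace (LatticeMode D d) →L[ℂ] NambuSpace (LatticeMode D d))

/-- The symbols of the operators that commute with `Z`. -/
def symbolCommutant : Subalgebra ℂ C(UnitAddTorus (Fin D), SiteMatrix d) :=
  (Subalgebra.centralizer ℂ {Z}).comap (blochRep D d).toAlgHom

variable {Z}

theorem mem_symbolCommutant_iff {F : C(UnitAddTorus (Fin D), SiteMatrix d)} :
    F ∈ symbolCommutant Z ↔ Commute Z (blochRep D d F) :=
  ⟨fun h => h Z rfl, fun h => by rintro _ rfl; exact h⟩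

theorem isClosed_symbolCommutant :
    IsClosed (symbolCommutant Z : Set C(UnitAddTorus (Fin D), SiteMatrix d)) :=
  (Set.isClosed_centralizer {Z}).preimage (continuous_blochRep D d)

end Commutant

section SignOperator

variable (hM : ∀ x, IsStronglyStable (H.symbol x))

/-- The convolution operator whose symbol is the sign of that of `[H, ·]`. It is the fundamental
symmetry of the translationally invariant quasiparticle vacuum. -/
def signOperator : NambuSpace (LatticeMode D d) →L[ℂ] NambuSpace (LatticeMode D d) :=
  blochRep D d (signMap H.symbol hM)

theorem commute_signOperator {Z : NambuSpace (LatticeMode D d) →L[ℂ] NambuSpace (LatticeMode D d)}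
    (hZ : Commute Z (blochRep D d H.symbol))
    (hZr : ∀ r, Commute Z (blochRep D d (monomialSymbol r 1))) : Commute Z (H.signOperator hM) :=
  mem_symbolCommutant_iff.1 <| signMap_mem_of_monomialSymbol_mem isClosed_symbolCommutant
    (fun r => mem_symbolCommutant_iff.2 (hZr r)) hM (mem_symbolCommutant_iff.2 hZ)

/-- The sign of the symbol is a continuous function of the symbol, the same one at all points of
the torus. -/
theorem commute_signOperator_of_indirectKreinGap_pos
    {Z : NambuSpace (LatticeMode D d) →L[ℂ] NambuSpace (LatticeMode D d)}
    (hgap : 0 < H.indirectKreinGap) (hZ : Commute Z (blochRep D d H.symbol)) :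
    Commute Z (H.signOperator hM) := by
  obtain ⟨f, hf, hf_pos, hf_neg⟩ := H.exists_continuous_eq_on_energySet hgap
  refine mem_symbolCommutant_iff.1 <| signMap_mem_of_eq_signature hM isClosed_symbolCommutant
    (mem_symbolCommutant_iff.2 hZ) hf fun x a ha => (hM x).eq_signature ?_ ?_ ha
  · exact fun b v hv hpos => hf_pos b (H.neg_mem_energySet_of_symbol_mulVec hv hpos)
  · exact fun b v hv hneg => hf_neg b (H.mem_energySet_of_symbol_mulVec hv hneg)

theorem signOperator_commute_symbol : Commute (H.signOperator hM) (blochRep D d H.symbol) := by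
  have h : Commute (signMap H.symbol hM) H.symbol :=
    ContinuousMap.ext fun x => (commute_sign (Commute.refl (H.symbol x))).symm
  exact h.map (blochRep D d)

theorem signOperator_commute_translation (r : Fin D → ℤ) :
    Commute (H.signOperator hM) (blochRep D d (monomialSymbol r 1)) := by
  have h : Commute (signMap H.symbol hM) (monomialSymbol r 1) :=
    ContinuousMap.ext fun x => (Commute.one_right _).smul_right (UnitAddTorus.mFourier r x)
  exact h.map (blochRep D d)

theorem isFundamentalSymmetry_signOperator :
    IsFundamentalSymmetry kreinOp (H.signOperator hM) where
  mul_self := by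
    have h : signMap H.symbol hM * signMap H.symbol hM = 1 :=
      ContinuousMap.ext fun x => (hM x).sign_mul_self
    rw [signOperator, ← map_mul, h, map_one]
  nonneg := by
    obtain ⟨R, hR⟩ := exists_star_mul_self_eq (.const _ (tau d) * signMap H.symbol hM)
      fun x => (hM x).isFundamentalSymmetry_sign.nonneg
    rw [signOperator, ← blochRep_tau, ← map_mul, ← hR, map_mul, map_star]
    exact star_mul_self_nonneg _

/-- The operator `-conjOp S` is a fundamental symmetry that commutes with the sign operator `S`. -/
theorem conjOp_signOperator : conjOp (H.signOperator hM) = -H.signOperator hM := by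
  have hS := H.isFundamentalSymmetry_signOperator hM
  have hSc : IsFundamentalSymmetry kreinOp (-conjOp (H.signOperator hM)) := by
    refine ⟨by rw [neg_mul_neg, ← conjOp_mul, hS.mul_self, conjOp_one], ?_⟩
    have := conjOp_nonneg hS.nonneg
    rwa [conjOp_mul, conjOp_kreinOp, neg_mul, ← mul_neg] at this
  have hcomm : Commute (-conjOp (H.signOperator hM)) (H.signOperator hM) := by
    refine H.commute_signOperator hM ?_ fun r => ?_
    · have := congrArg conjOp (H.signOperator_commute_symbol hM).eq
      rw [conjOp_mul, conjOp_mul, conjOp_blochRep_symbol, mul_neg, neg_mul] at this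
      exact Commute.neg_left (neg_injective this)
    · have := congrArg conjOp (H.signOperator_commute_translation hM r).eq
      rw [conjOp_mul, conjOp_mul, conjOp_blochRep_translation] at this
      exact Commute.neg_left this
  rw [← neg_eq_iff_eq_neg, hSc.eq_of_commute hS kreinOp_mul_self hcomm]

end SignOperator

theorem exists_translationInvariant_qpv
    (hst : ∀ k ∈ brillouinZone D, IsStronglyStable (H.bloch k)) :
    ∃ ω₀ : CCRState (LatticeMode D d), H.IsQPV ω₀ ∧ ω₀.TranslationInvariant ∧
      (∀ ω, H.IsQPV ω → ω.TranslationInvariant → ω = ω₀) ∧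
      (0 < H.indirectKreinGap → ∀ ω, H.IsQPV ω → ω = ω₀) := by
  have hM := H.isStronglyStable_symbol hst
  have hS := H.isFundamentalSymmetry_signOperator hM
  have hSc := H.conjOp_signOperator hM
  obtain ⟨T₀, hT₀⟩ := Bogoliubov.exists_symmetry_eq hS hSc
  obtain ⟨ω₀, hω₀⟩ := T₀.exists_isVacuumOf
  have huniq {ω : CCRState (LatticeMode D d)} {T : Bogoliubov (LatticeMode D d)}
      (hT : ω.IsVacuumOf T.symmetry) (hcomm : Commute T.symmetry (H.signOperator hM)) :
      ω = ω₀ := by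
    have hTS := T.isFundamentalSymmetry_symmetry.eq_of_commute hS kreinOp_mul_self hcomm
    exact CCRState.IsVacuumOf.unique hS.mul_self hSc (hTS ▸ hT) (hT₀ ▸ hω₀)
  refine ⟨ω₀, ⟨(CCRState.isQuasiparticleVacuum_iff ω₀).2 ⟨T₀, hω₀⟩,
    (H.isEigenstate_iff_commute hω₀).2 (hT₀ ▸ H.signOperator_commute_symbol hM)⟩,
    (translationInvariant_iff_commute hω₀).2 (hT₀ ▸ H.signOperator_commute_translation hM), ?_, ?_⟩
  · rintro ω ⟨hω, hE⟩ ht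
    obtain ⟨T, hT⟩ := (CCRState.isQuasiparticleVacuum_iff ω).1 hω
    exact huniq hT (H.commute_signOperator hM ((H.isEigenstate_iff_commute hT).1 hE)
      ((translationInvariant_iff_commute hT).1 ht))
  · rintro hgap ω ⟨hω, hE⟩
    obtain ⟨T, hT⟩ := (CCRState.isQuasiparticleVacuum_iff ω).1 hω
    exact huniq hT (H.commute_signOperator_of_indirectKreinGap_pos hM hgap
      ((H.isEigenstate_iff_commute hT).1 hE))

end QBH

end

theorem theorem1 {D d : ℕ} (H : QBH D d) (hH : H.DynamicallyStable) :
    (0 < H.indirectKreinGap →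
      (∃! ω : CCRState (LatticeMode D d), H.IsQPV ω) ∧
        ∀ ω : CCRState (LatticeMode D d), H.IsQPV ω → ω.TranslationInvariant) ∧
    (0 < H.kreinGap →
      ∃! ω : CCRState (LatticeMode D d), H.IsQPV ω ∧ ω.TranslationInvariant) := by
  constructor
  · intro h
    obtain ⟨ω₀, hω₀, ht, -, huniq⟩ := H.exists_translationInvariant_qpv fun _ hk =>
      H.isStronglyStable_bloch_of_indirectKreinGap_pos hH h hk
    exact ⟨⟨ω₀, hω₀, huniq h⟩, fun ω hω => huniq h ω hω ▸ ht⟩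
  · intro h
    obtain ⟨ω₀, hω₀, ht, huniq, -⟩ := H.exists_translationInvariant_qpv fun _ hk =>
      H.isStronglyStable_bloch_of_kreinGap_pos hH h hk
    exact ⟨ω₀, ⟨hω₀, ht⟩, fun ω hω => huniq ω hω.1 hω.2⟩
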